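/- Let $K$ be a Henselian discretely valued field with ring of integers $\mathcal O_K$ and perfect residue field $k$, and fix an algebraic closure $\overline K$ of $K$. A finite extension $M/K$ inside $\overline K$ is unramified if $\mathcal O_M$, the integral closure of $\mathcal O_K$ in $M$, is unramified over $\mathcal O_K$; then $\mathcal O_M$ is a discrete valuation ring. Let $E/K$ be an elliptic curve. For $M=K$ or $M/K$ finite unramified, let $E^0(M)\subset E(M)$ be the set (in fact subgroup) of points with non-singular reduction on a minimal Weierstrass equation of $E$ over $\mathcal O_M$. We say that $E$ has split reduction over $M$ if one of the following holds: 1. $E/M$ has good reduction; 2. $E/M$ has split multiplicative reduction, i.e. the slopes of the tangent lines at the node are in the residue field of $M$; 3. $E/M$ has additive reduction and all components of the geometric special fibre of the minimal proper regular model of $E$ over $\mathcal O_M$ are defined over the residue field of $M$; equivalently, $\mathrm{Gal}(M^{un}/M)$ acts trivially on the component group $E(M^{un})/E^0(M^{un})$, where $M^{un}\subset\overline K$ is the maximal unramified extension of $M$ and $E^0(M^{un})$ is the union of the $E^0(M')$ over the finite unramified extensions $M'/K$ containing $M$. Let $L\subset\overline K$ be the smallest finite unramified extension of $K$ over which $E$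 has split reduction. Then $L/K$ is Galois, and the norm map $$\mathrm{Norm}_{L/K}\colon E(L)\to E(K),\qquad Q\mapsto \sum_{\sigma\in \mathrm{Gal}(L/K)} Q^{\sigma},$$ maps $E^0(L)$ into $E^0(K)$, and the induced map $E^0(L)\to E^0(K)$ is surjective. -/

import Mathlib

namespace UnramifiedNorm

open WeierstrassCurve

/-! ### Finite unramified extensions -/

/-- Let `O` be a Henselian discrete valuation ring with fraction field `K`. A field extension `L` of
`K` is *finite unramified* if it is finite, and its ring of integers `O_L` (the integral closure of
`O` in `L`) is a discrete valuation ring which is unramified over `O`, that is, `Ω_{O_L/O} = 0`: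
a uniformiser of `O` is a uniformiser of `O_L` and the residue field extension is separable. -/
structure IsFiniteUnramified (O K L : Type*) [CommRing O] [Field K] [Field L]
    [Algebra K L] [Algebra O L] : Prop where
  finiteDimensional : FiniteDimensional K L
  isDiscreteValuationRing : IsDiscreteValuationRing (integralClosure O L)
  formallyUnramified : Algebra.FormallyUnramified O (integralClosure O L)

theorem IsFiniteUnramified.isFractionRing {O K L : Type*} [CommRing O] [IsDomain O] [Field K]
    [Algebra O K] [IsFractionRing O K] [Field L] [Algebra K L] [Algebra O L] [IsScalarTower O K L]
    (h : IsFiniteUnramified O K L) : IsFractionRing (integralClosure O L) L :=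
  haveI := h.finiteDimensional
  integralClosure.isFractionRing_of_finite_extension K L

/-! ### Points with nonsingular reduction -/

section NonsingularReduction

variable (R : Type*) [CommRing R] [IsDomain R] [IsDiscreteValuationRing R]
  {F : Type*} [Field F] [Algebra R F] [IsFractionRing R F]

/-- For an elliptic curve `W` over the fraction field `F` of a discrete valuation ring `R`, the set
`W⁰(F)` of `F`-rational points with nonsingular reduction. One passes to a minimal Weierstrass
equation `C • W` of `W`, on which the point `(x, y)` of `W` has the coordinates
`x' = u⁻² (x - r)` and `y' = u⁻³ (y - s (x - r) - t)`. The point at infinity belongs to the set, and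
so does every point whose coordinates `x', y'` do not both lie in `R`, since it reduces to the point
at infinity, which is nonsingular. A point with `x', y'` in `R` belongs to the set if and only if
its reduction is a nonsingular point of the reduced curve. -/
def E0 (W : WeierstrassCurve F) : Set W.toAffine.Point :=
  {P | ∃ (C : VariableChange F) (_ : IsMinimal R (C • W)),
    ∀ (x y : F) (h : W.toAffine.Nonsingular x y), P = .some x y h →
      ∀ a b : R,
        algebraMap R F a = (C.u⁻¹ : Fˣ) ^ 2 * (x - C.r) →
        algebraMap R F b = (C.u⁻¹ : Fˣ) ^ 3 * (y - C.s * (x - C.r) - C.t) →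
        ((C • W).reduction R).toAffine.Nonsingular
          (IsLocalRing.residue R a) (IsLocalRing.residue R b)}

end NonsingularReduction

/-- The set `E⁰(L)`, for a finite unramified extension `L` of `K`. -/
def IsFiniteUnramified.E0 {O K L : Type*} [CommRing O] [IsDomain O] [Field K] [Algebra O K]
    [IsFractionRing O K] [Field L] [Algebra K L] [Algebra O L] [IsScalarTower O K L]
    (hL : IsFiniteUnramified O K L) (E : WeierstrassCurve K) :
    Set (E.baseChange L).toAffine.Point :=
  haveI := hL.isDiscreteValuationRing
  haveI := hL.isFractionRing
  UnramifiedNorm.E0 (integralClosure O L) (E.baseChange L)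

/-! ### Split reduction -/

section Split

variable {O K Kbar : Type*} [CommRing O] [IsDomain O] [Field K] [Algebra O K] [IsFractionRing O K]
  [Field Kbar] [Algebra K Kbar] [Algebra O Kbar] [IsScalarTower O K Kbar]

open scoped Classical in
/-- The absolute Galois group of the residue field of `L` acts trivially on the component group
`E(L^un) / E⁰(L^un)`, i.e. on the multiplicity one components of the geometric special fibre of the
minimal proper regular model of `E` over `O_L`. The maximal unramified extension `L^un` is written
as the union of the finite unramified extensions `M` of `K` that contain `L`. -/
def GaloisActsTriviallyOnComponents (O : Type*) [CommRing O] [IsDomain O] [Algebra O K]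
    [IsFractionRing O K] [Algebra O Kbar] [IsScalarTower O K Kbar]
    (E : WeierstrassCurve K) (L : IntermediateField K Kbar) : Prop :=
  ∀ (M : IntermediateField K Kbar) (hM : IsFiniteUnramified O K M), L ≤ M →
    ∀ σ : M ≃ₐ[K] M, (∀ x : M, (x : Kbar) ∈ L → σ x = x) →
      ∀ P : (E.baseChange M).toAffine.Point,
        Affine.Point.map (W' := E) σ.toAlgHom P - P ∈ hM.E0 E

/-- `E` has *split reduction* over the finite unramified extension `L` of `K`: a minimal Weierstrass
equation of `E` over `O_L` has good reduction, or split multiplicative reduction (the slopes of the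
tangent lines at the node lie in the residue field of `L`), or it has additive reduction and all
components of the geometric special fibre of the minimal proper regular model are defined over the
residue field of `L`. For each additive Kodaira type, an automorphism of the configuration of
components that fixes each multiplicity one component fixes every component, so that the last
condition can be read off from the component group. -/
def HasSplitReduction (E : WeierstrassCurve K) (L : IntermediateField K Kbar)
    (hL : IsFiniteUnramified O K L) : Prop :=
  haveI := hL.isDiscreteValuationRing
  haveI := hL.isFractionRing
  (∃ C : VariableChange L, HasGoodReduction (integralClosure O L) (C • E.baseChange L)) ∨
  (∃ C : VariableChange L,
    HasSplitMultiplicativeReduction (integralClosure O L) (C • E.baseChange L)) ∨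
  ((∃ C : VariableChange L, HasAdditiveReduction (integralClosure O L) (C • E.baseChange L)) ∧
    GaloisActsTriviallyOnComponents O E L)

/-- `L` is the smallest finite unramified extension of `K` inside the algebraic closure `Kbar` over
which `E` has split reduction. -/
def IsSmallestSplitting (O : Type*) [CommRing O] [IsDomain O] [Algebra O K]
    [IsFractionRing O K] [Algebra O Kbar] [IsScalarTower O K Kbar]
    (E : WeierstrassCurve K) (L : IntermediateField K Kbar) : Prop :=
  IsLeast {M : IntermediateField K Kbar |
    ∃ hM : IsFiniteUnramified O K M, HasSplitReduction E M hM} L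

end Split

/-! ### The norm map -/

section Norm

variable {K : Type*} [Field K] (E : WeierstrassCurve K) (L : Type*) [Field L] [Algebra K L]
  [FiniteDimensional K L]

open scoped Classical in
/-- The sum `∑ σ, σ(Q)` of the Galois conjugates of `Q ∈ E(L)`, as a point of `E(L)`. -/
noncomputable def conjugatesSum :
    (E.baseChange L).toAffine.Point →+ (E.baseChange L).toAffine.Point :=
  ∑ σ : L ≃ₐ[K] L, Affine.Point.map (W' := E) σ.toAlgHom

variable {L} in
open scoped Classical in
theorem exists_baseChange_eq [IsGalois K L] (P : (E.baseChange L).toAffine.Point)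
    (hP : ∀ σ : L ≃ₐ[K] L, Affine.Point.map (W' := E) σ.toAlgHom P = P) :
    ∃ P₀ : (E.baseChange K).toAffine.Point, Affine.Point.baseChange (W' := E) K L P₀ = P := by
  rcases P with _ | ⟨x, y, h⟩
  · exact ⟨0, rfl⟩
  · have key : ∀ σ : L ≃ₐ[K] L, σ x = x ∧ σ y = y := fun σ ↦ by
      have := hP σ
      rw [Affine.Point.map_some] at this
      simpa using this
    obtain ⟨x₀, rfl⟩ := (IsGalois.mem_range_algebraMap_iff_fixed x).mpr fun σ ↦ (key σ).1
    obtain ⟨y₀, rfl⟩ := (IsGalois.mem_range_algebraMap_iff_fixed y).mpr fun σ ↦ (key σ).2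
    have h₀ : (E.baseChange K).toAffine.Nonsingular x₀ y₀ :=
      (Affine.baseChange_nonsingular (W := E) (f := Algebra.ofId K L)
        (Algebra.ofId K L).injective ..).mp h
    exact ⟨.some x₀ y₀ h₀, rfl⟩

open scoped Classical in
theorem map_conjugatesSum (τ : L ≃ₐ[K] L) (Q : (E.baseChange L).toAffine.Point) :
    Affine.Point.map (W' := E) τ.toAlgHom (conjugatesSum E L Q) = conjugatesSum E L Q := by
  simp only [conjugatesSum, AddMonoidHom.finsetSum_apply, map_sum]
  exact Fintype.sum_equiv (Equiv.mulLeft τ) _ _ fun σ ↦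
    Affine.Point.map_map (W' := E) σ.toAlgHom τ.toAlgHom Q

open scoped Classical in
/-- The norm map `E(L) → E(K)` of a finite Galois extension `L/K`: the norm of `Q` is the point of
`E(K)` whose image in `E(L)` is the sum of all the Galois conjugates of `Q`. -/
noncomputable def norm [IsGalois K L] :
    (E.baseChange L).toAffine.Point →+ (E.baseChange K).toAffine.Point where
  toFun Q := (exists_baseChange_eq E _ fun τ ↦ map_conjugatesSum E L τ Q).choose
  map_zero' := Affine.Point.map_injective (W' := E) (Algebra.ofId K L) <| by
    rw [(exists_baseChange_eq E _ fun τ ↦ map_conjugatesSum E L τ 0).choose_spec, _root_.map_zero,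
      _root_.map_zero]
  map_add' P Q := Affine.Point.map_injective (W' := E) (Algebra.ofId K L) <| by
    rw [(exists_baseChange_eq E _ fun τ ↦ map_conjugatesSum E L τ (P + Q)).choose_spec,
      _root_.map_add, _root_.map_add,
      (exists_baseChange_eq E _ fun τ ↦ map_conjugatesSum E L τ P).choose_spec,
      (exists_baseChange_eq E _ fun τ ↦ map_conjugatesSum E L τ Q).choose_spec]

open scoped Classical in
theorem baseChange_norm [IsGalois K L] (Q : (E.baseChange L).toAffine.Point) :
    Affine.Point.baseChange (W' := E) K L (norm E L Q) =
      ∑ σ : L ≃ₐ[K] L, Affine.Point.map (W' := E) σ.toAlgHom Q := by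
  rw [← AddMonoidHom.finsetSum_apply]
  exact (exists_baseChange_eq E _ fun τ ↦ map_conjugatesSum E L τ Q).choose_spec

end Norm

end UnramifiedNorm

/-!
Let `v` be the valuation of `L`, and `W` a minimal equation of `E` over `K`. It stays minimal over
`L`, since a change of variables that would improve it descends to `K` by taking traces
(`IsHenselianUnramified.minimalCurve_baseChange`), so `E⁰(K)` consists of the points of `E(K)`
that lie in `E⁰(L)`.

`L/K` is Galois: a `K`-automorphism `σ` of the algebraic closure carries everything that enters
into split reduction over `L` to the corresponding objects over `σ L`, so `L ⊆ σ L` by minimality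
(`IsSmallestSplitting.isGalois`).

If `L = K`, the norm is the identity. Otherwise the reduction of `W` is singular. As the residue
field `k` is perfect, the singular point is rational over `k` and can be moved to the origin over
`K` (`IsSmallestSplitting.exists_singularAtOrigin`). Then `E⁰(L)` is the set of points whose
coordinates are not both in the maximal ideal. It is a group because a line through two such
points meets the curve again outside the origin of the reduction (`awaySubgroup`), and it is
stable under the Galois group. Hence the norm maps `E⁰(L)` into `E⁰(K)`. There remain two cases
for its surjectivity.

*Cusp.* One may assume that `W` reduces to `y² = x³`, whose smooth locus is the additive group. It
suffices to treat `P` in `E⁰(K)` reducing to an affine point, since a point in the kernel of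
reduction is the difference of two of these. On the level of reductions, the trace of `L/K` gives
a point `q` over the residue field of `L` whose conjugates are distinct and have sum `P`. The
function with simple zeros at these conjugates and at `-P` lifts to a function `A(x) + y B(x)` on
`W` over `K` that vanishes at `-P`, and Hensel's lemma lifts `q` to a zero `Q` of it. So the
divisor of zeros consists of `-P` and the conjugates of `Q`, which means that `P` is the norm of
`Q` (`IsHenselianUnramified.exists_sum_eq_of_cusp`, with `sum_eq_zero_of_eval_eq_zero` for the
last step).

*Node.* The reduction is split multiplicative over `L`, so the slope of a tangent line at the node
lifts to an element `α` of `L`, and `E` has split reduction over `K(α)`. Hence `L = K(α)` is a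
quadratic extension whose automorphism `τ` exchanges the two tangent lines
(`IsSmallestSplitting.eq_adjoin_slope`). The function `(y - α x) / (y - τ(α) x)` induces a
homomorphism from `E⁰(L)` to the units of the residue field of `L` whose kernel is the kernel of
reduction. It maps `E⁰(K)` to elements of norm one, and the norm from `E⁰(L)` corresponds to `w ↦
w / τ(w)`. So Hilbert's theorem 90 shows that each `P` in `E⁰(K)` is a norm up to the kernel of
reduction. The latter is `E⁰` of the equation scaled by a uniformiser, whose reduction is `y² =
x³`, so that the previous case applies (`IsHenselianUnramified.exists_norm_eq_of_node`).

The valuation-theoretic facts that these arguments use are collected in `IsHenselianUnramified`.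
They are derived from the definition of finite unramified extensions and the Henselian property of
`O`, which passes to the integral closure of `O` in `L` (`henselianLocalRing_integralClosure`).
-/

namespace UnramifiedNorm

open WeierstrassCurve

/-! ### Changes of variables on points -/

section VariableChange

variable {F : Type*} [Field F]

/-- The `x`-coordinate on `C • W` of the point of `W` with coordinates `(x, y)`. -/
def coordX (C : VariableChange F) (x : F) : F := (C.u⁻¹ : Fˣ) ^ 2 * (x - C.r)

/-- The `y`-coordinate on `C • W` of the point of `W` with coordinates `(x, y)`. -/
def coordY (C : VariableChange F) (x y : F) : F :=
  (C.u⁻¹ : Fˣ) ^ 3 * (y - C.s * (x - C.r) - C.t)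

theorem coordX_mul (C D : VariableChange F) (x : F) :
    coordX (C * D) x = coordX C (coordX D x) := by
  have h : (D.u : F) * (D.u⁻¹ : Fˣ) = 1 := D.u.mul_inv
  simp only [coordX, VariableChange.mul_def, mul_inv, Units.val_mul]
  linear_combination (-(C.u⁻¹ : Fˣ) ^ 2 * C.r * (D.u * (D.u⁻¹ : Fˣ) + 1 : F)) * h

theorem coordY_mul (C D : VariableChange F) (x y : F) :
    coordY (C * D) x y = coordY C (coordX D x) (coordY D x y) := by
  have h : (D.u : F) = (D.u⁻¹ : Fˣ).val⁻¹ := by simp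
  have h0 : (D.u⁻¹ : Fˣ).val ≠ 0 := Units.ne_zero _
  simp only [coordX, coordY, VariableChange.mul_def, mul_inv, Units.val_mul, h]
  generalize (D.u⁻¹ : Fˣ).val = d at *
  generalize (C.u⁻¹ : Fˣ).val = c at *
  field_simp
  ring

theorem coordX_one (x : F) : coordX 1 x = x := by simp [coordX, VariableChange.one_def]

theorem coordY_one (x y : F) : coordY 1 x y = y := by simp [coordY, VariableChange.one_def]

variable (W : WeierstrassCurve F) (C : VariableChange F)

theorem equation_coord {x y : F} (h : W.toAffine.Equation x y) :
    (C • W).toAffine.Equation (coordX C x) (coordY C x y) := by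
  rw [Affine.equation_iff] at h ⊢
  simp only [variableChange_def, coordX, coordY]
  linear_combination (C.u⁻¹ : Fˣ).val ^ 6 * h

theorem nonsingular_coord {x y : F} (h : W.toAffine.Nonsingular x y) :
    (C • W).toAffine.Nonsingular (coordX C x) (coordY C x y) := by
  rw [Affine.nonsingular_iff'] at h ⊢
  refine ⟨equation_coord W C h.1, ?_⟩
  by_contra! hc
  have hu : (C.u⁻¹ : Fˣ).val ≠ 0 := Units.ne_zero _
  have e1 : 2 * y + W.a₁ * x + W.a₃ = 0 := by
    refine (mul_eq_zero.mp (?_ : (C.u⁻¹ : Fˣ).val ^ 3 * (2 * y + W.a₁ * x + W.a₃) = 0)).resolve_left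
      (pow_ne_zero _ hu)
    rw [← hc.2]
    simp only [variableChange_def, coordX, coordY]
    ring
  have e2 : W.a₁ * y - (3 * x ^ 2 + 2 * W.a₂ * x + W.a₄) = 0 := by
    refine (mul_eq_zero.mp (?_ : (C.u⁻¹ : Fˣ).val ^ 4 *
      (W.a₁ * y - (3 * x ^ 2 + 2 * W.a₂ * x + W.a₄)) = 0)).resolve_left (pow_ne_zero _ hu)
    rw [← hc.1]
    simp only [variableChange_def, coordX, coordY]
    linear_combination (- (C.u⁻¹ : Fˣ).val ^ 4 * C.s) * e1
  exact h.2.elim (· e2) (· e1)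

theorem nonsingular_coord_iff {x y : F} :
    (C • W).toAffine.Nonsingular (coordX C x) (coordY C x y) ↔ W.toAffine.Nonsingular x y := by
  refine ⟨fun h ↦ ?_, nonsingular_coord W C⟩
  simpa [← coordX_mul, ← coordY_mul, coordX_one, coordY_one] using nonsingular_coord _ C⁻¹ h

theorem coordX_injective : Function.Injective (coordX C) := fun a b h ↦ by
  simpa [coordX] using h

theorem coordY_injective (x : F) : Function.Injective (coordY C x) := fun a b h ↦ by
  simpa [coordY] using h

theorem negY_coord (x y : F) : (C • W).toAffine.negY (coordX C x) (coordY C x y) =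
    coordY C x (W.toAffine.negY x y) := by
  simp only [Affine.negY, coordX, coordY, variableChange_def]
  ring

theorem slope_coord [DecidableEq F] {x₁ x₂ y₁ y₂ : F} (h₁ : W.toAffine.Equation x₁ y₁)
    (h₂ : W.toAffine.Equation x₂ y₂)
    (hxy : ¬(x₁ = x₂ ∧ y₁ = W.toAffine.negY x₂ y₂)) :
    (C • W).toAffine.slope (coordX C x₁) (coordX C x₂) (coordY C x₁ y₁) (coordY C x₂ y₂) =
      (C.u⁻¹ : Fˣ) * (W.toAffine.slope x₁ x₂ y₁ y₂ - C.s) := by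
  have hu : (C.u⁻¹ : Fˣ).val ≠ 0 := Units.ne_zero _
  by_cases hx : x₁ = x₂
  · subst hx
    have hy : y₁ ≠ W.toAffine.negY x₁ y₂ := fun h ↦ hxy ⟨rfl, h⟩
    have hyy : y₁ = y₂ := Affine.Y_eq_of_Y_ne h₁ h₂ rfl hy
    subst hyy
    rw [Affine.slope_of_Y_ne rfl hy, Affine.slope_of_Y_ne rfl (by
      rw [negY_coord]; exact fun h ↦ hy (coordY_injective C _ h)), negY_coord]
    have h0 : y₁ - W.toAffine.negY x₁ y₁ ≠ 0 := sub_ne_zero.mpr hy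
    have h1 : coordY C x₁ y₁ - coordY C x₁ (W.toAffine.negY x₁ y₁) =
      (C.u⁻¹ : Fˣ).val ^ 3 * (y₁ - W.toAffine.negY x₁ y₁) := by simp only [coordY]; ring
    rw [h1, div_eq_iff (mul_ne_zero (pow_ne_zero _ hu) h0)]
    have h2 : ∀ a b c : F, c ≠ 0 → ∀ u s : F, u * (a / c - s) * (u ^ 3 * c) = u ^ 4 * (a - s * c) := by
      intro a b c hc u s
      field_simp
    rw [h2 _ 0 _ h0]
    simp only [Affine.negY, coordX, coordY, variableChange_def]
    ring
  · rw [Affine.slope_of_X_ne hx, Affine.slope_of_X_ne fun h ↦ hx (coordX_injective C h)]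
    have h0 : x₁ - x₂ ≠ 0 := sub_ne_zero.mpr hx
    have h1 : coordX C x₁ - coordX C x₂ = (C.u⁻¹ : Fˣ).val ^ 2 * (x₁ - x₂) := by
      simp only [coordX]; ring
    rw [h1, div_eq_iff (mul_ne_zero (pow_ne_zero _ hu) h0)]
    simp only [coordY]
    field_simp
    ring

open scoped Classical in
/-- The isomorphism from `W(F)` to `W'(F)` given by a change of variables `C` with `C • W = W'`. -/
noncomputable def pointHom {W W' : WeierstrassCurve F} (C : VariableChange F) (h : C • W = W') :
    W.toAffine.Point →+ W'.toAffine.Point where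
  toFun P := match P with
    | .zero => 0
    | .some x y hP => .some (coordX C x) (coordY C x y) (h ▸ nonsingular_coord W C hP)
  map_zero' := rfl
  map_add' := by
    subst h
    rintro (_ | ⟨x₁, y₁, h₁⟩) (_ | ⟨x₂, y₂, h₂⟩)
    any_goals rfl
    by_cases hxy : x₁ = x₂ ∧ y₁ = W.toAffine.negY x₂ y₂
    · rw [Affine.Point.add_of_Y_eq hxy.1 hxy.2]
      exact (Affine.Point.add_of_Y_eq (by rw [hxy.1])
        (by rw [hxy.1, hxy.2, negY_coord])).symm
    · have hxy' : ¬(coordX C x₁ = coordX C x₂ ∧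
          coordY C x₁ y₁ = (C • W).toAffine.negY (coordX C x₂) (coordY C x₂ y₂)) := by
        rintro ⟨hx, hy⟩
        obtain rfl := coordX_injective C hx
        rw [negY_coord] at hy
        exact hxy ⟨rfl, coordY_injective C _ hy⟩
      have hX : (C • W).toAffine.addX (coordX C x₁) (coordX C x₂)
          ((C.u⁻¹ : Fˣ) * (W.toAffine.slope x₁ x₂ y₁ y₂ - C.s)) =
          coordX C (W.toAffine.addX x₁ x₂ (W.toAffine.slope x₁ x₂ y₁ y₂)) := by
        simp only [Affine.addX, coordX, variableChange_def]
        ring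
      have hY : (C • W).toAffine.addY (coordX C x₁) (coordX C x₂) (coordY C x₁ y₁)
          ((C.u⁻¹ : Fˣ) * (W.toAffine.slope x₁ x₂ y₁ y₂ - C.s)) =
          coordY C (W.toAffine.addX x₁ x₂ (W.toAffine.slope x₁ x₂ y₁ y₂))
            (W.toAffine.addY x₁ x₂ y₁ (W.toAffine.slope x₁ x₂ y₁ y₂)) := by
        rw [Affine.addY, Affine.negAddY, hX, Affine.addY, Affine.negAddY, ← negY_coord]
        congr 1
        simp only [coordX, coordY]
        ring
      rw [Affine.Point.add_some hxy]
      refine Eq.trans ?_ (Affine.Point.add_some hxy').symm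
      rw [Affine.Point.some.injEq]
      rw [slope_coord W C h₁.1 h₂.1 hxy, hX, hY]
      exact ⟨rfl, rfl⟩

theorem pointHom_some {W W' : WeierstrassCurve F} {C : VariableChange F} (h : C • W = W')
    {x y : F} (hP : W.toAffine.Nonsingular x y) :
    pointHom C h (.some x y hP) =
      .some (coordX C x) (coordY C x y) (h ▸ nonsingular_coord W C hP) := rfl

theorem pointHom_bijective {W W' : WeierstrassCurve F} {C : VariableChange F} (h : C • W = W') :
    Function.Bijective (pointHom C h) := by
  constructor
  · rintro (_ | ⟨x₁, y₁, h₁⟩) (_ | ⟨x₂, y₂, h₂⟩) he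
    · rfl
    · cases he
    · cases he
    · rw [pointHom_some, pointHom_some, Affine.Point.some.injEq] at he
      obtain rfl := coordX_injective C he.1
      obtain rfl := coordY_injective C _ he.2
      rfl
  · subst h
    rintro (_ | ⟨x, y, hP⟩)
    · exact ⟨0, rfl⟩
    · have e : coordX C (coordX C⁻¹ x) = x := by rw [← coordX_mul, mul_inv_cancel, coordX_one]
      have e' : coordY C (coordX C⁻¹ x) (coordY C⁻¹ x y) = y := by
        rw [← coordY_mul, mul_inv_cancel, coordY_one]
      refine ⟨.some (coordX C⁻¹ x) (coordY C⁻¹ x y) ?_, ?_⟩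
      · rw [← nonsingular_coord_iff W C, e, e']
        exact hP
      · rw [pointHom_some, Affine.Point.some.injEq]
        exact ⟨e, e'⟩

end VariableChange

/-! ### Points reducing away from a singular point at the origin -/

section Valuation

variable {F Γ₀ : Type*} [Field F] [LinearOrderedCommGroupWithZero Γ₀] (v : Valuation F Γ₀)

/-- The coefficients of `W` are integral for `v`, and `(0, 0)` is a singular point of the reduction
of `W`. -/
structure SingularAtOrigin (W : WeierstrassCurve F) : Prop where
  a₁ : v W.a₁ ≤ 1
  a₂ : v W.a₂ ≤ 1
  a₃ : v W.a₃ < 1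
  a₄ : v W.a₄ < 1
  a₆ : v W.a₆ < 1

/-- The points of `W` that do not reduce to the origin `(0, 0)`. -/
def awayFromOrigin (W : WeierstrassCurve F) : Set W.toAffine.Point :=
  {P | ∀ x y h, P = .some x y h → ¬(v x < 1 ∧ v y < 1)}

variable {v}

theorem some_mem_awayFromOrigin {W : WeierstrassCurve F} {x y : F} {h : W.toAffine.Nonsingular x y} :
    Affine.Point.some x y h ∈ awayFromOrigin v W ↔ ¬(v x < 1 ∧ v y < 1) := by
  refine ⟨fun H ↦ H x y h rfl, fun H a b h' e ↦ ?_⟩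
  rw [Affine.Point.some.injEq] at e
  rwa [← e.1, ← e.2]

theorem zero_mem_awayFromOrigin {W : WeierstrassCurve F} :
    (0 : W.toAffine.Point) ∈ awayFromOrigin v W := fun _ _ _ e ↦ by cases e

theorem map_mul_lt_one_left {a b : F} (ha : v a < 1) (hb : v b ≤ 1) : v (a * b) < 1 := by
  rw [map_mul]; exact (mul_le_of_le_one_right' hb).trans_lt ha

theorem map_mul_lt_one_right {a b : F} (ha : v a ≤ 1) (hb : v b < 1) : v (a * b) < 1 := by
  rw [map_mul]; exact (mul_le_of_le_one_left' ha).trans_lt hb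

theorem map_mul_le_one {a b : F} (ha : v a ≤ 1) (hb : v b ≤ 1) : v (a * b) ≤ 1 := by
  rw [map_mul]; exact mul_le_one' ha hb

theorem map_natCast_le_one (n : ℕ) : v (n : F) ≤ 1 := by
  induction n with
  | zero => simp
  | succ n ih => push_cast; exact v.map_add_le ih (by simp)

theorem map_ofNat_le_one (n : ℕ) [n.AtLeastTwo] : v (OfNat.ofNat n : F) ≤ 1 := by
  rw [← Nat.cast_ofNat]; exact map_natCast_le_one _

theorem map_pow_lt_one {a : F} (ha : v a < 1) {n : ℕ} (hn : n ≠ 0) : v (a ^ n) < 1 := by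
  rw [map_pow]; exact pow_lt_one₀ zero_le ha hn

theorem map_pow_le_one {a : F} (ha : v a ≤ 1) (n : ℕ) : v (a ^ n) ≤ 1 := by
  rw [map_pow]; exact pow_le_one₀ zero_le ha

/-- The line `y = l x + m` meets the cubic `W` exactly in the points with `x`-coordinates
`x₁`, `x₂`, `x₃`, counted with multiplicity. -/
structure IsLineSection (W : WeierstrassCurve F) (l m x₁ x₂ x₃ : F) : Prop where
  e₁ : x₁ + x₂ + x₃ = l ^ 2 + W.a₁ * l - W.a₂
  e₂ : x₁ * x₂ + x₁ * x₃ + x₂ * x₃ = W.a₄ - 2 * l * m - W.a₁ * m - W.a₃ * l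
  e₃ : x₁ * x₂ * x₃ = m ^ 2 + W.a₃ * m - W.a₆

variable {W : WeierstrassCurve F}

/-- If the second and third elementary symmetric functions of three elements reduce to zero, then
two of the three elements do, so that one of the first two does. -/
theorem exists_lt_one_of_product {x₁ x₂ x₃ : F} (h₁ : v x₁ ≤ 1) (h₂ : v x₂ ≤ 1)
    (e₂ : v (x₁ * x₂ + x₁ * x₃ + x₂ * x₃) < 1) (e₃ : v (x₁ * x₂ * x₃) < 1) :
    v x₁ < 1 ∨ v x₂ < 1 := by
  by_contra! hc
  have e1 : v x₁ = 1 := le_antisymm h₁ hc.1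
  have e2 : v x₂ = 1 := le_antisymm h₂ hc.2
  have e3 : v x₃ < 1 := by simpa [e1, e2] using e₃
  have : v (x₁ * x₂) < 1 := by
    have h : x₁ * x₂ = (x₁ * x₂ + x₁ * x₃ + x₂ * x₃) - (x₁ * x₃ + x₂ * x₃) := by ring
    rw [h]
    exact v.map_sub_lt e₂ (v.map_add_lt (map_mul_lt_one_right h₁ e3) (map_mul_lt_one_right h₂ e3))
  simp [e1, e2] at this

theorem le_one_of_cubic {c₀ c₁ c₂ x : F} (h₀ : v c₀ ≤ 1) (h₁ : v c₁ ≤ 1) (h₂ : v c₂ ≤ 1)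
    (h : x ^ 3 + c₂ * x ^ 2 + c₁ * x + c₀ = 0) : v x ≤ 1 := by
  by_contra! hx
  have hx0 : x ≠ 0 := by rintro rfl; simp at hx
  have hi : v x⁻¹ < 1 := by rw [map_inv₀]; exact inv_lt_one_of_one_lt₀ hx
  have : v (1 : F) < 1 := by
    have e : (1 : F) = -(x⁻¹ * (c₂ + x⁻¹ * (c₁ + x⁻¹ * c₀))) := by
      field_simp
      linear_combination h
    rw [e, Valuation.map_neg]
    exact map_mul_lt_one_left hi (v.map_add_le h₂ (map_mul_le_one hi.le
      (v.map_add_le h₁ (map_mul_le_one hi.le h₀))))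
  simp at this

/-- A line through two points that do not reduce to the origin does not pass through the origin
modulo the maximal ideal: a line through a singular point of a cubic meets the cubic there with
multiplicity at least two. -/
theorem IsLineSection.le_intercept (hW : SingularAtOrigin v W) {l m x₁ x₂ x₃ : F}
    (h : IsLineSection W l m x₁ x₂ x₃) (h₁ : ¬(v x₁ < 1 ∧ v (l * x₁ + m) < 1))
    (h₂ : ¬(v x₂ < 1 ∧ v (l * x₂ + m) < 1)) : 1 ≤ v m ∧ v l ≤ v m := by
  by_contra hc
  have hc : v m < 1 ∨ v m < v l := by
    rw [not_and_or, not_le, not_le] at hc; exact hc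
  have n2 : v (2 : F) ≤ 1 := map_ofNat_le_one 2
  have n3 : v (3 : F) ≤ 1 := map_ofNat_le_one 3
  by_cases hl : v l ≤ 1
  · have hm : v m < 1 := hc.elim id fun h ↦ h.trans_le hl
    have c₂ : v (x₁ + x₂ + x₃) ≤ 1 := by
      rw [h.e₁]
      exact v.map_sub_le (v.map_add_le (map_pow_le_one hl _) (map_mul_le_one hW.a₁ hl)) hW.a₂
    have c₁ : v (x₁ * x₂ + x₁ * x₃ + x₂ * x₃) < 1 := by
      rw [h.e₂]
      exact v.map_sub_lt (v.map_sub_lt (v.map_sub_lt hW.a₄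
        (map_mul_lt_one_right (map_mul_le_one n2 hl) hm)) (map_mul_lt_one_right hW.a₁ hm))
        (map_mul_lt_one_left hW.a₃ hl)
    have c₀ : v (x₁ * x₂ * x₃) < 1 := by
      rw [h.e₃]
      exact v.map_sub_lt (v.map_add_lt (map_pow_lt_one hm two_ne_zero)
        (map_mul_lt_one_left hW.a₃ hm.le)) hW.a₆
    have key : ∀ x : F, x = x₁ ∨ x = x₂ ∨ x = x₃ → v x ≤ 1 := by
      intro x hx
      refine le_one_of_cubic (c₂ := -(x₁ + x₂ + x₃)) (c₁ := x₁ * x₂ + x₁ * x₃ + x₂ * x₃)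
        (c₀ := -(x₁ * x₂ * x₃)) (by rw [Valuation.map_neg]; exact c₀.le) c₁.le
        (by rw [Valuation.map_neg]; exact c₂) ?_
      rcases hx with rfl | rfl | rfl <;> ring
    have on_line : ∀ x : F, v x < 1 → v (l * x + m) < 1 := fun x hx ↦
      v.map_add_lt (map_mul_lt_one_right hl hx) hm
    rcases exists_lt_one_of_product (key x₁ (by simp)) (key x₂ (by simp))
      c₁ c₀ with hx | hx
    · exact h₁ ⟨hx, on_line _ hx⟩
    · exact h₂ ⟨hx, on_line _ hx⟩
  · push Not at hl
    have hml : v m < v l := hc.elim (fun h ↦ h.trans hl) id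
    have hl0 : l ≠ 0 := by rintro rfl; simp at hl
    -- the line is `x = a y + b` with `a` and `b` in the maximal ideal
    obtain ⟨a, ha⟩ : ∃ a, a = l⁻¹ := ⟨_, rfl⟩
    obtain ⟨b, hb⟩ : ∃ b, b = -m * l⁻¹ := ⟨_, rfl⟩
    have hal : a * l = 1 := by rw [ha]; exact inv_mul_cancel₀ hl0
    have va : v a < 1 := by rw [ha, map_inv₀]; exact inv_lt_one_of_one_lt₀ hl
    have vb : v b < 1 := by
      rw [hb, map_mul, Valuation.map_neg, map_inv₀, ← div_eq_mul_inv]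
      exact (div_lt_one₀ (zero_lt_one.trans hl)).mpr hml
    have hm' : m = -b * l := by rw [hb]; field_simp
    have hx : ∀ x, x = a * (l * x + m) + b := fun x ↦ by
      rw [hm']; linear_combination (b - x) * hal
    obtain ⟨y₁, hy₁⟩ : ∃ y, y = l * x₁ + m := ⟨_, rfl⟩
    obtain ⟨y₂, hy₂⟩ : ∃ y, y = l * x₂ + m := ⟨_, rfl⟩
    obtain ⟨y₃, hy₃⟩ : ∃ y, y = l * x₃ + m := ⟨_, rfl⟩
    have hy : ∀ x, ¬(v x < 1 ∧ v (l * x + m) < 1) → 1 ≤ v (l * x + m) := fun x H ↦ by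
      by_contra! hlt
      refine H ⟨?_, hlt⟩
      rw [hx x]
      exact v.map_add_lt (map_mul_lt_one_left va hlt.le) vb
    have vy₁ : 1 ≤ v y₁ := hy₁ ▸ hy _ h₁
    have vy₂ : 1 ≤ v y₂ := hy₂ ▸ hy _ h₂
    -- the cubic polynomial in `y` cut out on the line, in terms of its roots
    have E₁ : a ^ 3 * (y₁ + y₂ + y₃) =
        1 + a * (W.a₁ - a * W.a₂ - 3 * a * b) := by
      have := h.e₁
      rw [hy₁, hy₂, hy₃, hm']
      linear_combination a ^ 3 * l * this + (W.a₁ * a * (1 + a * l) - W.a₂ * a ^ 2 - 3 * a ^ 2 * b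
        + (a ^ 2 * l ^ 2 + a * l + 1)) * hal
    have E₂ : a ^ 3 * (y₁ * y₂ + y₁ * y₃ + y₂ * y₃) =
        b * (3 * a * b + 2 * a * W.a₂ - W.a₁) + (W.a₄ * a - W.a₃) := by
      have h1 := h.e₁
      have h2 := h.e₂
      rw [hm'] at h2
      rw [hy₁, hy₂, hy₃, hm', ha]
      field_simp
      linear_combination h2 - 2 * b * h1
    have E₃ : a ^ 3 * (y₁ * y₂ * y₃) = - (b * (b ^ 2 + W.a₂ * b + W.a₄) + W.a₆) := by
      have h1 := h.e₁
      have h2 := h.e₂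
      have h3 := h.e₃
      rw [hm'] at h2 h3
      rw [hy₁, hy₂, hy₃, hm', ha]
      field_simp
      linear_combination h3 - b * h2 + b ^ 2 * h1
    have V₁ : v (a ^ 3 * (y₁ + y₂ + y₃)) = 1 := by
      rw [E₁]
      have : v (a * (W.a₁ - a * W.a₂ - 3 * a * b)) < 1 :=
        map_mul_lt_one_left va (v.map_sub_le (v.map_sub_le hW.a₁ (map_mul_le_one va.le hW.a₂))
          (map_mul_le_one (map_mul_le_one n3 va.le) vb.le))
      rw [v.map_add_eq_of_lt_left (by simpa using this)]
      simp
    have V₂ : v (a ^ 3 * (y₁ * y₂ + y₁ * y₃ + y₂ * y₃)) < 1 := by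
      rw [E₂]
      exact v.map_add_lt (map_mul_lt_one_left vb (v.map_sub_le (v.map_add_le
        (map_mul_le_one (map_mul_le_one n3 va.le) vb.le)
        (map_mul_le_one (map_mul_le_one n2 va.le) hW.a₂)) hW.a₁))
        (v.map_sub_lt (map_mul_lt_one_left hW.a₄ va.le) hW.a₃)
    have V₃ : v (a ^ 3 * (y₁ * y₂ * y₃)) < 1 := by
      rw [E₃, Valuation.map_neg]
      exact v.map_add_lt (map_mul_lt_one_left vb (v.map_add_le (v.map_add_le (map_pow_le_one vb.le _)
        (map_mul_le_one hW.a₂ vb.le)) hW.a₄.le)) hW.a₆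
    have a₃y : v (a ^ 3 * y₃) < 1 := by
      by_contra! hge
      refine V₃.not_ge ?_
      have : a ^ 3 * (y₁ * y₂ * y₃) = y₁ * y₂ * (a ^ 3 * y₃) := by ring
      rw [this, map_mul, map_mul]
      exact one_le_mul (one_le_mul vy₁ vy₂) hge
    have a12 : v (a ^ 3 * (y₁ + y₂)) = 1 := by
      have : a ^ 3 * (y₁ + y₂) = a ^ 3 * (y₁ + y₂ + y₃) - a ^ 3 * y₃ := by ring
      rw [this, v.map_sub_eq_of_lt_left (by rwa [V₁]), V₁]
    have a1y : 1 ≤ v (a ^ 3 * (y₁ * y₂)) := by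
      by_contra! hlt
      have hlt' : v (a ^ 3) * (v y₁ * v y₂) < 1 := by simpa using hlt
      have h1 : v (a ^ 3 * y₁) < 1 := by
        refine lt_of_le_of_lt ?_ hlt'
        rw [map_mul]
        exact mul_le_mul_right (le_mul_of_one_le_right' vy₂) _
      have h2 : v (a ^ 3 * y₂) < 1 := by
        refine lt_of_le_of_lt ?_ hlt'
        rw [map_mul]
        exact mul_le_mul_right (le_mul_of_one_le_left' vy₁) _
      have := v.map_add_lt h1 h2
      rw [← mul_add, a12] at this
      exact lt_irrefl _ this
    have vy₃ : v y₃ < 1 := by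
      by_contra! hge
      refine V₃.not_ge ?_
      rw [← mul_assoc, map_mul]
      exact one_le_mul a1y hge
    refine a1y.not_gt ?_
    have : a ^ 3 * (y₁ * y₂) = a ^ 3 * (y₁ * y₂ + y₁ * y₃ + y₂ * y₃) - a ^ 3 * (y₁ + y₂) * y₃ := by
      ring
    rw [this]
    exact v.map_sub_lt V₂ (map_mul_lt_one_right a12.le vy₃)

theorem isLineSection_slope [DecidableEq F] {x₁ x₂ y₁ y₂ : F} (h₁ : W.toAffine.Equation x₁ y₁)
    (h₂ : W.toAffine.Equation x₂ y₂) (hxy : ¬(x₁ = x₂ ∧ y₁ = W.toAffine.negY x₂ y₂)) :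
    IsLineSection W (W.toAffine.slope x₁ x₂ y₁ y₂) (y₁ - W.toAffine.slope x₁ x₂ y₁ y₂ * x₁) x₁ x₂
      (W.toAffine.addX x₁ x₂ (W.toAffine.slope x₁ x₂ y₁ y₂)) := by
  have h := Affine.addPolynomial_slope h₁ h₂ hxy
  rw [Affine.addPolynomial_eq, neg_inj, Cubic.prod_X_sub_C_eq, Cubic.toPoly_injective] at h
  obtain ⟨-, hb, hc, hd⟩ := Cubic.ext_iff.mp h
  dsimp only at hb hc hd
  constructor
  · linear_combination hb
  · linear_combination -hc
  · linear_combination hd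

theorem eq_slope_mul [DecidableEq F] {x₁ x₂ y₁ y₂ : F} (h₁ : W.toAffine.Equation x₁ y₁)
    (h₂ : W.toAffine.Equation x₂ y₂) (hxy : ¬(x₁ = x₂ ∧ y₁ = W.toAffine.negY x₂ y₂)) :
    y₂ = W.toAffine.slope x₁ x₂ y₁ y₂ * x₂ + (y₁ - W.toAffine.slope x₁ x₂ y₁ y₂ * x₁) := by
  by_cases hx : x₁ = x₂
  · subst hx
    rw [Affine.Y_eq_of_Y_ne h₁ h₂ rfl fun h ↦ hxy ⟨rfl, h⟩]
    ring
  · rw [Affine.slope_of_X_ne hx]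
    have : x₁ - x₂ ≠ 0 := sub_ne_zero.mpr hx
    field_simp
    ring

theorem neg_mem_awayFromOrigin (hW : SingularAtOrigin v W) {P : W.toAffine.Point}
    (hP : P ∈ awayFromOrigin v W) : -P ∈ awayFromOrigin v W := by
  rcases P with _ | ⟨x, y, h⟩
  · exact zero_mem_awayFromOrigin
  · rw [Affine.Point.neg_some, some_mem_awayFromOrigin]
    rw [some_mem_awayFromOrigin] at hP
    rintro ⟨hx, hy⟩
    refine hP ⟨hx, ?_⟩
    have : y = -(W.toAffine.negY x y + W.a₁ * x + W.a₃) := by simp only [Affine.negY]; ring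
    rw [this, Valuation.map_neg]
    exact v.map_add_lt (v.map_add_lt hy (map_mul_lt_one_right hW.a₁ hx)) hW.a₃

/-- The chord-tangent construction for two points that do not reduce to the origin and whose sum is
not zero: the line joining them, and its third point of intersection with the curve. -/
theorem exists_line_of_mem [DecidableEq F] (hW : SingularAtOrigin v W) {x₁ y₁ x₂ y₂ : F}
    {h₁ : W.toAffine.Nonsingular x₁ y₁} {h₂ : W.toAffine.Nonsingular x₂ y₂}
    (hxy : ¬(x₁ = x₂ ∧ y₁ = W.toAffine.negY x₂ y₂))
    (m₁ : Affine.Point.some x₁ y₁ h₁ ∈ awayFromOrigin v W)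
    (m₂ : Affine.Point.some x₂ y₂ h₂ ∈ awayFromOrigin v W) :
    ∃ l m x₃ h₃, Affine.Point.some x₁ y₁ h₁ + Affine.Point.some x₂ y₂ h₂ =
        - Affine.Point.some x₃ (l * x₃ + m) h₃ ∧
      IsLineSection W l m x₁ x₂ x₃ ∧ y₁ = l * x₁ + m ∧ y₂ = l * x₂ + m ∧
      1 ≤ v m ∧ v l ≤ v m ∧ Affine.Point.some x₃ (l * x₃ + m) h₃ ∈ awayFromOrigin v W := by
  rw [some_mem_awayFromOrigin] at m₁ m₂
  have hs := isLineSection_slope h₁.1 h₂.1 hxy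
  have hy₂ := eq_slope_mul h₁.1 h₂.1 hxy
  set l := W.toAffine.slope x₁ x₂ y₁ y₂ with hl
  set m := y₁ - l * x₁ with hm
  have hy₁ : y₁ = l * x₁ + m := by rw [hm]; ring
  have hv := hs.le_intercept hW (hy₁ ▸ m₁) (hy₂ ▸ m₂)
  have hy₃ : W.toAffine.negAddY x₁ x₂ y₁ l = l * W.toAffine.addX x₁ x₂ l + m := by
    rw [Affine.negAddY, hm]; ring
  have h₃ := Affine.nonsingular_negAdd h₁ h₂ hxy
  rw [← hl, hy₃] at h₃
  refine ⟨l, m, W.toAffine.addX x₁ x₂ l, h₃, ?_, hs, hy₁, hy₂, hv.1, hv.2, ?_⟩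
  · rw [Affine.Point.add_some hxy, Affine.Point.neg_some, Affine.Point.some.injEq]
    refine ⟨rfl, ?_⟩
    rw [Affine.addY, ← hl, hy₃]
  · rw [some_mem_awayFromOrigin]
    rintro ⟨hx, hy⟩
    -- the intercept `m = (l x + m) - l x` would be smaller than `max 1 |l|`
    have e : m = (l * W.toAffine.addX x₁ x₂ l + m) - l * W.toAffine.addX x₁ x₂ l := by ring
    have : v m < v m := by
      conv_lhs => rw [e]
      refine v.map_sub_lt (hy.trans_le hv.1) ?_
      rw [map_mul]
      rcases eq_or_ne (v l) 0 with h0 | h0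
      · rw [h0, zero_mul]; exact zero_lt_one.trans_le hv.1
      · exact (mul_lt_of_lt_one_right (zero_lt_iff.mpr h0) hx).trans_le hv.2
    exact lt_irrefl _ this

open scoped Classical in
theorem add_mem_awayFromOrigin (hW : SingularAtOrigin v W) {P Q : W.toAffine.Point}
    (hP : P ∈ awayFromOrigin v W) (hQ : Q ∈ awayFromOrigin v W) :
    P + Q ∈ awayFromOrigin v W := by
  rcases P with _ | ⟨x₁, y₁, h₁⟩
  · rwa [← Affine.Point.zero_def, zero_add]
  rcases Q with _ | ⟨x₂, y₂, h₂⟩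
  · rwa [← Affine.Point.zero_def, add_zero]
  by_cases hxy : x₁ = x₂ ∧ y₁ = W.toAffine.negY x₂ y₂
  · rw [Affine.Point.add_of_Y_eq hxy.1 hxy.2]
    exact zero_mem_awayFromOrigin
  · obtain ⟨l, m, x₃, h₃, e, -, -, -, -, -, hm⟩ := exists_line_of_mem hW hxy hP hQ
    rw [e]
    exact neg_mem_awayFromOrigin hW hm

variable (v W) in
open scoped Classical in
/-- The points that do not reduce to the singular point `(0, 0)` form a subgroup. -/
noncomputable def awaySubgroup (hW : SingularAtOrigin v W) : AddSubgroup W.toAffine.Point where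
  carrier := awayFromOrigin v W
  add_mem' := add_mem_awayFromOrigin hW
  zero_mem' := zero_mem_awayFromOrigin
  neg_mem' := neg_mem_awayFromOrigin hW

end Valuation

section Valuation

variable {F Γ₀ : Type*} [Field F] [LinearOrderedCommGroupWithZero Γ₀] {v : Valuation F Γ₀}
  {W : WeierstrassCurve F}

/-! ### Points reducing to infinity -/

theorem SingularAtOrigin.a₃_mul_le (hW : SingularAtOrigin v W) {y : F} : v (W.a₃ * y) ≤ v y := by
  rw [map_mul]; exact mul_le_of_le_one_left' hW.a₃.le

theorem y_le_one_of_x_le_one (hW : SingularAtOrigin v W) {x y : F} (h : W.toAffine.Equation x y)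
    (hx : v x ≤ 1) : v y ≤ 1 := by
  rw [Affine.equation_iff] at h
  refine le_one_of_cubic (c₂ := W.a₁ * x + W.a₃)
    (c₁ := -(x ^ 3 + W.a₂ * x ^ 2 + W.a₄ * x + W.a₆)) (c₀ := 0) (by simp) ?_
    (v.map_add_le (map_mul_le_one hW.a₁ hx) hW.a₃.le) (by linear_combination y * h)
  rw [Valuation.map_neg]
  exact v.map_add_le (v.map_add_le (v.map_add_le (map_pow_le_one hx _)
    (map_mul_le_one hW.a₂ (map_pow_le_one hx _))) (map_mul_le_one hW.a₄.le hx)) hW.a₆.le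

theorem x_lt_y_of_one_lt (hW : SingularAtOrigin v W) {x y : F} (h : W.toAffine.Equation x y)
    (hx : 1 < v x) : v x < v y := by
  by_contra! hy
  rw [Affine.equation_iff] at h
  have hx0 : v x ≠ 0 := (zero_lt_one.trans hx).ne'
  have h1 : v x ≤ v x ^ 2 := by rw [pow_two]; exact le_mul_of_one_le_right' hx.le
  have h2 : 1 ≤ v x ^ 2 := hx.le.trans h1
  have e : x ^ 3 = y ^ 2 + W.a₁ * x * y + W.a₃ * y - W.a₂ * x ^ 2 - W.a₄ * x - W.a₆ := by
    linear_combination -h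
  have hle : v (x ^ 3) ≤ v x ^ 2 := by
    rw [e]
    refine v.map_sub_le (v.map_sub_le (v.map_sub_le (v.map_add_le (v.map_add_le ?_ ?_) ?_) ?_) ?_) ?_
    · rw [map_pow]; exact pow_le_pow_left₀ zero_le hy 2
    · rw [map_mul, map_mul, pow_two, mul_assoc]
      exact (mul_le_of_le_one_left' hW.a₁).trans (mul_le_mul_right hy _)
    · exact hW.a₃_mul_le.trans (hy.trans h1)
    · rw [map_mul, map_pow]; exact mul_le_of_le_one_left' hW.a₂
    · rw [map_mul]; exact (mul_le_of_le_one_left' hW.a₄.le).trans h1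
    · exact hW.a₆.le.trans h2
  rw [map_pow, pow_succ] at hle
  exact hle.not_gt (lt_mul_of_one_lt_right (zero_lt_iff.mpr (pow_ne_zero _ hx0)) hx)

theorem y_sq_eq_x_cube (hW : SingularAtOrigin v W) {x y : F} (h : W.toAffine.Equation x y)
    (hx : 1 < v x) : v y ^ 2 = v x ^ 3 := by
  have hxy := x_lt_y_of_one_lt hW h hx
  rw [Affine.equation_iff] at h
  have hx0 : 0 < v x := zero_lt_one.trans hx
  have hy0 : 0 < v y := hx0.trans hxy
  have hy1 : 1 < v y := hx.trans hxy
  have hyy : v y < v y ^ 2 := by rw [pow_two]; exact lt_mul_of_one_lt_right hy0 hy1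
  have hxx : v x < v x ^ 2 := by rw [pow_two]; exact lt_mul_of_one_lt_right hx0 hx
  have hxxx : v x ^ 2 < v x ^ 3 := by
    rw [pow_succ _ 2]; exact lt_mul_of_one_lt_right (pow_pos hx0 _) hx
  have l : v (y ^ 2 + (W.a₁ * x * y + W.a₃ * y)) = v (y ^ 2) := by
    refine v.map_add_eq_of_lt_left ?_
    rw [map_pow]
    refine v.map_add_lt ?_ (hW.a₃_mul_le.trans_lt hyy)
    rw [map_mul, map_mul, pow_two]
    exact mul_lt_mul_of_pos_right ((mul_le_of_le_one_left' hW.a₁).trans_lt hxy) hy0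
  have r : v (x ^ 3 + (W.a₂ * x ^ 2 + W.a₄ * x + W.a₆)) = v (x ^ 3) := by
    refine v.map_add_eq_of_lt_left ?_
    rw [map_pow]
    refine v.map_add_lt (v.map_add_lt ?_ ?_) ?_
    · rw [map_mul, map_pow]; exact (mul_le_of_le_one_left' hW.a₂).trans_lt hxxx
    · rw [map_mul]; exact (mul_le_of_le_one_left' hW.a₄.le).trans_lt (hxx.trans hxxx)
    · exact hW.a₆.trans ((hx.trans hxx).trans hxxx)
  rw [← map_pow, ← map_pow, ← l, ← r]
  congr 1
  linear_combination h

variable (v) in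
/-- The points of `W` that reduce to the point at infinity. -/
def nearInfinity (W : WeierstrassCurve F) : Set W.toAffine.Point :=
  {P | ∀ x y h, P = .some x y h → 1 < v x}

theorem some_mem_nearInfinity {x y : F} {h : W.toAffine.Nonsingular x y} :
    Affine.Point.some x y h ∈ nearInfinity v W ↔ 1 < v x := by
  refine ⟨fun H ↦ H x y h rfl, fun H a b h' e ↦ ?_⟩
  rw [Affine.Point.some.injEq] at e
  rwa [← e.1]

variable (v) in
/-- All the coefficients of `W` reduce to zero, so that the reduction of `W` is the cuspidal cubic
`y² = x³`. -/
structure CuspAtOrigin (W : WeierstrassCurve F) : Prop where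
  a₁ : v W.a₁ < 1
  a₂ : v W.a₂ < 1
  a₃ : v W.a₃ < 1
  a₄ : v W.a₄ < 1
  a₆ : v W.a₆ < 1

theorem CuspAtOrigin.singularAtOrigin (h : CuspAtOrigin v W) : SingularAtOrigin v W :=
  ⟨h.a₁.le, h.a₂.le, h.a₃, h.a₄, h.a₆⟩

/-- The change of variables `(x, y) ↦ (ϖ² x, ϖ³ y)`. -/
def scaling (ϖ : Fˣ) : VariableChange F := ⟨ϖ⁻¹, 0, 0, 0⟩

theorem coordX_scaling (ϖ : Fˣ) (x : F) : coordX (scaling ϖ) x = ϖ ^ 2 * x := by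
  simp [coordX, scaling]

theorem coordY_scaling (ϖ : Fˣ) (x y : F) : coordY (scaling ϖ) x y = ϖ ^ 3 * y := by
  simp [coordY, scaling]

theorem SingularAtOrigin.cuspAtOrigin_scaling (hW : SingularAtOrigin v W) {ϖ : Fˣ}
    (hϖ : v (ϖ : F) < 1) : CuspAtOrigin v (scaling ϖ • W) := by
  constructor <;> simp only [variableChange_def, scaling, inv_inv, mul_zero, zero_mul, add_zero,
    sub_zero, ne_eq, OfNat.ofNat_ne_zero, not_false_eq_true, zero_pow]
  · exact map_mul_lt_one_left hϖ hW.a₁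
  · exact map_mul_lt_one_left (map_pow_lt_one hϖ two_ne_zero) hW.a₂
  · exact map_mul_lt_one_left (map_pow_lt_one hϖ three_ne_zero) hW.a₃.le
  · exact map_mul_lt_one_left (map_pow_lt_one hϖ four_ne_zero) hW.a₄.le
  · exact map_mul_lt_one_left (map_pow_lt_one hϖ (by norm_num)) hW.a₆.le

/-- The points reducing to infinity are those that do not reduce to the cusp on the model scaled by
a uniformiser. -/
theorem pointHom_scaling_mem_awayFromOrigin_iff (hW : SingularAtOrigin v W) {ϖ : Fˣ}
    (hϖ : v (ϖ : F) < 1) (hmax : ∀ x : F, v x < 1 → v x ≤ v (ϖ : F)) {W' : WeierstrassCurve F}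
    (hW' : scaling ϖ • W = W') {P : W.toAffine.Point} :
    pointHom (scaling ϖ) hW' P ∈ awayFromOrigin v W' ↔ P ∈ nearInfinity v W := by
  rcases P with _ | ⟨x, y, h⟩
  · exact ⟨fun _ _ _ _ e ↦ (by cases e), fun _ ↦ zero_mem_awayFromOrigin⟩
  rw [pointHom_some, some_mem_awayFromOrigin, some_mem_nearInfinity, coordX_scaling,
    coordY_scaling]
  constructor
  · intro H
    by_contra! hx
    exact H ⟨map_mul_lt_one_left (map_pow_lt_one hϖ two_ne_zero) hx,
      map_mul_lt_one_left (map_pow_lt_one hϖ three_ne_zero) (y_le_one_of_x_le_one hW h.1 hx)⟩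
  · rintro hx ⟨hlt, -⟩
    have hxy := x_lt_y_of_one_lt hW h.1 hx
    have hx0 : 0 < v x := zero_lt_one.trans hx
    have hy0 : 0 < v y := hx0.trans hxy
    -- `t = x / y` satisfies `|t|⁻² = |x|`, so that `|x| ≥ |ϖ|⁻²`
    have ht : v (x / y) < 1 := by rw [map_div₀]; exact (div_lt_one₀ hy0).mpr hxy
    have ht' := hmax _ ht
    have e : v (x / y) ^ 2 * v x = 1 := by
      have h3 : v y ^ 2 = v x ^ 3 := y_sq_eq_x_cube hW h.1 hx
      rw [map_div₀, div_pow, h3]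
      field_simp [hx0.ne']
    rw [map_mul, map_pow] at hlt
    refine hlt.not_ge ?_
    rw [← e]
    exact mul_le_mul_left (pow_le_pow_left₀ zero_le ht' 2) _

/-! ### The reduction map at a node -/

variable (W) in
/-- `α` and `β` are the slopes of the tangent lines at the node `(0, 0)` of the reduction of `W`,
lifted to roots of `T² + a₁ T - a₂`. -/
structure NodeSlopes (v : Valuation F Γ₀) (α β : F) : Prop where
  add : α + β = -W.a₁
  mul : α * β = -W.a₂
  left : v α ≤ 1
  right : v β ≤ 1
  sub : v (α - β) = 1

/-- The function `(y - α x) / (y - β x)`, which on the reduction of `W` is an isomorphism from the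
smooth locus of the nodal cubic to the multiplicative group. -/
noncomputable def slopeRatio (α β : F) : W.toAffine.Point → F
  | .zero => 1
  | .some x y _ => (y - α * x) / (y - β * x)

variable {α β : F}

theorem NodeSlopes.swap (h : NodeSlopes W v α β) : NodeSlopes W v β α :=
  ⟨by rw [add_comm, h.add], by rw [mul_comm, h.mul], h.right, h.left,
    by rw [Valuation.map_sub_swap, h.sub]⟩

theorem NodeSlopes.mul_eq (h : NodeSlopes W v α β) {x y : F} (hxy : W.toAffine.Equation x y) :
    (y - α * x) * (y - β * x) = x ^ 3 - W.a₃ * y + W.a₄ * x + W.a₆ := by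
  rw [Affine.equation_iff] at hxy
  linear_combination hxy - x * y * h.add + x ^ 2 * h.mul

/-- A point away from the node either has integral coordinates and unit `x`, or reduces to
infinity; in both cases the valuation of `y - α x` is known. -/
theorem NodeSlopes.cases_of_mem (hα : NodeSlopes W v α β) (hW : SingularAtOrigin v W) {x y : F}
    {h : W.toAffine.Nonsingular x y} (hP : Affine.Point.some x y h ∈ awayFromOrigin v W) :
    (v x = 1 ∧ v (y - α * x) = 1 ∧ v (y - β * x) = 1) ∨
      (1 < v x ∧ v x < v y ∧ v (y - α * x) = v y ∧ v (y - β * x) = v y) := by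
  rcases le_or_gt (v x) 1 with hx | hx
  · left
    have hy := y_le_one_of_x_le_one hW h.1 hx
    have hm := hα.mul_eq h.1
    have small : v (-W.a₃ * y + W.a₄ * x + W.a₆) < 1 :=
      v.map_add_lt (v.map_add_lt (map_mul_lt_one_left (by rw [Valuation.map_neg]; exact hW.a₃) hy)
        (map_mul_lt_one_left hW.a₄ hx)) hW.a₆
    have hx1 : v x = 1 := by
      refine le_antisymm hx ?_
      by_contra! hlt
      rw [some_mem_awayFromOrigin] at hP
      refine hP ⟨hlt, ?_⟩
      have e : y ^ 2 = x * (x ^ 2 + W.a₂ * x - W.a₁ * y) + (-W.a₃ * y + W.a₄ * x + W.a₆) := by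
        have := (W.toAffine.equation_iff _ _).mp h.1
        linear_combination this
      have : v (y ^ 2) < 1 := by
        rw [e]
        exact v.map_add_lt (map_mul_lt_one_left hlt (v.map_sub_le (v.map_add_le
          (map_pow_le_one hx _) (map_mul_le_one hW.a₂ hx)) (map_mul_le_one hW.a₁ hy))) small
      rw [map_pow] at this
      by_contra! h1
      exact this.not_ge (one_le_pow₀ h1)
    have vm : v ((y - α * x) * (y - β * x)) = 1 := by
      have e : (y - α * x) * (y - β * x) = x ^ 3 + (-W.a₃ * y + W.a₄ * x + W.a₆) := by
        rw [hm]; ring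
      rw [e, v.map_add_eq_of_lt_left (by simpa [hx1] using small)]
      simp [hx1]
    have l1 : v (y - α * x) ≤ 1 := v.map_sub_le hy (map_mul_le_one hα.left hx)
    have l2 : v (y - β * x) ≤ 1 := v.map_sub_le hy (map_mul_le_one hα.right hx)
    rw [map_mul] at vm
    refine ⟨hx1, le_antisymm l1 ?_, le_antisymm l2 ?_⟩
    · rw [← vm]; exact mul_le_of_le_one_right' l2
    · rw [← vm]; exact mul_le_of_le_one_left' l1
  · right
    have hxy := x_lt_y_of_one_lt hW h.1 hx
    refine ⟨hx, hxy, v.map_sub_eq_of_lt_left ?_, v.map_sub_eq_of_lt_left ?_⟩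
    · rw [map_mul]; exact (mul_le_of_le_one_left' hα.left).trans_lt hxy
    · rw [map_mul]; exact (mul_le_of_le_one_left' hα.right).trans_lt hxy

theorem NodeSlopes.le_of_mem (hα : NodeSlopes W v α β) (hW : SingularAtOrigin v W) {x y : F}
    {h : W.toAffine.Nonsingular x y} (hP : Affine.Point.some x y h ∈ awayFromOrigin v W) :
    1 ≤ v (y - α * x) ∧ v (y - α * x) = v (y - β * x) ∧ v x ≤ v (y - α * x) := by
  rcases hα.cases_of_mem hW hP with ⟨h1, h2, h3⟩ | ⟨h1, h2, h3, h4⟩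
  · rw [h1, h2, h3]; simp
  · rw [h3, h4]; exact ⟨(h1.trans h2).le, rfl, h2.le⟩

theorem NodeSlopes.slopeRatio_val (hα : NodeSlopes W v α β) (hW : SingularAtOrigin v W)
    {P : W.toAffine.Point} (hP : P ∈ awayFromOrigin v W) : v (slopeRatio α β P) = 1 := by
  rcases P with _ | ⟨x, y, h⟩
  · exact map_one v
  · obtain ⟨h1, h2, -⟩ := hα.le_of_mem hW hP
    rw [slopeRatio, map_div₀, h2, div_self]
    rw [← h2]
    exact (zero_lt_one.trans_le h1).ne'

theorem NodeSlopes.mem_nearInfinity (hα : NodeSlopes W v α β) (hW : SingularAtOrigin v W)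
    {P : W.toAffine.Point} (hP : P ∈ awayFromOrigin v W) (h1 : v (slopeRatio α β P - 1) < 1) :
    P ∈ nearInfinity v W := by
  rcases P with _ | ⟨x, y, h⟩
  · exact fun _ _ _ e ↦ (by cases e)
  · rw [some_mem_nearInfinity]
    rcases hα.cases_of_mem hW hP with ⟨hx, -, h3⟩ | ⟨hx, -⟩
    · have h0 : y - β * x ≠ 0 := fun h0 ↦ by simp [h0] at h3
      have e : slopeRatio α β (Affine.Point.some x y h) - 1 = (α - β) * (-x) / (y - β * x) := by
        rw [slopeRatio, eq_div_iff h0, sub_mul, div_mul_cancel₀ _ h0]; ring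
      rw [e, map_div₀, h3, map_mul, hα.sub, Valuation.map_neg, hx] at h1
      simp at h1
    · exact hx

theorem NodeSlopes.slopeRatio_neg (hα : NodeSlopes W v α β) (hW : SingularAtOrigin v W)
    {P : W.toAffine.Point} (hP : P ∈ awayFromOrigin v W) :
    v (slopeRatio α β (-P) * slopeRatio α β P - 1) < 1 := by
  rcases P with _ | ⟨x, y, h⟩
  · change v ((1 : F) * 1 - 1) < 1
    simp
  · obtain ⟨h1, h2, h3⟩ := hα.le_of_mem hW hP
    obtain ⟨p, hp⟩ : ∃ p, p = y - α * x := ⟨_, rfl⟩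
    obtain ⟨q, hq⟩ : ∃ q, q = y - β * x := ⟨_, rfl⟩
    rw [← hp, ← hq] at h2
    rw [← hp] at h1 h3
    have vp : v (p + W.a₃) = v p := v.map_add_eq_of_lt_left (hW.a₃.trans_le h1)
    have p0 : p + W.a₃ ≠ 0 := fun h0 ↦ by
      rw [h0, map_zero] at vp; exact (zero_lt_one.trans_le h1).ne vp
    have q0 : q ≠ 0 := fun h0 ↦ by
      rw [h0, map_zero] at h2; exact (zero_lt_one.trans_le h1).ne' h2
    have e : slopeRatio α β (-Affine.Point.some x y h) * slopeRatio α β (Affine.Point.some x y h) - 1 =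
        W.a₃ * ((β - α) * x) / ((p + W.a₃) * q) := by
      rw [Affine.Point.neg_some, slopeRatio, slopeRatio, ← hp, ← hq]
      have n1 : W.toAffine.negY x y - α * x = -(q + W.a₃) := by
        rw [hq, Affine.negY]; linear_combination -x * hα.add
      have n2 : W.toAffine.negY x y - β * x = -(p + W.a₃) := by
        rw [hp, Affine.negY]; linear_combination -x * hα.add
      rw [n1, n2, neg_div_neg_eq]
      field_simp
      rw [hp, hq]; ring
    rw [e, map_div₀, map_mul, map_mul, map_mul, vp, Valuation.map_sub_swap, hα.sub, one_mul, ← h2]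
    have p1 : 0 < v p := zero_lt_one.trans_le h1
    rw [div_lt_one₀ (mul_pos p1 p1)]
    calc v W.a₃ * v x ≤ v W.a₃ * v p := mul_le_mul_right h3 _
      _ < 1 * v p := mul_lt_mul_of_pos_right hW.a₃ p1
      _ ≤ v p * v p := mul_le_mul_left h1 _

/-- The values of `y - α x` at the three points of a line multiply to a polynomial in the
coefficients of the line, which is congruent to the cube of the intercept. -/
theorem IsLineSection.prod_eq {l m x₁ x₂ x₃ : F} (hs : IsLineSection W l m x₁ x₂ x₃)
    (hα : α ^ 2 + W.a₁ * α = W.a₂) :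
    (l * x₁ + m - α * x₁) * (l * x₂ + m - α * x₂) * (l * x₃ + m - α * x₃) =
      m ^ 3 + ((W.a₄ - W.a₃ * α) * m * (l - α) ^ 2 - W.a₆ * (l - α) ^ 3) := by
  linear_combination (l - α) ^ 3 * hs.e₃ + (l - α) ^ 2 * m * hs.e₂ + (l - α) * m ^ 2 * hs.e₁
    + (l - α) * m ^ 2 * hα

theorem NodeSlopes.quadratic (h : NodeSlopes W v α β) : α ^ 2 + W.a₁ * α = W.a₂ := by
  linear_combination α * h.add - h.mul

theorem IsLineSection.error_lt (hW : SingularAtOrigin v W) {l m γ : F} (hγ : v γ ≤ 1)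
    (hm : 1 ≤ v m) (hl : v l ≤ v m) :
    v ((W.a₄ - W.a₃ * γ) * m * (l - γ) ^ 2 - W.a₆ * (l - γ) ^ 3) < v m ^ 3 := by
  have hm0 : 0 < v m := zero_lt_one.trans_le hm
  have hlγ : v (l - γ) ≤ v m := v.map_sub_le hl (hγ.trans hm)
  have h1 : v (W.a₄ - W.a₃ * γ) < 1 := v.map_sub_lt hW.a₄ (map_mul_lt_one_left hW.a₃ hγ)
  refine v.map_sub_lt ?_ ?_
  · rw [map_mul, map_mul, map_pow, mul_assoc, pow_succ' (v m) 2]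
    calc _ ≤ v (W.a₄ - W.a₃ * γ) * (v m * v m ^ 2) :=
          mul_le_mul_right (mul_le_mul_right (pow_le_pow_left₀ zero_le hlγ 2) _) _
      _ < 1 * (v m * v m ^ 2) := mul_lt_mul_of_pos_right h1 (mul_pos hm0 (pow_pos hm0 2))
      _ = _ := one_mul _
  · rw [map_mul, map_pow]
    calc _ ≤ v W.a₆ * v m ^ 3 := mul_le_mul_right (pow_le_pow_left₀ zero_le hlγ 3) _
      _ < 1 * v m ^ 3 := mul_lt_mul_of_pos_right hW.a₆ (pow_pos hm0 3)
      _ = _ := one_mul _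

theorem NodeSlopes.prod_slopeRatio (hα : NodeSlopes W v α β) (hW : SingularAtOrigin v W)
    {l m x₁ x₂ x₃ : F} (hs : IsLineSection W l m x₁ x₂ x₃) (hm : 1 ≤ v m) (hl : v l ≤ v m) :
    v ((l * x₁ + m - α * x₁) / (l * x₁ + m - β * x₁) *
      ((l * x₂ + m - α * x₂) / (l * x₂ + m - β * x₂)) *
      ((l * x₃ + m - α * x₃) / (l * x₃ + m - β * x₃)) - 1) < 1 := by
  have hm0 : 0 < v m := zero_lt_one.trans_le hm
  rw [div_mul_div_comm, div_mul_div_comm, hs.prod_eq hα.quadratic, hs.prod_eq hα.swap.quadratic]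
  have h1 := IsLineSection.error_lt hW hα.left hm hl
  have h2 := IsLineSection.error_lt hW hα.right hm hl
  generalize (W.a₄ - W.a₃ * α) * m * (l - α) ^ 2 - W.a₆ * (l - α) ^ 3 = p at *
  generalize (W.a₄ - W.a₃ * β) * m * (l - β) ^ 2 - W.a₆ * (l - β) ^ 3 = q at *
  have vq : v (m ^ 3 + q) = v m ^ 3 := by
    rw [v.map_add_eq_of_lt_left (by rwa [map_pow]), map_pow]
  have q0 : m ^ 3 + q ≠ 0 := fun h0 ↦ by
    rw [h0, map_zero] at vq
    exact (pow_pos hm0 3).ne vq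
  have e : (m ^ 3 + p) / (m ^ 3 + q) - 1 = (p - q) / (m ^ 3 + q) := by field_simp; ring
  rw [e, map_div₀, vq, div_lt_one₀ (pow_pos hm0 3)]
  exact v.map_sub_lt h1 h2

theorem sub_lt_one_of_mul {a b c : F} (hc : v c = 1) (h1 : v (a * c - 1) < 1)
    (h2 : v (c * b - 1) < 1) : v (a - b) < 1 := by
  have e : v (a - b) = v (c * (a - b)) := by rw [map_mul, hc, one_mul]
  have e' : c * (a - b) = (a * c - 1) - (c * b - 1) := by ring
  rw [e, e']
  exact v.map_sub_lt h1 h2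

open scoped Classical in
/-- Modulo the maximal ideal, `slopeRatio` is a homomorphism on the points away from the node. -/
theorem NodeSlopes.slopeRatio_add (hα : NodeSlopes W v α β) (hW : SingularAtOrigin v W)
    {P Q : W.toAffine.Point} (hP : P ∈ awayFromOrigin v W) (hQ : Q ∈ awayFromOrigin v W) :
    v (slopeRatio α β (P + Q) - slopeRatio α β P * slopeRatio α β Q) < 1 := by
  rcases P with _ | ⟨x₁, y₁, h₁⟩
  · rw [← Affine.Point.zero_def, zero_add]
    change v (_ - 1 * _) < 1
    simp
  rcases Q with _ | ⟨x₂, y₂, h₂⟩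
  · rw [← Affine.Point.zero_def, add_zero]
    change v (_ - _ * 1) < 1
    simp
  by_cases hxy : x₁ = x₂ ∧ y₁ = W.toAffine.negY x₂ y₂
  · rw [Affine.Point.add_of_Y_eq hxy.1 hxy.2]
    have := hα.slopeRatio_neg hW hQ
    rw [Affine.Point.neg_some] at this
    obtain ⟨rfl, rfl⟩ := hxy
    rw [Valuation.map_sub_swap]
    exact this
  · obtain ⟨l, m, x₃, h₃, e, hs, hy₁, hy₂, hm, hl, hR⟩ := exists_line_of_mem hW hxy hP hQ
    have key := hα.prod_slopeRatio hW hs hm hl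
    rw [← hy₁, ← hy₂] at key
    rw [e]
    refine sub_lt_one_of_mul
      (hα.slopeRatio_val hW hR) (hα.slopeRatio_neg hW hR) ?_
    rw [mul_comm]
    exact key

end Valuation

/-! ### Zeros of functions on the affine curve -/

section Divisor

open Polynomial WeierstrassCurve.Affine

variable {F : Type*} [Field F] {W : WeierstrassCurve F}

theorem smul_one_add_smul_mk_mem_XYIdeal {p q : F[X]} {x y : F}
    (h : p.eval x + y * q.eval x = 0) :
    p • (1 : W.toAffine.CoordinateRing) + q • CoordinateRing.mk W.toAffine X ∈
      CoordinateRing.XYIdeal W.toAffine x (C y) := by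
  rw [CoordinateRing.XYIdeal, Ideal.mem_span_pair]
  obtain ⟨a, ha⟩ : X - C x ∣ p + C y * q := by
    rw [dvd_iff_isRoot]
    simpa [IsRoot] using h
  refine ⟨CoordinateRing.mk W.toAffine (C a), CoordinateRing.mk W.toAffine (C q), ?_⟩
  have key : C a * C (X - C x) + C q * (X - C (C y)) = (C p + C q * X : F[X][X]) := by
    have : C p + C (C y) * C q = (C (X - C x) * C a : F[X][X]) := by
      rw [← C_mul, ← C_mul, ← ha, C_add]
    linear_combination -this
  have := congrArg (CoordinateRing.mk W.toAffine) key
  rw [map_add, map_mul, map_mul, map_add, map_mul] at this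
  rw [CoordinateRing.smul, CoordinateRing.smul, mul_one]
  exact this

/-- The value at the point `(x, y)` of a function on the affine curve. -/
noncomputable def evalPoint {x y : F} (h : W.toAffine.Equation x y) :
    W.toAffine.CoordinateRing →ₐ[F] F :=
  (CoordinateRing.quotientXYIdealEquiv (W' := W.toAffine) (x := x) (y := C y)
      (by simpa [Affine.Equation, Polynomial.evalEval] using h)).toAlgHom.comp
    (Ideal.Quotient.mkₐ F _)

theorem evalPoint_eq_zero_iff {x y : F} (h : W.toAffine.Equation x y)
    (f : W.toAffine.CoordinateRing) :
    evalPoint h f = 0 ↔ f ∈ CoordinateRing.XYIdeal W.toAffine x (C y) := by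
  rw [← Ideal.Quotient.eq_zero_iff_mem]
  simp [evalPoint]

theorem evalPoint_C {x y : F} (h : W.toAffine.Equation x y) (p : F[X]) :
    evalPoint h (CoordinateRing.mk W.toAffine (C p)) = p.eval x := by
  have key : CoordinateRing.mk W.toAffine (C p) - algebraMap F _ (p.eval x) ∈
      CoordinateRing.XYIdeal W.toAffine x (C y) := by
    have := smul_one_add_smul_mk_mem_XYIdeal (W := W) (p := p - C (p.eval x)) (q := 0) (x := x)
      (y := y) (by simp)
    rw [CoordinateRing.smul, mul_one, zero_smul, add_zero, C_sub, map_sub] at this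
    exact this
  rw [← evalPoint_eq_zero_iff h, map_sub, AlgHom.commutes, sub_eq_zero] at key
  exact key

theorem isCoprime_XYIdeal {x₁ x₂ y₁ y₂ : F} (h : x₁ ≠ x₂) :
    IsCoprime (CoordinateRing.XYIdeal W.toAffine x₁ (C y₁))
      (CoordinateRing.XYIdeal W.toAffine x₂ (C y₂)) := by
  have h0 : x₂ - x₁ ≠ 0 := sub_ne_zero.mpr h.symm
  rw [Ideal.isCoprime_iff_exists]
  have mem : ∀ x y : F, CoordinateRing.XClass W.toAffine x ∈
      CoordinateRing.XYIdeal W.toAffine x (C y) := fun x y ↦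
    Ideal.subset_span (Set.mem_insert _ _)
  refine ⟨CoordinateRing.mk W.toAffine (C (C (x₂ - x₁)⁻¹)) * CoordinateRing.XClass W.toAffine x₁,
    Ideal.mul_mem_left _ _ (mem _ _),
    CoordinateRing.mk W.toAffine (C (C (-(x₂ - x₁)⁻¹))) * CoordinateRing.XClass W.toAffine x₂,
    Ideal.mul_mem_left _ _ (mem _ _), ?_⟩
  rw [CoordinateRing.XClass, CoordinateRing.XClass, ← map_mul (CoordinateRing.mk W.toAffine),
    ← map_mul (CoordinateRing.mk W.toAffine), ← map_add (CoordinateRing.mk W.toAffine), ← C_mul,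
    ← C_mul, ← C_add]
  have : C (x₂ - x₁)⁻¹ * (X - C x₁) + C (-(x₂ - x₁)⁻¹) * (X - C x₂) = (1 : F[X]) := by
    have e : C (x₂ - x₁)⁻¹ * (C x₂ - C x₁) = (1 : F[X]) := by
      rw [← C_sub, ← C_mul, inv_mul_cancel₀ h0, C_1]
    rw [C_neg]
    linear_combination e
  rw [this]
  simp

open scoped Classical in
/-- If a function `p(x) + y q(x)` has pole order `n` at infinity and vanishes at `n` points with
distinct `x`-coordinates, then these points are all its zeros, so that they sum to zero in the group
law. -/
theorem sum_eq_zero_of_eval_eq_zero {ι : Type*} [Fintype ι] [Nonempty ι] {x y : ι → F}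
    (hx : Function.Injective x) (h : ∀ i, W.toAffine.Nonsingular (x i) (y i)) {p q : F[X]}
    (hpq : ∀ i, p.eval (x i) + y i * q.eval (x i) = 0)
    (hdeg : (p ^ 2 - p * q * (C W.a₁ * X + C W.a₃) -
      q ^ 2 * (X ^ 3 + C W.a₂ * X ^ 2 + C W.a₄ * X + C W.a₆)).natDegree = Fintype.card ι) :
    ∑ i, Affine.Point.some (x i) (y i) (h i) = 0 := by
  set f : W.toAffine.CoordinateRing := p • 1 + q • CoordinateRing.mk W.toAffine X with hf
  have hn : (Algebra.norm F[X] f).natDegree = Fintype.card ι := by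
    rw [hf, CoordinateRing.norm_smul_basis]; exact hdeg
  have hf0 : f ≠ 0 := by
    intro h0
    have := Module.Free.of_basis (CoordinateRing.basis W.toAffine)
    have := Module.Finite.of_basis (CoordinateRing.basis W.toAffine)
    rw [h0, Algebra.norm_zero, natDegree_zero] at hn
    exact Fintype.card_ne_zero hn.symm
  have hfin := finrank_quotient_span_eq_natDegree_norm (F := F) (CoordinateRing.basis W.toAffine) hf0
  rw [hn] at hfin
  have : FiniteDimensional F (W.toAffine.CoordinateRing ⧸ Ideal.span {f}) :=
    Module.finite_of_finrank_pos (by rw [hfin]; exact Fintype.card_pos)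
  -- evaluation at the points is surjective by Lagrange interpolation
  let ev : W.toAffine.CoordinateRing →ₐ[F] (ι → F) := AlgHom.pi fun i ↦ evalPoint (h i).1
  have hevi : ∀ a i, ev a i = evalPoint (h i).1 a := fun _ _ ↦ rfl
  have hev : ∀ a ∈ Ideal.span {f}, ev a = 0 := by
    intro a ha
    obtain ⟨b, rfl⟩ := Ideal.mem_span_singleton'.mp ha
    have : ev f = 0 := funext fun i ↦ (evalPoint_eq_zero_iff (h i).1 f).mpr
      (smul_one_add_smul_mk_mem_XYIdeal (hpq i))
    rw [map_mul, this, mul_zero]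
  let ev' := Ideal.Quotient.liftₐ (Ideal.span {f}) ev hev
  have hev' : ∀ a, ev' (Ideal.Quotient.mk _ a) = ev a := fun a ↦ Ideal.Quotient.lift_mk _ _ _
  have hsurj : Function.Surjective ev' := by
    intro g
    refine ⟨Ideal.Quotient.mk _ (CoordinateRing.mk W.toAffine
      (C (Lagrange.interpolate Finset.univ x g))), funext fun i ↦ ?_⟩
    rw [hev']
    rw [hevi, evalPoint_C, Lagrange.eval_interpolate_at_node _ hx.injOn (Finset.mem_univ i)]
  have hinj : Function.Injective ev' :=
    (LinearMap.injective_iff_surjective_of_finrank_eq_finrank (f := ev'.toLinearMap)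
      (by rw [hfin, Module.finrank_fintype_fun_eq_card])).mpr hsurj
  have hprod : ∏ i, CoordinateRing.XYIdeal W.toAffine (x i) (C (y i)) = Ideal.span {f} := by
    rw [Ideal.prod_eq_iInf_of_pairwise_isCoprime fun i _ j _ hij ↦
      isCoprime_XYIdeal fun e ↦ hij (hx e)]
    refine le_antisymm (fun a ha ↦ ?_) ?_
    · rw [← Ideal.Quotient.eq_zero_iff_mem]
      refine hinj ?_
      rw [map_zero]
      rw [hev']
      refine funext fun i ↦ ?_
      rw [hevi, Pi.zero_apply, evalPoint_eq_zero_iff]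
      simp only [Ideal.mem_iInf, Finset.mem_univ, forall_true_left] at ha
      exact ha i
    · rw [Ideal.span_singleton_le_iff_mem]
      simp only [Ideal.mem_iInf, Finset.mem_univ, forall_true_left]
      exact fun i ↦ smul_one_add_smul_mk_mem_XYIdeal (hpq i)
  rw [← Affine.Point.toClass_eq_zero, map_sum]
  simp only [Affine.Point.toClass_some]
  have e : ∀ s : Finset ι, ∑ i ∈ s, (Additive.ofMul (ClassGroup.mk W.toAffine.FunctionField
      (CoordinateRing.XYIdeal' (W := W.toAffine) (h i)))) =
      Additive.ofMul (ClassGroup.mk W.toAffine.FunctionField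
        (∏ i ∈ s, CoordinateRing.XYIdeal' (W := W.toAffine) (h i))) := by
    intro s
    rw [map_prod, ofMul_prod]
  refine (e Finset.univ).trans ?_
  have hc : ((∏ i, CoordinateRing.XYIdeal' (W := W.toAffine) (h i) :
      (FractionalIdeal _ W.toAffine.FunctionField)ˣ) :
      FractionalIdeal (nonZeroDivisors W.toAffine.CoordinateRing) W.toAffine.FunctionField) =
      (Ideal.span {f} : Ideal W.toAffine.CoordinateRing) := by
    rw [← hprod, Units.coe_prod]
    simp only [CoordinateRing.XYIdeal'_eq]
    exact (map_prod (FractionalIdeal.coeIdealHom (nonZeroDivisors W.toAffine.CoordinateRing)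
      W.toAffine.FunctionField) _ _).symm
  rw [(ClassGroup.mk_eq_one_of_coe_ideal hc).mpr ⟨f, hf0, rfl⟩]
  rfl

end Divisor

end UnramifiedNorm

namespace UnramifiedNorm

open WeierstrassCurve Polynomial

/-! ### Polynomials with integral coefficients -/

section IntegralPolynomial

variable {F Γ₀ : Type*} [Field F] [LinearOrderedCommGroupWithZero Γ₀] {v : Valuation F Γ₀}

variable (v) in
/-- The polynomials over `F` with coefficients that are integral for `v`. -/
def integralPolynomials : Subring F[X] where
  carrier := {p | ∀ i, v (p.coeff i) ≤ 1}
  mul_mem' {p q} hp hq i := by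
    rw [coeff_mul]
    exact v.map_sum_le fun j _ ↦ map_mul_le_one (hp _) (hq _)
  one_mem' i := by rw [coeff_one]; split_ifs <;> simp
  add_mem' {p q} hp hq i := by rw [coeff_add]; exact v.map_add_le (hp i) (hq i)
  zero_mem' i := by simp
  neg_mem' {p} hp i := by rw [coeff_neg, Valuation.map_neg]; exact hp i

theorem C_mem_integralPolynomials {a : F} (ha : v a ≤ 1) : C a ∈ integralPolynomials v := fun i ↦ by
  rw [coeff_C]; split_ifs <;> simp [ha]

theorem X_mem_integralPolynomials : (X : F[X]) ∈ integralPolynomials v := fun i ↦ by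
  rw [coeff_X]; split_ifs <;> simp

variable (v) in
/-- The polynomials over `F` all of whose coefficients reduce to zero. -/
def topNilPolynomials : AddSubgroup F[X] where
  carrier := {p | ∀ i, v (p.coeff i) < 1}
  add_mem' {p q} hp hq i := by rw [coeff_add]; exact v.map_add_lt (hp i) (hq i)
  zero_mem' i := by simp
  neg_mem' {p} hp i := by rw [coeff_neg, Valuation.map_neg]; exact hp i

theorem mul_mem_topNilPolynomials {p q : F[X]} (hp : p ∈ topNilPolynomials v)
    (hq : q ∈ integralPolynomials v) : p * q ∈ topNilPolynomials v := fun i ↦ by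
  rw [coeff_mul]
  exact v.map_sum_lt one_ne_zero fun j _ ↦ map_mul_lt_one_left (hp _) (hq _)

theorem C_mem_topNilPolynomials {a : F} (ha : v a < 1) : C a ∈ topNilPolynomials v := fun i ↦ by
  rw [coeff_C]; split_ifs <;> simp [ha]

theorem eval_le_one {p : F[X]} (hp : p ∈ integralPolynomials v) {a : F} (ha : v a ≤ 1) :
    v (p.eval a) ≤ 1 := by
  rw [eval_eq_sum_range]
  exact v.map_sum_le fun i _ ↦ map_mul_le_one (hp i) (map_pow_le_one ha i)

theorem eval_lt_one {p : F[X]} (hp : p ∈ topNilPolynomials v) {a : F} (ha : v a ≤ 1) :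
    v (p.eval a) < 1 := by
  rw [eval_eq_sum_range]
  exact v.map_sum_lt one_ne_zero fun i _ ↦ map_mul_lt_one_left (hp i) (map_pow_le_one ha i)

theorem derivative_mem_integralPolynomials {p : F[X]} (hp : p ∈ integralPolynomials v) :
    derivative p ∈ integralPolynomials v := fun i ↦ by
  rw [coeff_derivative]
  exact_mod_cast map_mul_le_one (hp _) (map_natCast_le_one (v := v) (i + 1))

theorem derivative_mem_topNilPolynomials {p : F[X]} (hp : p ∈ topNilPolynomials v) :
    derivative p ∈ topNilPolynomials v := fun i ↦ by
  rw [coeff_derivative]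
  exact_mod_cast map_mul_lt_one_left (hp _) (map_natCast_le_one (v := v) (i + 1))

theorem pow_sub_pow_lt_one {a b : F} (ha : v a ≤ 1) (hb : v b ≤ 1) (h : v (a - b) < 1) (n : ℕ) :
    v (a ^ n - b ^ n) < 1 := by
  induction n with
  | zero => simp
  | succ n ih =>
    have e : a ^ (n + 1) - b ^ (n + 1) = a ^ n * (a - b) + (a ^ n - b ^ n) * b := by ring
    rw [e]
    exact v.map_add_lt (map_mul_lt_one_right (map_pow_le_one ha n) h) (map_mul_lt_one_left ih hb)

theorem eval_sub_eval_lt_one {p : F[X]} (hp : p ∈ integralPolynomials v) {a b : F} (ha : v a ≤ 1)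
    (hb : v b ≤ 1) (h : v (a - b) < 1) : v (p.eval a - p.eval b) < 1 := by
  rw [eval_eq_sum_range, eval_eq_sum_range, ← Finset.sum_sub_distrib]
  refine v.map_sum_lt one_ne_zero fun i _ ↦ ?_
  rw [← mul_sub]
  exact map_mul_lt_one_right (hp i) (pow_sub_pow_lt_one ha hb h i)

end IntegralPolynomial

/-! ### Even and odd parts of a polynomial -/

section EvenOdd

variable {R : Type*} [CommRing R]

/-- The polynomial `A` in the decomposition `f(T) = A(T²) + T³ B(T²)` of a polynomial without linear
term. -/
noncomputable def evenPart (f : R[X]) : R[X] := contract 2 f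

/-- The polynomial `B` in the decomposition `f(T) = A(T²) + T³ B(T²)` of a polynomial without linear
term. -/
noncomputable def oddPart (f : R[X]) : R[X] := contract 2 (divX (divX (divX f)))

theorem coeff_evenPart (f : R[X]) (n : ℕ) : (evenPart f).coeff n = f.coeff (n * 2) :=
  coeff_contract two_ne_zero f n

theorem coeff_oddPart (f : R[X]) (n : ℕ) : (oddPart f).coeff n = f.coeff (n * 2 + 3) := by
  rw [oddPart, coeff_contract two_ne_zero, coeff_divX, coeff_divX, coeff_divX]

theorem eq_evenPart_add_oddPart {f : R[X]} (h : f.coeff 1 = 0) :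
    f = expand R 2 (evenPart f) + X ^ 3 * expand R 2 (oddPart f) := by
  ext n
  rw [coeff_add, coeff_expand two_pos, coeff_X_pow_mul', coeff_evenPart]
  rcases Nat.even_or_odd' n with ⟨k, rfl | rfl⟩
  · rw [if_pos (dvd_mul_right 2 k), Nat.mul_div_cancel_left _ two_pos, mul_comm k]
    split_ifs with h3
    · rw [coeff_expand two_pos, if_neg (by omega), add_zero]
    · rw [add_zero]
  · rw [if_neg (by omega), zero_add]
    split_ifs with h3
    · obtain ⟨j, rfl⟩ : ∃ j, k = j + 1 := ⟨k - 1, by omega⟩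
      have e : 2 * (j + 1) + 1 - 3 = 2 * j := by omega
      rw [e, coeff_expand two_pos, if_pos (dvd_mul_right 2 j), Nat.mul_div_cancel_left _ two_pos,
        coeff_oddPart]
      congr 1; omega
    · obtain rfl : k = 0 := by omega
      simpa using h

theorem eval_eq_evenPart_add_oddPart {f : R[X]} (h : f.coeff 1 = 0) (t : R) :
    f.eval t = (evenPart f).eval (t ^ 2) + t ^ 3 * (oddPart f).eval (t ^ 2) := by
  conv_lhs => rw [eq_evenPart_add_oddPart h]
  simp

theorem natDegree_evenPart_le {f : R[X]} {d : ℕ} (h : f.natDegree ≤ d) :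
    (evenPart f).natDegree ≤ d / 2 := by
  rw [natDegree_le_iff_coeff_eq_zero]
  intro N hN
  rw [coeff_evenPart]
  exact coeff_eq_zero_of_natDegree_lt (by omega)

theorem natDegree_oddPart_le {f : R[X]} {d : ℕ} (h : f.natDegree ≤ d) :
    (oddPart f).natDegree ≤ (d - 3) / 2 := by
  rw [natDegree_le_iff_coeff_eq_zero]
  intro N hN
  rw [coeff_oddPart]
  exact coeff_eq_zero_of_natDegree_lt (by omega)

/-- `A² - X³ B²` is, up to sign, the polynomial whose roots are the squares of the roots of
`f(T) = A(T²) + T³ B(T²)`. -/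
theorem evenPart_sq_sub_oddPart_sq {ι : Type*} [Fintype ι] [IsDomain R] {r : ι → R}
    (h : (∏ i, (X - C (r i))).coeff 1 = 0) :
    evenPart (∏ i, (X - C (r i))) ^ 2 - X ^ 3 * oddPart (∏ i, (X - C (r i))) ^ 2 =
      (-1) ^ Fintype.card ι * ∏ i, (X - C (r i ^ 2)) := by
  set f : R[X] := ∏ i, (X - C (r i)) with hf
  refine expand_injective (R := R) two_pos ?_
  have e1 := eq_evenPart_add_oddPart h
  have e2 : f.comp (-X) = expand R 2 (evenPart f) - X ^ 3 * expand R 2 (oddPart f) := by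
    conv_lhs => rw [e1]
    simp only [expand_eq_comp_X_pow, add_comp, mul_comp, comp_assoc, X_comp, pow_comp, neg_sq]
    ring
  have e3 : f * f.comp (-X) = (-1) ^ Fintype.card ι * ∏ i, (X ^ 2 - C (r i ^ 2)) := by
    rw [hf, prod_comp, ← Finset.prod_mul_distrib, ← Finset.card_univ, ← Finset.prod_const,
      ← Finset.prod_mul_distrib]
    refine Finset.prod_congr rfl fun i _ ↦ ?_
    simp only [sub_comp, X_comp, C_comp, C_pow]
    ring
  have e4 : f * f.comp (-X) =
      (expand R 2 (evenPart f) + X ^ 3 * expand R 2 (oddPart f)) * f.comp (-X) := by rw [← e1]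
  rw [map_mul, map_prod]
  simp only [map_sub, map_pow, expand_X, expand_C, map_neg, map_one, map_mul]
  simp only [C_pow] at e3 ⊢
  rw [← e3, e4, e2]
  ring

end EvenOdd

/-! ### Products of linear factors -/

section LinearFactors

theorem coeff_one_prod_X_sub_C {F : Type*} [Field F] {ι : Type*} [Fintype ι] {r : ι → F}
    (hr : ∀ i, r i ≠ 0) (h : ∑ i, (r i)⁻¹ = 0) : (∏ i, (X - C (r i))).coeff 1 = 0 := by
  classical
  have e : (derivative (∏ i, (X - C (r i)))).eval 0 = (∏ i, (X - C (r i))).coeff 1 := by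
    rw [← coeff_zero_eq_eval_zero, coeff_derivative]; simp
  rw [← e, derivative_prod_finset, eval_finsetSum]
  have e2 : ∀ i ∈ Finset.univ, ((∏ j ∈ Finset.univ.erase i, (X - C (r j))) *
      derivative (X - C (r i))).eval 0 = (∏ j, (-r j)) * (-(r i)⁻¹) := by
    intro i hi
    rw [← Finset.mul_prod_erase _ _ hi, eval_mul, eval_prod]
    simp only [eval_sub, eval_X, eval_C, zero_sub, derivative_sub, derivative_X, derivative_C,
      sub_zero, eval_one, mul_one]
    have := hr i
    field_simp
  rw [Finset.sum_congr rfl e2, ← Finset.mul_sum, Finset.sum_neg_distrib, h]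
  simp

variable {K L Γ₀ : Type*} [Field K] [Field L] [Algebra K L]
  [LinearOrderedCommGroupWithZero Γ₀] {v : Valuation L Γ₀}

theorem algEquiv_eval {p : L[X]} {σ : L ≃ₐ[K] L} (hp : ∀ i, σ (p.coeff i) = p.coeff i) (x : L) :
    σ (p.eval x) = p.eval (σ x) := by
  rw [eval_eq_sum_range, eval_eq_sum_range, map_sum]
  refine Finset.sum_congr rfl fun i _ ↦ ?_
  rw [map_mul, map_pow, hp]

theorem algEquiv_coeff_prod {ι : Type*} [Fintype ι] {r : ι → L} (σ : L ≃ₐ[K] L) (e : ι ≃ ι)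
    (he : ∀ i, σ (r i) = r (e i)) (j : ℕ) :
    σ ((∏ i, (X - C (r i))).coeff j) = (∏ i, (X - C (r i))).coeff j := by
  have : (∏ i, (X - C (r i))).map (σ : L →+* L) = ∏ i, (X - C (r i)) := by
    rw [Polynomial.map_prod]
    refine Fintype.prod_equiv e _ _ fun i ↦ ?_
    simp [← he]
  conv_rhs => rw [← this]
  rw [coeff_map]
  rfl

theorem prod_X_sub_C_mem_integralPolynomials {ι : Type*} [Fintype ι] {r : ι → L}
    (hr : ∀ i, v (r i) ≤ 1) : ∏ i, (X - C (r i)) ∈ integralPolynomials v :=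
  Subring.prod_mem _ fun i _ ↦
    Subring.sub_mem _ X_mem_integralPolynomials (C_mem_integralPolynomials (hr i))

end LinearFactors

/-! ### The norm onto points near a cusp -/

section Cusp

variable {K L Γ₀ : Type*} [Field K] [Field L] [Algebra K L] [FiniteDimensional K L]
  [LinearOrderedCommGroupWithZero Γ₀]

variable (K) in
/-- The properties of the valuation `v` of a finite unramified Galois extension `L` of a Henselian
discretely valued field `K` on which the surjectivity of the norm rests. The last one is a
consequence of the normal basis theorem for the extension of residue fields. -/
structure IsHenselianUnramified (v : Valuation L Γ₀) : Prop where
  map_algEquiv : ∀ (σ : L ≃ₐ[K] L) (x : L), v (σ x) = v x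
  exists_uniformizer : ∃ ϖ : Kˣ, v (algebraMap K L ϖ) < 1 ∧
    ∀ x : L, v x < 1 → v x ≤ v (algebraMap K L ϖ)
  hensel : ∀ (f : L[X]) (b : L), f.Monic → f ∈ integralPolynomials v → v b ≤ 1 →
    v (f.eval b) < 1 → v (f.derivative.eval b) = 1 → ∃ a, f.eval a = 0 ∧ v (a - b) < 1
  hensel_base : ∀ (f : K[X]) (b : K), f.Monic →
    f ∈ integralPolynomials (v.comap (algebraMap K L)) → v (algebraMap K L b) ≤ 1 →
    v (algebraMap K L (f.eval b)) < 1 → v (algebraMap K L (f.derivative.eval b)) = 1 →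
    ∃ a, f.eval a = 0 ∧ v (algebraMap K L (a - b)) < 1
  exists_normal : ∃ u : L, v u = 1 ∧ v (∑ σ : L ≃ₐ[K] L, σ u) = 1 ∧
    ∀ σ : L ≃ₐ[K] L, σ ≠ 1 → v (σ u - u) = 1 ∧ v (σ u + u) = 1

variable {v : Valuation L Γ₀}

theorem sum_algEquiv_fixed (τ : L ≃ₐ[K] L) (x : L) :
    τ (∑ σ : L ≃ₐ[K] L, σ x) = ∑ σ : L ≃ₐ[K] L, σ x := by
  rw [map_sum]
  exact Fintype.sum_equiv (Equiv.mulLeft τ) _ _ fun σ ↦ rfl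

/-- An element whose conjugates reduce to distinct elements, such that the sum of the inverses of
its conjugates is a given unit of `K`. -/
theorem IsHenselianUnramified.exists_sum_inv (hv : IsHenselianUnramified K v)
    (hn : Nontrivial (L ≃ₐ[K] L)) {c : L} (hc : v c = 1) (hfix : ∀ σ : L ≃ₐ[K] L, σ c = c) :
    ∃ w : L, v w = 1 ∧ ∑ σ : L ≃ₐ[K] L, (σ w)⁻¹ = c⁻¹ ∧
      (∀ σ : L ≃ₐ[K] L, σ ≠ 1 → v (w ^ 2 - σ w ^ 2) = 1) ∧ v (w ^ 2 - c ^ 2) = 1 := by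
  obtain ⟨u, hu, hs, hσ⟩ := hv.exists_normal
  obtain ⟨s, hsdef⟩ : ∃ s, s = ∑ σ : L ≃ₐ[K] L, σ u := ⟨_, rfl⟩
  have sfix : ∀ σ : L ≃ₐ[K] L, σ s = s := fun σ ↦ by rw [hsdef, sum_algEquiv_fixed]
  rw [← hsdef] at hs
  have ne0 : ∀ {x : L}, v x = 1 → x ≠ 0 := fun {x} h h0 ↦ by simp [h0] at h
  have hu0 := ne0 hu
  have hs0 := ne0 hs
  have hc0 := ne0 hc
  have hu' : ∀ σ : L ≃ₐ[K] L, v (σ u) = 1 := fun σ ↦ by rw [hv.map_algEquiv, hu]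
  have hw : ∀ σ : L ≃ₐ[K] L, σ (s * c / u) = s * c / σ u := fun σ ↦ by
    rw [map_div₀, map_mul, sfix, hfix]
  -- as `u` is not congruent to its conjugates, it is not congruent to `± s`
  obtain ⟨τ, hτ⟩ := exists_ne (1 : L ≃ₐ[K] L)
  have h1 : v (s - u) = 1 := by
    refine le_antisymm (v.map_sub_le hs.le hu.le) ?_
    by_contra! hlt
    have h2 : v (s - τ u) < 1 := by
      rw [← sfix τ, ← map_sub, hv.map_algEquiv]; exact hlt
    have : v (τ u - u) < 1 := by
      have e : τ u - u = (s - u) - (s - τ u) := by ring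
      rw [e]; exact v.map_sub_lt hlt h2
    rw [(hσ τ hτ).1] at this
    exact lt_irrefl _ this
  have h2 : v (s + u) = 1 := by
    refine le_antisymm (v.map_add_le hs.le hu.le) ?_
    by_contra! hlt
    have h2 : v (s + τ u) < 1 := by
      rw [← sfix τ, ← map_add, hv.map_algEquiv]; exact hlt
    have : v (τ u - u) < 1 := by
      have e : τ u - u = (s + τ u) - (s + u) := by ring
      rw [e]; exact v.map_sub_lt h2 hlt
    rw [(hσ τ hτ).1] at this
    exact lt_irrefl _ this
  refine ⟨s * c / u, by simp [hs, hc, hu], ?_, fun σ hσ1 ↦ ?_, ?_⟩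
  · simp only [hw, inv_div]
    rw [← Finset.sum_div, ← hsdef]
    field_simp
  · have e : (s * c / u) ^ 2 - σ (s * c / u) ^ 2 =
        (s * c) ^ 2 * ((σ u - u) * (σ u + u)) / (u * σ u) ^ 2 := by
      have : σ u ≠ 0 := ne0 (hu' σ)
      rw [hw]; field_simp; ring
    rw [e]
    simp [hs, hc, hu, hu', hσ σ hσ1]
  · have e : (s * c / u) ^ 2 - c ^ 2 = c ^ 2 * ((s - u) * (s + u)) / u ^ 2 := by
      field_simp; ring
    rw [e]
    simp [hc, hu, h1, h2]

end Cusp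

section Cusp

variable {K L Γ₀ : Type*} [Field K] [Field L] [Algebra K L] [FiniteDimensional K L]
  [LinearOrderedCommGroupWithZero Γ₀] {v : Valuation L Γ₀}

theorem CuspAtOrigin.val_coords {F : Type*} [Field F] {v : Valuation F Γ₀} {W : WeierstrassCurve F}
    (hW : CuspAtOrigin v W) {x y : F} (h : W.toAffine.Equation x y) (hx : v x ≤ 1)
    (h0 : ¬(v x < 1 ∧ v y < 1)) : v x = 1 ∧ v y = 1 ∧ v (y ^ 2 - x ^ 3) < 1 := by
  have hy := y_le_one_of_x_le_one hW.singularAtOrigin h hx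
  have key : v (y ^ 2 - x ^ 3) < 1 := by
    have e : y ^ 2 - x ^ 3 = W.a₂ * x ^ 2 + W.a₄ * x + W.a₆ - W.a₁ * (x * y) - W.a₃ * y := by
      rw [Affine.equation_iff] at h
      linear_combination h
    rw [e]
    exact v.map_sub_lt (v.map_sub_lt (v.map_add_lt (v.map_add_lt
      (map_mul_lt_one_left hW.a₂ (map_pow_le_one hx _)) (map_mul_lt_one_left hW.a₄ hx)) hW.a₆)
      (map_mul_lt_one_left hW.a₁ (map_mul_le_one hx hy))) (map_mul_lt_one_left hW.a₃ hy)
  have hx1 : v x = 1 := by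
    refine le_antisymm hx ?_
    by_contra! hlt
    refine h0 ⟨hlt, ?_⟩
    have : v (y ^ 2) < 1 := by
      rw [← sub_add_cancel (y ^ 2) (x ^ 3)]
      exact v.map_add_lt key (map_pow_lt_one hlt three_ne_zero)
    rw [map_pow] at this
    by_contra! h1
    exact this.not_ge (one_le_pow₀ h1)
  refine ⟨hx1, le_antisymm hy ?_, key⟩
  by_contra! hlt
  have : v (x ^ 3) < 1 := by
    have e : x ^ 3 = y ^ 2 - (y ^ 2 - x ^ 3) := by ring
    rw [e]
    exact v.map_sub_lt (map_pow_lt_one hlt two_ne_zero) key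
  rw [map_pow, hx1] at this
  simp at this

/-- The norm of the function `p(x) + y q(x)` on the affine curve `W` to the polynomial ring in
`x`. -/
noncomputable def normPolynomial {F : Type*} [Field F] (W : WeierstrassCurve F) (p q : F[X]) :
    F[X] :=
  p ^ 2 - p * q * (C W.a₁ * X + C W.a₃) - q ^ 2 * (X ^ 3 + C W.a₂ * X ^ 2 + C W.a₄ * X + C W.a₆)

/-- The difference between the norm polynomials of `p(x) - ε + y q(x)` on `W` and of `p(x) + y q(x)`
on the cuspidal cubic `y² = x³`. -/
noncomputable def cuspError {F : Type*} [Field F] (W : WeierstrassCurve F) (p q : F[X]) (ε : F) :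
    F[X] :=
  C ε * (C ε - 2 * p) - (C W.a₁ * X + C W.a₃) * ((p - C ε) * q) -
    (C W.a₂ * X ^ 2 + C W.a₄ * X + C W.a₆) * q ^ 2

theorem normPolynomial_eq {F : Type*} [Field F] (W : WeierstrassCurve F) (p q : F[X]) (ε : F) :
    normPolynomial W (p - C ε) q = p ^ 2 - X ^ 3 * q ^ 2 + cuspError W p q ε := by
  rw [normPolynomial, cuspError]; ring

theorem CuspAtOrigin.cuspError_mem {F : Type*} [Field F] {v : Valuation F Γ₀}
    {W : WeierstrassCurve F} (hW : CuspAtOrigin v W) {p q : F[X]} (hp : p ∈ integralPolynomials v)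
    (hq : q ∈ integralPolynomials v) {ε : F} (hε : v ε < 1) :
    cuspError W p q ε ∈ topNilPolynomials v := by
  have X1 : (X : F[X]) ∈ integralPolynomials v := X_mem_integralPolynomials
  have Cε := C_mem_integralPolynomials hε.le
  refine AddSubgroup.sub_mem _ (AddSubgroup.sub_mem _ ?_ ?_) ?_
  · exact mul_mem_topNilPolynomials (C_mem_topNilPolynomials hε) (Subring.sub_mem _
      Cε (Subring.mul_mem _ (ofNat_mem _ 2) hp))
  · exact mul_mem_topNilPolynomials (AddSubgroup.add_mem _ (mul_mem_topNilPolynomials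
      (C_mem_topNilPolynomials hW.a₁) X1) (C_mem_topNilPolynomials hW.a₃))
      (Subring.mul_mem _ (Subring.sub_mem _ hp Cε) hq)
  · exact mul_mem_topNilPolynomials (AddSubgroup.add_mem _ (AddSubgroup.add_mem _
      (mul_mem_topNilPolynomials (C_mem_topNilPolynomials hW.a₂) (Subring.pow_mem _ X1 2))
      (mul_mem_topNilPolynomials (C_mem_topNilPolynomials hW.a₄) X1))
      (C_mem_topNilPolynomials hW.a₆)) (Subring.pow_mem _ hq 2)

theorem natDegree_cuspError_le {F : Type*} [Field F] (W : WeierstrassCurve F) {p q : F[X]} {n : ℕ}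
    (hn : 2 ≤ n) (hp : p.natDegree ≤ (n + 1) / 2) (hq : q.natDegree ≤ (n + 1 - 3) / 2) (ε : F) :
    (cuspError W p q ε).natDegree ≤ n := by
  have hpε : (p - C ε).natDegree ≤ (n + 1) / 2 :=
    (natDegree_sub_le_of_le hp (natDegree_C ε).le).trans (by simp)
  have h1 : (C ε * (C ε - 2 * p)).natDegree ≤ n := by
    refine (natDegree_C_mul_le _ _).trans ?_
    refine (natDegree_sub_le_of_le (natDegree_C ε).le
      (natDegree_mul_le_of_le (natDegree_ofNat 2).le hp)).trans ?_
    omega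
  have h2 : ((C W.a₁ * X + C W.a₃) * ((p - C ε) * q)).natDegree ≤ n := by
    refine (natDegree_mul_le_of_le natDegree_linear_le (natDegree_mul_le_of_le hpε hq)).trans ?_
    omega
  have h3 : ((C W.a₂ * X ^ 2 + C W.a₄ * X + C W.a₆) * q ^ 2).natDegree ≤ n := by
    refine (natDegree_mul_le_of_le natDegree_quadratic_le (natDegree_pow_le_of_le 2 hq)).trans ?_
    omega
  exact (natDegree_sub_le_of_le (natDegree_sub_le_of_le h1 h2) h3).trans (by simp)

open scoped Classical in
/-- A point reducing to a smooth affine point of the cuspidal cubic `y² = x³` is a norm.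

The smooth points of the cuspidal cubic are `(t², t³)`, and points of this form sum to zero if the
inverses of their parameters do. For `P` reducing to `(c², c³)`, choose `w` in `L` such that the
inverses of its conjugates sum to `c⁻¹`. Then `(T + c) ∏ (T - σ w)` has no linear term and is
therefore the restriction of a function `p(x) + y q(x)` to the cuspidal cubic. Changing the constant
term one obtains a function on `W` that vanishes at `-P`. The norm polynomial of this function has
the simple root `w²` modulo the maximal ideal, so Hensel's lemma provides a zero `Q` of the function
with coordinates in `L`. Its zeros are then `-P` and the conjugates of `Q`, so that `P` is the sum
of the conjugates of `Q`. -/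
theorem IsHenselianUnramified.exists_sum_eq_of_cusp (hv : IsHenselianUnramified K v)
    (hn : Nontrivial (L ≃ₐ[K] L)) {W : WeierstrassCurve K} [W.IsElliptic]
    (hW : CuspAtOrigin v (W.baseChange L)) {x₀ y₀ : K} (h₀ : (W.baseChange K).toAffine.Nonsingular x₀ y₀)
    (hx₀ : v (algebraMap K L x₀) ≤ 1)
    (h : ¬(v (algebraMap K L x₀) < 1 ∧ v (algebraMap K L y₀) < 1)) :
    ∃ Q ∈ awayFromOrigin v (W.baseChange L),
      ∑ σ : L ≃ₐ[K] L, Affine.Point.map (W' := W) σ.toAlgHom Q =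
        Affine.Point.baseChange (W' := W) K L (.some x₀ y₀ h₀) := by
  set W' := W.baseChange L with hW'
  obtain ⟨x, hx⟩ : ∃ x, x = algebraMap K L x₀ := ⟨_, rfl⟩
  obtain ⟨y, hy⟩ : ∃ y, y = algebraMap K L y₀ := ⟨_, rfl⟩
  have h₁ : W'.toAffine.Nonsingular x y := by
    rw [hx, hy]
    exact (Affine.baseChange_nonsingular (W := W) (f := Algebra.ofId K L)
        (Algebra.ofId K L).injective ..).mpr h₀
  have hP : Affine.Point.baseChange (W' := W) K L (.some x₀ y₀ h₀) = .some x y h₁ := by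
    subst hx hy; rfl
  rw [← hx] at hx₀
  rw [← hx, ← hy] at h
  have hxσ : ∀ σ : L ≃ₐ[K] L, σ x = x := fun σ ↦ by rw [hx, σ.commutes]
  have hyσ : ∀ σ : L ≃ₐ[K] L, σ y = y := fun σ ↦ by rw [hy, σ.commutes]
  have haσ : ∀ (σ : L ≃ₐ[K] L), σ W'.a₁ = W'.a₁ ∧ σ W'.a₂ = W'.a₂ ∧ σ W'.a₃ = W'.a₃ ∧
      σ W'.a₄ = W'.a₄ ∧ σ W'.a₆ = W'.a₆ := fun σ ↦ by
    refine ⟨?_, ?_, ?_, ?_, ?_⟩ <;> exact σ.commutes _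
  obtain ⟨vx, vy, vxy⟩ := hW.val_coords h₁.1 hx₀ h
  have ne0 : ∀ {x : L}, v x = 1 → x ≠ 0 := fun {x} h h0 ↦ by simp [h0] at h
  have x0 := ne0 vx
  have y0 := ne0 vy
  obtain ⟨c, hc⟩ : ∃ c, c = y / x := ⟨_, rfl⟩
  have vc : v c = 1 := by rw [hc, map_div₀, vx, vy, div_one]
  have hcσ : ∀ σ : L ≃ₐ[K] L, σ c = c := fun σ ↦ by rw [hc, map_div₀, hxσ, hyσ]
  obtain ⟨w, vw, hsum, hw, hwc⟩ := hv.exists_sum_inv hn vc hcσ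
  -- the polynomial `(T + c) ∏ (T - σ w)`
  obtain ⟨r, hr⟩ : ∃ r : Option (L ≃ₐ[K] L) → L, r = fun i ↦ i.elim (-c) (fun σ ↦ σ w) := ⟨_, rfl⟩
  have r_none : r none = -c := by rw [hr]; rfl
  have r_some : ∀ σ, r (some σ) = σ w := fun σ ↦ by rw [hr]; rfl
  have vr : ∀ i, v (r i) = 1 := by
    rintro (_ | σ)
    · rw [r_none, Valuation.map_neg, vc]
    · rw [r_some, hv.map_algEquiv, vw]
  obtain ⟨f, hf⟩ : ∃ f, f = ∏ i, (X - C (r i)) := ⟨_, rfl⟩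
  have f1 : f.coeff 1 = 0 := by
    rw [hf]
    refine coeff_one_prod_X_sub_C (fun i ↦ ne0 (vr i)) ?_
    rw [Fintype.sum_option, r_none]
    simp only [r_some]
    rw [hsum, inv_neg, neg_add_cancel]
  have fint : f ∈ integralPolynomials v := hf ▸ prod_X_sub_C_mem_integralPolynomials fun i ↦ (vr i).le
  have fσ : ∀ (σ : L ≃ₐ[K] L) j, σ (f.coeff j) = f.coeff j := by
    intro σ j
    rw [hf]
    refine algEquiv_coeff_prod σ (Equiv.optionCongr (Equiv.mulLeft σ)) ?_ j
    rintro (_ | τ)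
    · simp [r_none, hcσ]
    · simp [r_some]
  set n := Fintype.card (L ≃ₐ[K] L) with hndef
  have hn2 : 2 ≤ n := Fintype.one_lt_card
  have hcard : Fintype.card (Option (L ≃ₐ[K] L)) = n + 1 := Fintype.card_option
  have fdeg : f.natDegree = n + 1 := by
    rw [hf, natDegree_prod_of_monic _ _ fun i _ ↦ monic_X_sub_C _]
    simp only [natDegree_X_sub_C, Finset.sum_const, smul_eq_mul, mul_one, Finset.card_univ, hcard]
  set A₀ := evenPart f with hA₀
  set B := oddPart f with hB
  have A₀int : A₀ ∈ integralPolynomials v := fun i ↦ by rw [coeff_evenPart]; exact fint _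
  have Bint : B ∈ integralPolynomials v := fun i ↦ by rw [coeff_oddPart]; exact fint _
  have A₀deg : A₀.natDegree ≤ (n + 1) / 2 := natDegree_evenPart_le fdeg.le
  have Bdeg : B.natDegree ≤ (n + 1 - 3) / 2 := natDegree_oddPart_le fdeg.le
  have feval := eval_eq_evenPart_add_oddPart f1
  rw [← hA₀, ← hB] at feval
  have froot : ∀ i, f.eval (r i) = 0 := fun i ↦ by
    rw [hf, eval_prod]; exact Finset.prod_eq_zero (Finset.mem_univ i) (by simp)
  -- the polynomial whose roots are the squares of the roots of `f`
  obtain ⟨M, hM⟩ : ∃ M, M = ∏ i, (X - C (r i ^ 2)) := ⟨_, rfl⟩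
  have Mmonic : M.Monic := hM ▸ monic_prod_of_monic _ _ fun i _ ↦ monic_X_sub_C _
  have Mdeg : M.natDegree = n + 1 := by
    rw [hM, natDegree_prod_of_monic _ _ fun i _ ↦ monic_X_sub_C _]
    simp only [natDegree_X_sub_C, Finset.sum_const, smul_eq_mul, mul_one, Finset.card_univ, hcard]
  have hH : A₀ ^ 2 - X ^ 3 * B ^ 2 = (-1) ^ (n + 1) * M := by
    rw [hA₀, hB, hM, ← hcard, hf]
    exact evenPart_sq_sub_oddPart_sq (hf ▸ f1)
  have Mint : M ∈ integralPolynomials v :=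
    hM ▸ prod_X_sub_C_mem_integralPolynomials fun i ↦ by rw [map_pow, vr]; simp
  have Mw : M.eval (w ^ 2) = 0 := by
    rw [hM, eval_prod]
    refine Finset.prod_eq_zero (Finset.mem_univ (some 1)) ?_
    simp [r_some]
  have vw2 : v (w ^ 2) = 1 := by rw [map_pow, vw, one_pow]
  have M'w : v (M.derivative.eval (w ^ 2)) = 1 := by
    have e : M = (X - C (w ^ 2)) * ∏ i ∈ Finset.univ.erase (some 1), (X - C (r i ^ 2)) := by
      rw [hM, ← Finset.mul_prod_erase _ _ (Finset.mem_univ (some 1)), r_some]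
      rfl
    rw [e, derivative_mul]
    simp only [derivative_sub, derivative_X, derivative_C, sub_zero, one_mul, eval_add, eval_mul,
      eval_sub, eval_X, eval_C, sub_self, zero_mul, add_zero, eval_prod]
    rw [map_prod]
    refine Finset.prod_eq_one ?_
    rintro (_ | σ) hi
    · rw [r_none, neg_sq]; exact hwc
    · rw [r_some]
      exact hw σ fun h1 ↦ by simp [h1] at hi
  -- the function vanishing at `-P`
  obtain ⟨y', hy'⟩ : ∃ y', y' = W'.toAffine.negY x y := ⟨_, rfl⟩
  have h₁' : W'.toAffine.Nonsingular x y' := hy' ▸ (Affine.nonsingular_neg ..).mpr h₁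
  have hyσ' : ∀ σ : L ≃ₐ[K] L, σ y' = y' := fun σ ↦ by
    rw [hy', Affine.negY]
    simp only [map_sub, map_neg, map_mul, hxσ, hyσ]
    rw [(haσ σ).1, (haσ σ).2.2.1]
  obtain ⟨ε, hε⟩ : ∃ ε, ε = A₀.eval x + y' * B.eval x := ⟨_, rfl⟩
  have xc : v (x - c ^ 2) < 1 := by
    have e : x - c ^ 2 = -(y ^ 2 - x ^ 3) / x ^ 2 := by rw [hc]; field_simp; ring
    rw [e, map_div₀, Valuation.map_neg, map_pow, vx]
    simpa using vxy
  have y'c : v (y' - (-c) ^ 3) < 1 := by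
    have e : y' - (-c) ^ 3 = y * (y ^ 2 - x ^ 3) / x ^ 3 + (-W'.a₁ * x - W'.a₃) := by
      rw [hy', Affine.negY, hc]; field_simp; ring
    rw [e]
    refine v.map_add_lt ?_ (v.map_sub_lt (map_mul_lt_one_left ?_ vx.le) hW.a₃)
    · simpa [vx, vy] using vxy
    · rw [Valuation.map_neg]; exact hW.a₁
  have vε : v ε < 1 := by
    have e : ε = (A₀.eval x - A₀.eval ((-c) ^ 2)) + (-c) ^ 3 * (B.eval x - B.eval ((-c) ^ 2)) +
        (y' - (-c) ^ 3) * B.eval x := by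
      have h0 := froot none
      rw [r_none, feval] at h0
      rw [hε]
      linear_combination h0
    have vc2 : v ((-c) ^ 2) ≤ 1 := by simp [vc]
    have xc' : v (x - (-c) ^ 2) < 1 := by rwa [neg_sq]
    rw [e]
    refine v.map_add_lt (v.map_add_lt (eval_sub_eval_lt_one A₀int vx.le vc2 xc') ?_) ?_
    · exact map_mul_lt_one_right (by simp [vc]) (eval_sub_eval_lt_one Bint vx.le vc2 xc')
    · exact map_mul_lt_one_left y'c (eval_le_one Bint vx.le)
  set A := A₀ - C ε with hA
  have AP : A.eval x + y' * B.eval x = 0 := by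
    rw [hA, eval_sub, eval_C, hε]; ring
  have Aσ : ∀ (σ : L ≃ₐ[K] L) j, σ (A.coeff j) = A.coeff j := by
    intro σ j
    have εσ : σ ε = ε := by
      rw [hε, map_add, map_mul, algEquiv_eval fun i ↦ by rw [coeff_evenPart]; exact fσ σ _,
        algEquiv_eval fun i ↦ by rw [coeff_oddPart]; exact fσ σ _, hxσ, hyσ']
    rw [hA, coeff_sub, map_sub, coeff_evenPart, fσ, coeff_C]
    split_ifs
    · rw [εσ]
    · rw [map_zero]
  have Bσ : ∀ (σ : L ≃ₐ[K] L) j, σ (B.coeff j) = B.coeff j := fun σ j ↦ by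
    rw [coeff_oddPart]; exact fσ σ _
  have Aint : A ∈ integralPolynomials v := Subring.sub_mem _ A₀int (C_mem_integralPolynomials vε.le)
  obtain ⟨D, hD⟩ : ∃ D, D = cuspError W' A₀ B ε := ⟨_, rfl⟩
  obtain ⟨N, hN⟩ : ∃ N, N = normPolynomial W' A B := ⟨_, rfl⟩
  have ND : N = (-1) ^ (n + 1) * M + D := by
    rw [hN, hA, normPolynomial_eq, ← hH, hD]
  have Dnil : D ∈ topNilPolynomials v := hD ▸ hW.cuspError_mem A₀int Bint vε
  have Ddeg : D.natDegree ≤ n := hD ▸ natDegree_cuspError_le W' hn2 A₀deg Bdeg ε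
  have sgn : ((-1) ^ (n + 1) * (-1) ^ (n + 1) : L[X]) = 1 := by
    rw [← mul_pow]; simp
  have sint : ((-1) ^ (n + 1) : L[X]) ∈ integralPolynomials v :=
    Subring.pow_mem _ (Subring.neg_mem _ (Subring.one_mem _)) _
  obtain ⟨D', hD'⟩ : ∃ D', D' = D * (-1) ^ (n + 1) := ⟨_, rfl⟩
  have D'nil : D' ∈ topNilPolynomials v := hD' ▸ mul_mem_topNilPolynomials Dnil sint
  have D'deg : D'.degree < M.degree := by
    rw [degree_eq_natDegree Mmonic.ne_zero, Mdeg]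
    refine lt_of_le_of_lt (degree_le_of_natDegree_le (n := n) ?_) (by exact_mod_cast n.lt_succ_self)
    rw [hD']
    refine (natDegree_mul_le_of_le Ddeg (natDegree_pow_le_of_le (n + 1)
      (m := 0) (by simp))).trans (by simp)
  have NM : N * (-1) ^ (n + 1) = M + D' := by
    rw [ND, hD']; linear_combination M * sgn
  have NM' : N = (M + D') * (-1) ^ (n + 1) := by
    rw [← NM]; linear_combination -N * sgn
  have Ndeg : N.natDegree = n + 1 := by
    have h1 : (M + D').natDegree = n + 1 := by
      rw [natDegree_add_eq_left_of_degree_lt D'deg, Mdeg]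
    have h2 : ((-1) ^ (n + 1) : L[X]) = 1 ∨ ((-1) ^ (n + 1) : L[X]) = -1 := neg_one_pow_eq_or _ _
    rw [NM']
    rcases h2 with h2 | h2 <;> rw [h2]
    · rw [mul_one, h1]
    · rw [mul_neg, mul_one, natDegree_neg, h1]
  obtain ⟨x₁, hx₁, vx₁⟩ := hv.hensel (M + D') (w ^ 2) (Mmonic.add_of_left D'deg)
    (Subring.add_mem _ Mint fun i ↦ (D'nil i).le) vw2.le
    (by rw [eval_add, Mw, zero_add]; exact eval_lt_one D'nil vw2.le)
    (by
      rw [derivative_add, eval_add, v.map_add_eq_of_lt_left, M'w]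
      rw [M'w]; exact eval_lt_one (derivative_mem_topNilPolynomials D'nil) vw2.le)
  have v1 : v x₁ = 1 := by
    rw [← sub_add_cancel x₁ (w ^ 2), v.map_add_eq_of_lt_right (by rwa [vw2]), vw2]
  -- `B` does not vanish at `w²` modulo the maximal ideal, because `w²` is a simple root of `M`
  have vBw : v (B.eval (w ^ 2)) = 1 := by
    refine le_antisymm (eval_le_one Bint vw2.le) ?_
    by_contra! hlt
    have h1 : A₀.eval (w ^ 2) = -w ^ 3 * B.eval (w ^ 2) := by
      have h0 := froot (some 1)
      rw [r_some, feval] at h0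
      have e1 : (1 : L ≃ₐ[K] L) w = w := rfl
      rw [e1] at h0
      linear_combination h0
    have h2 : v (A₀.eval (w ^ 2)) < 1 := by
      rw [h1]; exact map_mul_lt_one_right (by simp [vw]) hlt
    have h3 := congrArg (fun p ↦ (derivative p).eval (w ^ 2)) hH
    have e2 : derivative ((-1) ^ (n + 1) * M) = (-1) ^ (n + 1) * derivative M := by
      rcases neg_one_pow_eq_or L[X] (n + 1) with h2 | h2 <;> rw [h2] <;> simp
    simp only [e2, derivative_sub, derivative_mul, derivative_pow, eval_sub,
      eval_mul, eval_add, eval_pow, eval_neg, eval_one, eval_X, eval_C] at h3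
    have h4 : v ((-1) ^ (n + 1) * (derivative M).eval (w ^ 2)) = 1 := by
      rw [map_mul, M'w]; simp
    rw [← h3] at h4
    refine h4.not_lt (v.map_sub_lt ?_ (v.map_add_lt ?_ ?_))
    · refine map_mul_lt_one_left (map_mul_lt_one_right (map_natCast_le_one _) ?_)
        (eval_le_one (derivative_mem_integralPolynomials A₀int) vw2.le)
      simpa using h2
    · exact map_mul_lt_one_right (map_mul_le_one (map_mul_le_one (map_natCast_le_one _)
        (map_pow_le_one vw2.le _)) (eval_le_one (derivative_mem_integralPolynomials
        X_mem_integralPolynomials) vw2.le)) (map_pow_lt_one hlt two_ne_zero)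
    · refine map_mul_lt_one_right (map_pow_le_one vw2.le _) (map_mul_lt_one_left
        (map_mul_lt_one_right (map_natCast_le_one _) ?_)
        (eval_le_one (derivative_mem_integralPolynomials Bint) vw2.le))
      simpa using hlt
  have B0 : B.eval x₁ ≠ 0 := by
    intro h0
    have := eval_sub_eval_lt_one Bint v1.le vw2.le vx₁
    rw [h0, zero_sub, Valuation.map_neg, vBw] at this
    exact lt_irrefl _ this
  obtain ⟨y₁, hy₁⟩ : ∃ y₁, y₁ = -A.eval x₁ / B.eval x₁ := ⟨_, rfl⟩
  have ABQ : A.eval x₁ + y₁ * B.eval x₁ = 0 := by rw [hy₁]; field_simp; ring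
  have hQ : W'.toAffine.Nonsingular x₁ y₁ := by
    have : W'.toAffine.IsElliptic := inferInstanceAs (W.map (algebraMap K L)).IsElliptic
    rw [← Affine.equation_iff_nonsingular, Affine.equation_iff]
    have hN0 : N.eval x₁ = 0 := by rw [NM', eval_mul, hx₁, zero_mul]
    rw [hN, normPolynomial] at hN0
    simp only [eval_sub, eval_mul, eval_add, eval_pow, eval_X, eval_C] at hN0
    refine mul_left_cancel₀ (pow_ne_zero 2 B0) ?_
    linear_combination hN0 + (B.eval x₁ * (W'.a₁ * x₁ + W'.a₃ + y₁) - A.eval x₁) * ABQ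
  refine ⟨.some x₁ y₁ hQ, some_mem_awayFromOrigin.mpr fun hlt ↦ by simp [v1] at hlt, ?_⟩
  -- the zeros of the function are `-P` and the conjugates of `Q`
  obtain ⟨px, hpx⟩ : ∃ px : Option (L ≃ₐ[K] L) → L, px = fun i ↦ i.elim x (fun σ ↦ σ x₁) := ⟨_, rfl⟩
  obtain ⟨py, hpy⟩ : ∃ py : Option (L ≃ₐ[K] L) → L, py = fun i ↦ i.elim y' (fun σ ↦ σ y₁) :=
    ⟨_, rfl⟩
  have hns : ∀ i, W'.toAffine.Nonsingular (px i) (py i) := by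
    rintro (_ | σ)
    · rw [hpx, hpy]; exact h₁'
    · rw [hpx, hpy]
      exact (Affine.baseChange_nonsingular (W := W) (f := σ.toAlgHom) σ.injective ..).mpr hQ
  have vpx : ∀ i, v (px i - r i ^ 2) < 1 := by
    rintro (_ | σ)
    · rw [r_none, hpx, neg_sq]; exact xc
    · rw [r_some, hpx]
      change v (σ x₁ - σ w ^ 2) < 1
      rw [← map_pow, ← map_sub, hv.map_algEquiv]
      exact vx₁
  have vrr : ∀ i j, i ≠ j → v (r i ^ 2 - r j ^ 2) = 1 := by
    have key : ∀ σ : L ≃ₐ[K] L, v (σ w ^ 2 - c ^ 2) = 1 := fun σ ↦ by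
      rw [← hcσ σ, ← map_pow, ← map_pow, ← map_sub, hv.map_algEquiv, hwc]
    rintro (_ | σ) (_ | τ) hij
    · exact absurd rfl hij
    · rw [r_none, r_some, neg_sq, Valuation.map_sub_swap]; exact key τ
    · rw [r_none, r_some, neg_sq]; exact key σ
    · rw [r_some, r_some, ← hv.map_algEquiv σ⁻¹, map_sub, map_pow, map_pow]
      change v ((σ⁻¹ * σ) w ^ 2 - (σ⁻¹ * τ) w ^ 2) = 1
      rw [inv_mul_cancel]
      refine hw _ fun h1 ↦ hij ?_
      rw [inv_mul_eq_one.mp h1]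
  have hinj : Function.Injective px := by
    intro i j hij
    by_contra hne
    have := vrr i j hne
    have e : r i ^ 2 - r j ^ 2 = (px j - r j ^ 2) - (px i - r i ^ 2) := by rw [hij]; ring
    rw [e] at this
    exact this.not_lt (v.map_sub_lt (vpx j) (vpx i))
  have hzero : ∀ i, A.eval (px i) + py i * B.eval (px i) = 0 := by
    rintro (_ | σ)
    · rw [hpx, hpy]; exact AP
    · rw [hpx, hpy]
      change A.eval (σ x₁) + σ y₁ * B.eval (σ x₁) = 0
      rw [← algEquiv_eval (Aσ σ), ← algEquiv_eval (Bσ σ), ← map_mul, ← map_add, ABQ, map_zero]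
  have key := sum_eq_zero_of_eval_eq_zero hinj hns hzero (by
    rw [hcard, ← Ndeg, hN]; rfl)
  rw [Fintype.sum_option] at key
  have e1 : Affine.Point.some (px none) (py none) (hns none) = -Affine.Point.some x y h₁ := by
    rw [Affine.Point.neg_some, Affine.Point.some.injEq]
    exact ⟨by rw [hpx]; rfl, by rw [hpy, ← hy']; rfl⟩
  rw [e1, neg_add_eq_zero] at key
  rw [hP, key]
  refine Finset.sum_congr rfl fun σ _ ↦ ?_
  rw [Affine.Point.map_some, Affine.Point.some.injEq]
  exact ⟨by rw [hpx]; rfl, by rw [hpy]; rfl⟩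

end Cusp

/-! ### Changes of variables and base change -/

section BaseChange

variable {K : Type*} [Field K]

theorem smul_baseChange (W : WeierstrassCurve K) (C : VariableChange K) (F : Type*) [Field F]
    [Algebra K F] : C.map (algebraMap K F) • W.baseChange F = (C • W).baseChange F :=
  map_variableChange W C (algebraMap K F)

open scoped Classical in
/-- The isomorphism `W(F) ≃ (C • W)(F)` for an extension `F` of the field of definition of `W`
and `C`. -/
noncomputable def baseChangeHom (W : WeierstrassCurve K) (C : VariableChange K) (F : Type*) [Field F]
    [Algebra K F] :
    (W.baseChange F).toAffine.Point →+ ((C • W).baseChange F).toAffine.Point :=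
  pointHom (C.map (algebraMap K F)) (smul_baseChange W C F)

variable {W : WeierstrassCurve K} {C : VariableChange K} {F F' : Type*} [Field F] [Algebra K F]
  [Field F'] [Algebra K F']

open scoped Classical in
theorem baseChangeHom_some {x y : F} (h : (W.baseChange F).toAffine.Nonsingular x y) :
    baseChangeHom W C F (.some x y h) = .some (coordX (C.map (algebraMap K F)) x)
      (coordY (C.map (algebraMap K F)) x y)
      (smul_baseChange W C F ▸ nonsingular_coord _ _ h) := rfl

open scoped Classical in
theorem baseChangeHom_bijective : Function.Bijective (baseChangeHom W C F) :=
  pointHom_bijective _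

open scoped Classical in
theorem map_baseChangeHom (f : F →ₐ[K] F') (P : (W.baseChange F).toAffine.Point) :
    Affine.Point.map (W' := C • W) f (baseChangeHom W C F P) =
      baseChangeHom W C F' (Affine.Point.map (W' := W) f P) := by
  rcases P with _ | ⟨x, y, h⟩
  · rfl
  · have hu : ∀ n, f ((((C.map (algebraMap K F)).u⁻¹ : Fˣ) : F) ^ n) =
        (((C.map (algebraMap K F')).u⁻¹ : F'ˣ) : F') ^ n := fun n ↦ by
      simp [VariableChange.map]
    rw [baseChangeHom_some, Affine.Point.map_some, Affine.Point.map_some, baseChangeHom_some,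
      Affine.Point.some.injEq]
    constructor
    · simp only [coordX, map_mul, hu, map_sub]
      simp [VariableChange.map]
    · simp only [coordY, map_mul, hu, map_sub]
      simp [VariableChange.map]

variable [FiniteDimensional K F]

open scoped Classical in
/-- Norms of points are compatible with changes of variables. -/
theorem sum_map_eq_of_baseChangeHom {P : (W.baseChange K).toAffine.Point}
    {Q : (W.baseChange F).toAffine.Point}
    (h : ∑ σ : F ≃ₐ[K] F, Affine.Point.map (W' := C • W) σ.toAlgHom (baseChangeHom W C F Q) =
      Affine.Point.baseChange (W' := C • W) K F (baseChangeHom W C K P)) :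
    ∑ σ : F ≃ₐ[K] F, Affine.Point.map (W' := W) σ.toAlgHom Q =
      Affine.Point.baseChange (W' := W) K F P := by
  refine (baseChangeHom_bijective (C := C)).1 ?_
  rw [map_sum]
  simp only [← map_baseChangeHom]
  exact h

end BaseChange

section Cusp

variable {K L Γ₀ : Type*} [Field K] [Field L] [Algebra K L] [FiniteDimensional K L]
  [LinearOrderedCommGroupWithZero Γ₀] {v : Valuation L Γ₀}

open scoped Classical in
/-- The points reducing to infinity form a subgroup. -/
theorem sub_mem_nearInfinity {F : Type*} [Field F] {v : Valuation F Γ₀} {W : WeierstrassCurve F}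
    (hW : SingularAtOrigin v W) {ϖ : Fˣ} (hϖ : v (ϖ : F) < 1)
    (hmax : ∀ x : F, v x < 1 → v x ≤ v (ϖ : F)) {P Q : W.toAffine.Point}
    (hP : P ∈ nearInfinity v W) (hQ : Q ∈ nearInfinity v W) : P - Q ∈ nearInfinity v W := by
  rw [← pointHom_scaling_mem_awayFromOrigin_iff hW hϖ hmax rfl] at hP hQ ⊢
  rw [map_sub]
  exact (awaySubgroup v _ (hW.cuspAtOrigin_scaling hϖ).singularAtOrigin).sub_mem hP hQ

open scoped Classical in
/-- A cuspidal cubic has a smooth affine point, namely `(1, 1)`, which lifts to a `K`-rational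
point. -/
theorem IsHenselianUnramified.exists_point_of_cusp (hv : IsHenselianUnramified K v)
    {W : WeierstrassCurve K} [W.IsElliptic] (hW : CuspAtOrigin v (W.baseChange L)) :
    ∃ x : K, (W.baseChange K).toAffine.Nonsingular x x ∧ v (algebraMap K L x) = 1 := by
  set f : K[X] := X ^ 3 + (C (W.a₂ - W.a₁ - 1) * X ^ 2 + C (W.a₄ - W.a₃) * X + C W.a₆) with hf
  have w₁ : v (algebraMap K L W.a₁) < 1 := hW.a₁
  have w₂ : v (algebraMap K L W.a₂) < 1 := hW.a₂
  have w₃ : v (algebraMap K L W.a₃) < 1 := hW.a₃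
  have w₄ : v (algebraMap K L W.a₄) < 1 := hW.a₄
  have w₆ : v (algebraMap K L W.a₆) < 1 := hW.a₆
  have fmonic : f.Monic := by
    refine (monic_X_pow 3).add_of_left ?_
    rw [degree_X_pow]
    exact lt_of_le_of_lt degree_quadratic_le (by norm_num)
  have fint : f ∈ integralPolynomials (v.comap (algebraMap K L)) := by
    refine Subring.add_mem _ (Subring.pow_mem _ X_mem_integralPolynomials 3) (Subring.add_mem _
      (Subring.add_mem _ (Subring.mul_mem _ (C_mem_integralPolynomials ?_)
      (Subring.pow_mem _ X_mem_integralPolynomials 2)) (Subring.mul_mem _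
      (C_mem_integralPolynomials ?_) X_mem_integralPolynomials)) (C_mem_integralPolynomials w₆.le))
    · rw [Valuation.comap_apply, map_sub (algebraMap K L), map_sub (algebraMap K L)]
      exact v.map_sub_le (v.map_sub_le w₂.le w₁.le) (by simp)
    · rw [Valuation.comap_apply, map_sub (algebraMap K L)]
      exact v.map_sub_le w₄.le w₃.le
  obtain ⟨x, hx, hx1⟩ := hv.hensel_base f 1 fmonic fint (by simp) (by
    have e : f.eval 1 = W.a₂ - W.a₁ + (W.a₄ - W.a₃) + W.a₆ := by simp [hf]; ring
    rw [e, map_add (algebraMap K L), map_add (algebraMap K L),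
      map_sub (algebraMap K L), map_sub (algebraMap K L)]
    exact v.map_add_lt (v.map_add_lt (v.map_sub_lt w₂ w₁) (v.map_sub_lt w₄ w₃)) w₆) (by
    have e : f.derivative.eval 1 = 1 + (2 * (W.a₂ - W.a₁) + (W.a₄ - W.a₃)) := by
      simp [hf]; ring
    rw [e, map_add (algebraMap K L), map_one (algebraMap K L),
      v.map_add_eq_of_lt_left, map_one]
    rw [map_one, map_add (algebraMap K L), map_mul (algebraMap K L), map_sub (algebraMap K L),
      map_sub (algebraMap K L), map_ofNat]
    exact v.map_add_lt (map_mul_lt_one_right (map_ofNat_le_one 2) (v.map_sub_lt w₂ w₁))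
      (v.map_sub_lt w₄ w₃))
  refine ⟨x, ?_, ?_⟩
  · have : (W.baseChange K).toAffine.IsElliptic :=
      inferInstanceAs (W.map (algebraMap K K)).IsElliptic
    rw [← Affine.equation_iff_nonsingular, Affine.equation_iff]
    simp [hf] at hx
    simp only [baseChange, map_a₁, map_a₂, map_a₃, map_a₄, map_a₆, Algebra.algebraMap_self,
      RingHom.id_apply]
    linear_combination -hx
  · have e : algebraMap K L x = 1 + algebraMap K L (x - 1) := by simp
    rw [e, v.map_add_eq_of_lt_left (by simpa using hx1), map_one]

open scoped Classical in
/-- If `W` reduces to the cuspidal cubic `y² = x³`, then the norm is surjective on the points that do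
not reduce to the cusp. -/
theorem IsHenselianUnramified.exists_norm_eq_of_cusp (hv : IsHenselianUnramified K v)
    (hn : Nontrivial (L ≃ₐ[K] L)) {W : WeierstrassCurve K} [W.IsElliptic]
    (hW : CuspAtOrigin v (W.baseChange L)) {P : (W.baseChange K).toAffine.Point}
    (hP : Affine.Point.baseChange (W' := W) K L P ∈ awayFromOrigin v (W.baseChange L)) :
    ∃ Q ∈ awayFromOrigin v (W.baseChange L),
      ∑ σ : L ≃ₐ[K] L, Affine.Point.map (W' := W) σ.toAlgHom Q =
        Affine.Point.baseChange (W' := W) K L P := by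
  have core : ∀ R : (W.baseChange K).toAffine.Point,
      Affine.Point.baseChange (W' := W) K L R ∈ awayFromOrigin v (W.baseChange L) →
      Affine.Point.baseChange (W' := W) K L R ∉ nearInfinity v (W.baseChange L) →
      ∃ Q ∈ awayFromOrigin v (W.baseChange L),
      ∑ σ : L ≃ₐ[K] L, Affine.Point.map (W' := W) σ.toAlgHom Q =
        Affine.Point.baseChange (W' := W) K L R := by
    rintro (_ | ⟨x, y, h⟩) h1 h2
    · exact (h2 fun _ _ _ e ↦ by cases e).elim
    · rw [Affine.Point.baseChange, Affine.Point.map_some, some_mem_awayFromOrigin] at h1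
      rw [Affine.Point.baseChange, Affine.Point.map_some, some_mem_nearInfinity, not_lt] at h2
      exact hv.exists_sum_eq_of_cusp hn hW h h2 h1
  by_cases hP' : Affine.Point.baseChange (W' := W) K L P ∈ nearInfinity v (W.baseChange L)
  · -- `P` is the difference of two points not reducing to infinity
    obtain ⟨ϖ, hϖ, hmax⟩ := hv.exists_uniformizer
    obtain ⟨x, h, vx⟩ := hv.exists_point_of_cusp hW
    set P₀ : (W.baseChange K).toAffine.Point := .some x x h with hP₀
    have h₀ : Affine.Point.baseChange (W' := W) K L P₀ ∉ nearInfinity v (W.baseChange L) := by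
      rw [hP₀, Affine.Point.baseChange, Affine.Point.map_some, some_mem_nearInfinity]
      exact vx.not_gt
    have h₀' : Affine.Point.baseChange (W' := W) K L P₀ ∈ awayFromOrigin v (W.baseChange L) := by
      rw [hP₀, Affine.Point.baseChange, Affine.Point.map_some, some_mem_awayFromOrigin]
      exact fun hlt ↦ hlt.1.ne vx
    have h₁ : Affine.Point.baseChange (W' := W) K L (P + P₀) ∉ nearInfinity v (W.baseChange L) := by
      intro h1
      refine h₀ ?_
      have e : Affine.Point.baseChange (W' := W) K L P₀ =
          Affine.Point.baseChange (W' := W) K L (P + P₀) -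
            Affine.Point.baseChange (W' := W) K L P := by
        rw [← map_sub, add_sub_cancel_left]
      rw [e]
      exact sub_mem_nearInfinity hW.singularAtOrigin
        (ϖ := Units.map (algebraMap K L : K →* L) ϖ) hϖ hmax h1 hP'
    have h₁' : Affine.Point.baseChange (W' := W) K L (P + P₀) ∈
        awayFromOrigin v (W.baseChange L) := by
      rw [map_add]
      exact add_mem_awayFromOrigin hW.singularAtOrigin hP h₀'
    obtain ⟨Q₀, hQ₀, e₀⟩ := core _ h₀' h₀
    obtain ⟨Q₁, hQ₁, e₁⟩ := core _ h₁' h₁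
    refine ⟨Q₁ - Q₀, (awaySubgroup v _ hW.singularAtOrigin).sub_mem hQ₁ hQ₀, ?_⟩
    simp only [map_sub, Finset.sum_sub_distrib]
    rw [e₀, e₁, ← map_sub, add_sub_cancel_right]
  · exact core P hP hP'

open scoped Classical in
/-- The norm is surjective on the points reducing to infinity: on a model scaled by a uniformiser,
these are the points that do not reduce to the cusp. -/
theorem IsHenselianUnramified.exists_norm_eq_of_nearInfinity (hv : IsHenselianUnramified K v)
    (hn : Nontrivial (L ≃ₐ[K] L)) {W : WeierstrassCurve K} [W.IsElliptic]
    (hW : SingularAtOrigin v (W.baseChange L)) {P : (W.baseChange K).toAffine.Point}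
    (hP : Affine.Point.baseChange (W' := W) K L P ∈ nearInfinity v (W.baseChange L)) :
    ∃ Q ∈ nearInfinity v (W.baseChange L),
      ∑ σ : L ≃ₐ[K] L, Affine.Point.map (W' := W) σ.toAlgHom Q =
        Affine.Point.baseChange (W' := W) K L P := by
  obtain ⟨ϖ, hϖ, hmax⟩ := hv.exists_uniformizer
  set ϖ' : Lˣ := Units.map (algebraMap K L : K →* L) ϖ with hϖ'
  have hϖ1 : v (ϖ' : L) < 1 := hϖ
  have hmap : (scaling ϖ).map (algebraMap K L) = scaling ϖ' := by
    ext <;> simp [scaling, hϖ', VariableChange.map]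
  have hcurve : scaling ϖ' • W.baseChange L = (scaling ϖ • W).baseChange L := by
    rw [← hmap]; exact map_variableChange W (scaling ϖ) (algebraMap K L)
  have hhom : ∀ Q, baseChangeHom W (scaling ϖ) L Q = pointHom (scaling ϖ') hcurve Q := by
    rintro (_ | ⟨x, y, h⟩)
    · rfl
    · rw [baseChangeHom_some, pointHom_some, Affine.Point.some.injEq, hmap]
      exact ⟨rfl, rfl⟩
  have hW' : CuspAtOrigin v ((scaling ϖ • W).baseChange L) := by
    rw [← hcurve]; exact hW.cuspAtOrigin_scaling hϖ1
  have hmem : ∀ Q, baseChangeHom W (scaling ϖ) L Q ∈ awayFromOrigin v _ ↔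
      Q ∈ nearInfinity v (W.baseChange L) := fun Q ↦ by
    rw [hhom]; exact pointHom_scaling_mem_awayFromOrigin_iff hW hϖ1 hmax hcurve
  obtain ⟨Q', hQ', e⟩ := hv.exists_norm_eq_of_cusp hn hW'
    (P := baseChangeHom W (scaling ϖ) K P) (by
      rw [Affine.Point.baseChange, map_baseChangeHom, hmem]; exact hP)
  obtain ⟨Q, rfl⟩ := baseChangeHom_bijective.2 Q'
  exact ⟨Q, (hmem Q).mp hQ', sum_map_eq_of_baseChangeHom e⟩

end Cusp

/-! ### The norm onto points away from a node with conjugate tangents -/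

section Node

variable {K L Γ₀ : Type*} [Field K] [Field L] [Algebra K L]
  [LinearOrderedCommGroupWithZero Γ₀] {v : Valuation L Γ₀}

theorem nearInfinity_subset_awayFromOrigin {W : WeierstrassCurve L} {P : W.toAffine.Point}
    (hP : P ∈ nearInfinity v W) : P ∈ awayFromOrigin v W := by
  rcases P with _ | ⟨x, y, h⟩
  · exact zero_mem_awayFromOrigin
  · rw [some_mem_nearInfinity] at hP
    rw [some_mem_awayFromOrigin]
    exact fun h ↦ h.1.not_gt hP

open scoped Classical in
theorem map_mem_awayFromOrigin (hv : ∀ (σ : L ≃ₐ[K] L) (x : L), v (σ x) = v x)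
    {W : WeierstrassCurve K} (σ : L ≃ₐ[K] L) {P : (W.baseChange L).toAffine.Point}
    (hP : P ∈ awayFromOrigin v (W.baseChange L)) :
    Affine.Point.map (W' := W) σ.toAlgHom P ∈ awayFromOrigin v (W.baseChange L) := by
  rcases P with _ | ⟨x, y, h⟩
  · exact zero_mem_awayFromOrigin
  · rw [some_mem_awayFromOrigin] at hP
    rw [Affine.Point.map_some, some_mem_awayFromOrigin]
    simpa [hv] using hP

open scoped Classical in
theorem slopeRatio_map {W : WeierstrassCurve K} {α β : L} {σ : L ≃ₐ[K] L} (hα : σ α = β)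
    (hβ : σ β = α) (P : (W.baseChange L).toAffine.Point) :
    slopeRatio α β (Affine.Point.map (W' := W) σ.toAlgHom P) = (σ (slopeRatio α β P))⁻¹ := by
  rcases P with _ | ⟨x, y, h⟩
  · change (1 : L) = (σ 1)⁻¹
    simp
  · rw [Affine.Point.map_some, slopeRatio, slopeRatio, map_div₀, inv_div, map_sub, map_sub, map_mul,
      map_mul, hα, hβ]
    rfl

variable [FiniteDimensional K L]

/-- Every unit is congruent to the `slopeRatio` of some point: the point is found on a line through
the node. -/
theorem IsHenselianUnramified.exists_slopeRatio (hv : IsHenselianUnramified K v)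
    {W : WeierstrassCurve L} [W.IsElliptic] (hW : SingularAtOrigin v W) {α β : L}
    (hα : NodeSlopes W v α β) {w : L} (hw : v w = 1) :
    ∃ Q ∈ awayFromOrigin v W, v (slopeRatio α β Q - w) < 1 := by
  by_cases hw1 : v (1 - w) < 1
  · exact ⟨0, zero_mem_awayFromOrigin, hw1⟩
  have hw1 : v (1 - w) = 1 := le_antisymm (v.map_sub_le (by simp) hw.le) (not_lt.mp hw1)
  have hw0 : 1 - w ≠ 0 := fun h ↦ by simp [h] at hw1
  obtain ⟨m, hm⟩ : ∃ m, m = (α - w * β) / (1 - w) := ⟨_, rfl⟩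
  have mα : m - α = w * (α - β) / (1 - w) := by rw [hm]; field_simp; ring
  have mβ : m - β = (α - β) / (1 - w) := by rw [hm]; field_simp; ring
  have vmα : v (m - α) = 1 := by rw [mα]; simp [hw, hα.sub, hw1]
  have vmβ : v (m - β) = 1 := by rw [mβ]; simp [hα.sub, hw1]
  have mβ0 : m - β ≠ 0 := fun h ↦ by simp [h] at vmβ
  have vm : v m ≤ 1 := by
    have e : m = (m - α) + α := by ring
    rw [e]; exact v.map_add_le vmα.le hα.left
  obtain ⟨c, hc⟩ : ∃ c, c = m ^ 2 + W.a₁ * m - W.a₂ := ⟨_, rfl⟩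
  have hc' : c = (m - α) * (m - β) := by
    rw [hc]; linear_combination m * hα.add - hα.mul
  have vc : v c = 1 := by rw [hc', map_mul, vmα, vmβ, one_mul]
  set f : L[X] := X ^ 3 + (C (-c) * X ^ 2 + C (W.a₄ - W.a₃ * m) * X + C W.a₆) with hf
  have v₄ : v (W.a₄ - W.a₃ * m) < 1 := v.map_sub_lt hW.a₄ (map_mul_lt_one_left hW.a₃ vm)
  have fmonic : f.Monic := by
    refine (monic_X_pow 3).add_of_left ?_
    rw [degree_X_pow]
    exact lt_of_le_of_lt degree_quadratic_le (by norm_num)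
  have fint : f ∈ integralPolynomials v := by
    refine Subring.add_mem _ (Subring.pow_mem _ X_mem_integralPolynomials 3) (Subring.add_mem _
      (Subring.add_mem _ (Subring.mul_mem _ (C_mem_integralPolynomials ?_)
      (Subring.pow_mem _ X_mem_integralPolynomials 2)) (Subring.mul_mem _
      (C_mem_integralPolynomials v₄.le) X_mem_integralPolynomials))
      (C_mem_integralPolynomials hW.a₆.le))
    rw [Valuation.map_neg]; exact vc.le
  obtain ⟨x, hx, hxc⟩ := hv.hensel f c fmonic fint vc.le (by
    have e : f.eval c = (W.a₄ - W.a₃ * m) * c + W.a₆ := by simp [hf]; ring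
    rw [e]
    exact v.map_add_lt (map_mul_lt_one_left v₄ vc.le) hW.a₆) (by
    have e : f.derivative.eval c = c ^ 2 + (W.a₄ - W.a₃ * m) := by simp [hf]; ring
    have vc2 : v (c ^ 2) = 1 := by rw [map_pow, vc, one_pow]
    rw [e, v.map_add_eq_of_lt_left (by rwa [vc2]), vc2])
  have vx : v x = 1 := by
    have e : x = c + (x - c) := by ring
    rw [e, v.map_add_eq_of_lt_left (by rwa [vc]), vc]
  have x0 : x ≠ 0 := fun h ↦ by simp [h] at vx
  have heq : W.toAffine.Equation x (m * x) := by
    rw [Affine.equation_iff]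
    simp [hf] at hx
    linear_combination -hx - x ^ 2 * hc
  refine ⟨.some x (m * x) (W.toAffine.equation_iff_nonsingular.mp heq), ?_, ?_⟩
  · rw [some_mem_awayFromOrigin]
    exact fun h ↦ h.1.ne vx
  · have e : slopeRatio α β (Affine.Point.some x (m * x)
        (W.toAffine.equation_iff_nonsingular.mp heq)) = w := by
      rw [slopeRatio, ← sub_mul, ← sub_mul, mul_div_mul_right _ _ x0, mα, mβ]
      have : α - β ≠ 0 := fun h ↦ by simpa [h] using hα.sub
      field_simp
    rw [e, sub_self, map_zero]
    exact zero_lt_one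

open scoped Classical in
/-- If `W` reduces to a nodal cubic whose tangent slopes at the node are conjugate in the quadratic
extension `L` of `K`, then the norm is surjective on the points that do not reduce to the node.
The reductions of the `K`-points are the elements of norm one, and these are of the form `w / σ w`
by Hilbert's theorem 90. -/
theorem IsHenselianUnramified.exists_norm_eq_of_node [IsGalois K L] (hv : IsHenselianUnramified K v)
    {τ : L ≃ₐ[K] L} (hτ1 : τ ≠ 1) (hτ : ∀ σ : L ≃ₐ[K] L, σ = 1 ∨ σ = τ)
    {W : WeierstrassCurve K} [W.IsElliptic] (hW : SingularAtOrigin v (W.baseChange L)) {α : L}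
    (hα : NodeSlopes (W.baseChange L) v α (τ α)) {P : (W.baseChange K).toAffine.Point}
    (hP : Affine.Point.baseChange (W' := W) K L P ∈ awayFromOrigin v (W.baseChange L)) :
    ∃ Q ∈ awayFromOrigin v (W.baseChange L),
      ∑ σ : L ≃ₐ[K] L, Affine.Point.map (W' := W) σ.toAlgHom Q =
        Affine.Point.baseChange (W' := W) K L P := by
  have hn : Nontrivial (L ≃ₐ[K] L) := ⟨τ, 1, hτ1⟩
  have hττ : ∀ x, τ (τ x) = x := fun x ↦ by
    have : τ * τ = 1 := (hτ _).resolve_right fun h ↦ hτ1 (by simpa using h)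
    exact DFunLike.congr_fun this x
  have : (W.baseChange L).IsElliptic := inferInstanceAs (W.map (algebraMap K L)).IsElliptic
  set PL := Affine.Point.baseChange (W' := W) K L P with hPL
  have hPτ : Affine.Point.map (W' := W) τ.toAlgHom PL = PL :=
    Affine.Point.map_baseChange (W' := W) (F := K) τ.toAlgHom P
  obtain ⟨ζ, hζ⟩ : ∃ ζ, ζ = slopeRatio α (τ α) PL := ⟨_, rfl⟩
  have vζ : v ζ = 1 := by rw [hζ]; exact hα.slopeRatio_val hW hP
  have ζ0 : ζ ≠ 0 := fun h ↦ by simp [h] at vζ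
  have τζ : τ ζ = ζ⁻¹ := by
    have := slopeRatio_map (W := W) (α := α) rfl (hττ α) PL
    rw [hPτ, ← hζ] at this
    conv_rhs => rw [this]
    rw [inv_inv]
  -- Hilbert 90, with a resolvent that is a unit
  obtain ⟨w, vw, hw⟩ : ∃ w, v w = 1 ∧ τ w = ζ⁻¹ * w := by
    have key : ∀ b, τ (b + ζ * τ b) = ζ⁻¹ * (b + ζ * τ b) := fun b ↦ by
      rw [map_add, map_mul, τζ, hττ]; field_simp; ring
    by_cases h1 : v (1 + ζ) < 1
    · refine ⟨_, ?_, key α⟩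
      have e : α + ζ * τ α = (α - τ α) + (1 + ζ) * τ α := by ring
      rw [e, v.map_add_eq_of_lt_left (by
        rw [hα.sub]; exact map_mul_lt_one_left h1 hα.right), hα.sub]
    · refine ⟨_, ?_, key 1⟩
      rw [map_one, mul_one]
      exact le_antisymm (v.map_add_le (by simp) vζ.le) (not_lt.mp h1)
  obtain ⟨Q, hQ, hQw⟩ := hv.exists_slopeRatio hW hα vw
  have hQτ := map_mem_awayFromOrigin hv.map_algEquiv τ hQ
  have sum2 : ∀ R : (W.baseChange L).toAffine.Point,
      ∑ σ : L ≃ₐ[K] L, Affine.Point.map (W' := W) σ.toAlgHom R =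
        R + Affine.Point.map (W' := W) τ.toAlgHom R := fun R ↦ by
    have : (Finset.univ : Finset (L ≃ₐ[K] L)) = {1, τ} := by
      ext σ; simpa using hτ σ
    rw [this, Finset.sum_pair hτ1.symm]
    congr 1
    exact Affine.Point.map_id (W' := W) R
  have hR : Q + Affine.Point.map (W' := W) τ.toAlgHom Q ∈ awayFromOrigin v (W.baseChange L) :=
    add_mem_awayFromOrigin hW hQ hQτ
  have ratio : v (slopeRatio α (τ α) (Q + Affine.Point.map (W' := W) τ.toAlgHom Q) - ζ) < 1 := by
    have h1 := hα.slopeRatio_add hW hQ hQτ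
    rw [slopeRatio_map (W := W) rfl (hττ α)] at h1
    generalize slopeRatio α (τ α) (Q + Affine.Point.map (W' := W) τ.toAlgHom Q) = r at h1 ⊢
    have vs := hα.slopeRatio_val hW hQ
    generalize slopeRatio α (τ α) Q = s at h1 hQw vs
    have s0 : s ≠ 0 := fun h ↦ by simp [h] at vs
    have vτs : v (τ s) = 1 := by rw [hv.map_algEquiv, vs]
    have τs0 : τ s ≠ 0 := fun h ↦ by simp [h] at vτs
    have h2 : v (τ s - ζ⁻¹ * w) < 1 := by rw [← hw, ← map_sub, hv.map_algEquiv]; exact hQw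
    have e : r - ζ = (r - s * (τ s)⁻¹) + ((s - w) - ζ * (τ s - ζ⁻¹ * w)) * (τ s)⁻¹ := by
      field_simp; ring
    rw [e]
    exact v.map_add_lt h1 (map_mul_lt_one_left
      (v.map_sub_lt hQw (map_mul_lt_one_right vζ.le h2)) (by simp [vτs]))
  have hdiff : PL - (Q + Affine.Point.map (W' := W) τ.toAlgHom Q) ∈ nearInfinity v _ := by
    have hneg := neg_mem_awayFromOrigin hW hR
    rw [sub_eq_add_neg]
    refine hα.mem_nearInfinity hW (add_mem_awayFromOrigin hW hP hneg) ?_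
    have h1 := hα.slopeRatio_add hW hP hneg
    have h2 := hα.slopeRatio_neg hW hR
    have h3 := hα.slopeRatio_val hW hneg
    rw [← hζ] at h1
    generalize slopeRatio α (τ α) (PL + -(Q + Affine.Point.map (W' := W) τ.toAlgHom Q)) = a at *
    generalize slopeRatio α (τ α) (-(Q + Affine.Point.map (W' := W) τ.toAlgHom Q)) = b at *
    generalize slopeRatio α (τ α) (Q + Affine.Point.map (W' := W) τ.toAlgHom Q) = c at *
    have e : a - 1 = (a - ζ * b) + ((b * c - 1) - b * (c - ζ)) := by ring
    rw [e]
    exact v.map_add_lt h1 (v.map_sub_lt h2 (map_mul_lt_one_right h3.le ratio))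
  have hnorm := baseChange_norm W L Q
  have hP' : Affine.Point.baseChange (W' := W) K L (P - norm W L Q) ∈ nearInfinity v _ := by
    rw [map_sub, hnorm, sum2]
    exact hdiff
  obtain ⟨Q', hQ', e⟩ := hv.exists_norm_eq_of_nearInfinity hn hW hP'
  refine ⟨Q' + Q, add_mem_awayFromOrigin hW (nearInfinity_subset_awayFromOrigin hQ') hQ, ?_⟩
  simp only [map_add, Finset.sum_add_distrib]
  rw [e, map_sub, hnorm, sub_add_cancel]

end Node

end UnramifiedNorm

namespace UnramifiedNorm

open WeierstrassCurve

/-! ### Integral and minimal equations in terms of a valuation -/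

section Minimal

variable {F Γ₀ : Type*} [Field F] [LinearOrderedCommGroupWithZero Γ₀]

/-- The coefficients of `W` are integral. -/
structure IntegralCurve (v : Valuation F Γ₀) (W : WeierstrassCurve F) : Prop where
  a₁ : v W.a₁ ≤ 1
  a₂ : v W.a₂ ≤ 1
  a₃ : v W.a₃ ≤ 1
  a₄ : v W.a₄ ≤ 1
  a₆ : v W.a₆ ≤ 1

/-- `W` is integral, and no integral equation isomorphic to `W` has a discriminant of larger
absolute value. The discriminant of `C • W` is `u⁻¹²` times that of `W`. -/
structure MinimalCurve (v : Valuation F Γ₀) (W : WeierstrassCurve F) : Prop where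
  integral : IntegralCurve v W
  one_le : ∀ C : VariableChange F, IntegralCurve v (C • W) → 1 ≤ v (C.u : F)

/-- The change of variables `C` is an automorphism of the affine plane over the valuation ring. -/
structure IntegralChange (v : Valuation F Γ₀) (C : VariableChange F) : Prop where
  u : v (C.u : F) = 1
  r : v C.r ≤ 1
  s : v C.s ≤ 1
  t : v C.t ≤ 1

/-- The points of `W` with nonsingular reduction, for an integral equation `W`. -/
def smoothLocus (v : Valuation F Γ₀) (W : WeierstrassCurve F) : Set W.toAffine.Point :=
  {P | ∀ (x y : F) (h : W.toAffine.Nonsingular x y), P = .some x y h → v x ≤ 1 → v y ≤ 1 →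
    ¬(v (W.a₁ * y - (3 * x ^ 2 + 2 * W.a₂ * x + W.a₄)) < 1 ∧ v (2 * y + W.a₁ * x + W.a₃) < 1)}

variable {v : Valuation F Γ₀} {W : WeierstrassCurve F}

theorem some_mem_smoothLocus {x y : F} {h : W.toAffine.Nonsingular x y} :
    Affine.Point.some x y h ∈ smoothLocus v W ↔ (v x ≤ 1 → v y ≤ 1 →
    ¬(v (W.a₁ * y - (3 * x ^ 2 + 2 * W.a₂ * x + W.a₄)) < 1 ∧
      v (2 * y + W.a₁ * x + W.a₃) < 1)) := by
  refine ⟨fun H ↦ H x y h rfl, fun H a b h' e ↦ ?_⟩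
  rw [Affine.Point.some.injEq] at e
  rwa [← e.1, ← e.2]

theorem zero_mem_smoothLocus : (0 : W.toAffine.Point) ∈ smoothLocus v W :=
  fun _ _ _ e ↦ by cases e

theorem IntegralCurve.exists_map (h : IntegralCurve v W) :
    ∃ W₀ : WeierstrassCurve v.integer, W₀.map (algebraMap v.integer F) = W :=
  ⟨⟨⟨_, h.a₁⟩, ⟨_, h.a₂⟩, ⟨_, h.a₃⟩, ⟨_, h.a₄⟩, ⟨_, h.a₆⟩⟩, rfl⟩

theorem integralCurve_map (W₀ : WeierstrassCurve v.integer) :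
    IntegralCurve v (W₀.map (algebraMap v.integer F)) :=
  ⟨W₀.a₁.2, W₀.a₂.2, W₀.a₃.2, W₀.a₄.2, W₀.a₆.2⟩

theorem IntegralCurve.invariants_le (h : IntegralCurve v W) :
    v W.b₂ ≤ 1 ∧ v W.b₄ ≤ 1 ∧ v W.b₆ ≤ 1 ∧ v W.b₈ ≤ 1 ∧ v W.c₄ ≤ 1 ∧ v W.Δ ≤ 1 := by
  obtain ⟨W₀, rfl⟩ := h.exists_map
  simp only [map_b₂, map_b₄, map_b₆, map_b₈, map_c₄, map_Δ]
  exact ⟨W₀.b₂.2, W₀.b₄.2, W₀.b₆.2, W₀.b₈.2, W₀.c₄.2, W₀.Δ.2⟩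

theorem IntegralChange.exists_map {C : VariableChange F} (h : IntegralChange v C) :
    ∃ C₀ : VariableChange v.integer, C₀.map (algebraMap v.integer F) = C := by
  have hu : v (C.u⁻¹ : Fˣ) ≤ 1 := by rw [Units.val_inv_eq_inv_val, map_inv₀, h.u, inv_one]
  refine ⟨⟨⟨⟨_, h.u.le⟩, ⟨_, hu⟩, Subtype.ext (C.u.mul_inv), Subtype.ext (C.u.inv_mul)⟩,
    ⟨_, h.r⟩, ⟨_, h.s⟩, ⟨_, h.t⟩⟩, ?_⟩
  ext <;> rfl

theorem IntegralCurve.smul (h : IntegralCurve v W) {C : VariableChange F}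
    (hC : IntegralChange v C) : IntegralCurve v (C • W) := by
  obtain ⟨W₀, rfl⟩ := h.exists_map
  obtain ⟨C₀, rfl⟩ := hC.exists_map
  rw [map_variableChange]
  exact integralCurve_map _

theorem IntegralChange.inv {C : VariableChange F} (h : IntegralChange v C) :
    IntegralChange v C⁻¹ := by
  have hu : v (C.u⁻¹ : Fˣ) = 1 := by rw [Units.val_inv_eq_inv_val, map_inv₀, h.u, inv_one]
  refine ⟨hu, ?_, ?_, ?_⟩
  · simpa [VariableChange.inv_def, h.u] using h.r
  · simpa [VariableChange.inv_def, h.u] using h.s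
  · simpa [VariableChange.inv_def, h.u] using
      v.map_sub_le (map_mul_le_one h.r h.s) h.t

theorem MinimalCurve.smul (h : MinimalCurve v W) {C : VariableChange F}
    (hC : IntegralChange v C) : MinimalCurve v (C • W) := by
  refine ⟨h.integral.smul hC, fun D hD ↦ ?_⟩
  have := h.one_le (D * C) (by rwa [mul_smul])
  simpa [VariableChange.mul_def, hC.u] using this

theorem le_one_of_sq {a b x : F} (ha : v a ≤ 1) (hb : v b ≤ 1) (h : x ^ 2 = a * x + b) :
    v x ≤ 1 := by
  by_contra! hx
  have h0 : 0 < v x := zero_lt_one.trans hx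
  have : v (x ^ 2) ≤ v x := by
    rw [h]
    refine v.map_add_le ?_ (hb.trans hx.le)
    rw [map_mul]; exact mul_le_of_le_one_left' ha
  rw [map_pow, sq] at this
  exact this.not_gt (lt_mul_of_one_lt_left h0 hx)

/-- A change of variables between integral equations with `|u| ≤ 1` has integral `r`, `s` and `t`;
this rests on the expressions for `b₆` and `b₈`, then `a₂`, then `a₆`. -/
theorem IntegralCurve.le_one_of_smul (h : IntegralCurve v W) {C : VariableChange F}
    (h' : IntegralCurve v (C • W)) (hu : v (C.u : F) ≤ 1) :
    v C.r ≤ 1 ∧ v C.s ≤ 1 ∧ v C.t ≤ 1 := by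
  obtain ⟨-, w₄, w₆, w₈, -, -⟩ := h.invariants_le
  obtain ⟨-, -, h₆, h₈, -, -⟩ := h'.invariants_le
  obtain ⟨u, hudef⟩ : ∃ u : F, u = C.u := ⟨_, rfl⟩
  have hu0 : u ≠ 0 := by rw [hudef]; exact C.u.ne_zero
  have hui : ((C.u⁻¹ : Fˣ) : F) = u⁻¹ := by simp [hudef]
  rw [← hudef] at hu
  have n2 : v (2 : F) ≤ 1 := map_ofNat_le_one 2
  have n3 : v (3 : F) ≤ 1 := map_ofNat_le_one 3
  have hr : v C.r ≤ 1 := by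
    obtain ⟨p, hp⟩ : ∃ p, p = u ^ 6 * (C • W).b₆ := ⟨_, rfl⟩
    obtain ⟨q, hq⟩ : ∃ q, q = u ^ 8 * (C • W).b₈ := ⟨_, rfl⟩
    have vp : v p ≤ 1 := by rw [hp]; exact map_mul_le_one (map_pow_le_one hu 6) h₆
    have vq : v q ≤ 1 := by rw [hq]; exact map_mul_le_one (map_pow_le_one hu 8) h₈
    have hp' : p = W.b₆ + 2 * C.r * W.b₄ + C.r ^ 2 * W.b₂ + 4 * C.r ^ 3 := by
      rw [hp, variableChange_b₆, hui]; field_simp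
    have hq' : q = W.b₈ + 3 * C.r * W.b₆ + 3 * C.r ^ 2 * W.b₄ + C.r ^ 3 * W.b₂ + 3 * C.r ^ 4 := by
      rw [hq, variableChange_b₈, hui]; field_simp
    have key : (C.r ^ 2) ^ 2 = W.b₄ * C.r ^ 2 + ((2 * W.b₆ + p) * C.r + (W.b₈ - q)) := by
      rw [hp', hq']; ring
    by_contra! hlt
    have h0 : 0 < v C.r := zero_lt_one.trans hlt
    have le2 : v C.r ≤ v (C.r ^ 2) := by
      rw [map_pow, sq]; exact le_mul_of_one_le_left' hlt.le
    have lt2 : 1 < v (C.r ^ 2) := hlt.trans_le le2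
    have : v ((C.r ^ 2) ^ 2) ≤ v (C.r ^ 2) := by
      rw [key]
      refine v.map_add_le ?_ (v.map_add_le ?_ ((v.map_sub_le w₈ vq).trans lt2.le))
      · rw [map_mul]; exact mul_le_of_le_one_left' w₄
      · rw [map_mul]
        exact (mul_le_of_le_one_left' (v.map_add_le (map_mul_le_one n2 w₆) vp)).trans le2
    rw [map_pow v (C.r ^ 2), sq] at this
    exact this.not_gt (lt_mul_of_one_lt_left (zero_lt_one.trans lt2) lt2)
  have hs : v C.s ≤ 1 := by
    have e : C.s ^ 2 = -W.a₁ * C.s + (W.a₂ + 3 * C.r - u ^ 2 * (C • W).a₂) := by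
      rw [variableChange_a₂, hui]; field_simp; ring
    refine le_one_of_sq (by rw [Valuation.map_neg]; exact h.a₁) ?_ e
    exact v.map_sub_le (v.map_add_le h.a₂ (map_mul_le_one n3 hr))
      (map_mul_le_one (map_pow_le_one hu 2) h'.a₂)
  refine ⟨hr, hs, ?_⟩
  have e : C.t ^ 2 = -(W.a₃ + C.r * W.a₁) * C.t +
      (W.a₆ + C.r * W.a₄ + C.r ^ 2 * W.a₂ + C.r ^ 3 - u ^ 6 * (C • W).a₆) := by
    rw [variableChange_a₆, hui]; field_simp; ring
  refine le_one_of_sq (by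
    rw [Valuation.map_neg]; exact v.map_add_le h.a₃ (map_mul_le_one hr h.a₁)) ?_ e
  exact v.map_sub_le (v.map_add_le (v.map_add_le (v.map_add_le h.a₆ (map_mul_le_one hr h.a₄))
    (map_mul_le_one (map_pow_le_one hr 2) h.a₂)) (map_pow_le_one hr 3))
    (map_mul_le_one (map_pow_le_one hu 6) h'.a₆)

theorem IntegralCurve.integralChange (h : IntegralCurve v W) {C : VariableChange F}
    (h' : IntegralCurve v (C • W)) (hu : v (C.u : F) = 1) : IntegralChange v C :=
  have := h.le_one_of_smul h' hu.le
  ⟨hu, this.1, this.2.1, this.2.2⟩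

theorem MinimalCurve.integralChange (h : MinimalCurve v W) {C : VariableChange F}
    (h' : MinimalCurve v (C • W)) : IntegralChange v C := by
  refine h.integral.integralChange h'.integral (le_antisymm ?_ (h.one_le C h'.integral))
  have := h'.one_le C⁻¹ (by rw [inv_smul_smul]; exact h.integral)
  rw [VariableChange.inv_def, Units.val_inv_eq_inv_val, map_inv₀] at this
  exact (one_le_inv₀ (zero_lt_iff.mpr (v.ne_zero_iff.mpr C.u.ne_zero))).mp this

open scoped Classical in
/-- Having nonsingular reduction is invariant under integral changes of variables. -/
theorem IntegralChange.pointHom_mem_smoothLocus_iff {C : VariableChange F}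
    (hC : IntegralChange v C) {W' : WeierstrassCurve F} (hW' : C • W = W') {P : W.toAffine.Point} :
    pointHom C hW' P ∈ smoothLocus v W' ↔ P ∈ smoothLocus v W := by
  subst hW'
  rcases P with _ | ⟨x, y, h⟩
  · exact ⟨fun _ ↦ zero_mem_smoothLocus, fun _ ↦ zero_mem_smoothLocus⟩
  rw [pointHom_some, some_mem_smoothLocus, some_mem_smoothLocus]
  obtain ⟨u, hu⟩ : ∃ u : F, u = (C.u⁻¹ : Fˣ) := ⟨_, rfl⟩
  have vu : v u = 1 := by rw [hu]; exact hC.inv.u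
  have hx : v (coordX C x) ≤ 1 ↔ v x ≤ 1 := by
    rw [coordX, ← hu, map_mul, map_pow, vu, one_pow, one_mul]
    refine ⟨fun h ↦ ?_, fun h ↦ v.map_sub_le h hC.r⟩
    have e : x = (x - C.r) + C.r := by ring
    rw [e]; exact v.map_add_le h hC.r
  rw [hx]
  refine imp_congr_right fun vx ↦ ?_
  have vst : v (C.s * (x - C.r) + C.t) ≤ 1 :=
    v.map_add_le (map_mul_le_one hC.s (v.map_sub_le vx hC.r)) hC.t
  have hy : v (coordY C x y) ≤ 1 ↔ v y ≤ 1 := by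
    have e : y - C.s * (x - C.r) - C.t = y - (C.s * (x - C.r) + C.t) := by ring
    rw [coordY, ← hu, map_mul, map_pow, vu, one_pow, one_mul, e]
    refine ⟨fun h ↦ ?_, fun h ↦ v.map_sub_le h vst⟩
    have e : y = (y - (C.s * (x - C.r) + C.t)) + (C.s * (x - C.r) + C.t) := by ring
    rw [e]; exact v.map_add_le h vst
  rw [hy]
  refine imp_congr_right fun vy ↦ not_congr ?_
  obtain ⟨p, hp⟩ : ∃ p, p = W.a₁ * y - (3 * x ^ 2 + 2 * W.a₂ * x + W.a₄) := ⟨_, rfl⟩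
  obtain ⟨q, hq⟩ : ∃ q, q = 2 * y + W.a₁ * x + W.a₃ := ⟨_, rfl⟩
  have e1 : (C • W).a₁ * coordY C x y -
      (3 * coordX C x ^ 2 + 2 * (C • W).a₂ * coordX C x + (C • W).a₄) = u ^ 4 * (p + C.s * q) := by
    rw [hp, hq, hu]
    simp only [variableChange_def, coordX, coordY]
    ring
  have e2 : 2 * coordY C x y + (C • W).a₁ * coordX C x + (C • W).a₃ = u ^ 3 * q := by
    rw [hq, hu]
    simp only [variableChange_def, coordX, coordY]
    ring
  rw [e1, e2, ← hp, ← hq]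
  simp only [map_mul, map_pow, vu, one_pow, one_mul]
  refine ⟨fun h ↦ ⟨?_, h.2⟩, fun h ↦ ⟨v.map_add_lt h.1 (map_mul_lt_one_right hC.s h.2), h.2⟩⟩
  have e : p = (p + C.s * q) - C.s * q := by ring
  rw [e]
  exact v.map_sub_lt h.1 (map_mul_lt_one_right hC.s h.2)

/-- If the reduction of `W` is singular at the origin, the origin is its only singular point. -/
theorem SingularAtOrigin.smoothLocus_eq (hW : SingularAtOrigin v W) :
    smoothLocus v W = awayFromOrigin v W := by
  ext P
  rcases P with _ | ⟨x, y, h⟩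
  · exact ⟨fun _ ↦ zero_mem_awayFromOrigin, fun _ ↦ zero_mem_smoothLocus⟩
  rw [some_mem_smoothLocus, some_mem_awayFromOrigin]
  have n2 : v (2 : F) ≤ 1 := map_ofNat_le_one 2
  have n3 : v (3 : F) ≤ 1 := map_ofNat_le_one 3
  constructor
  · rintro H ⟨hx, hy⟩
    refine H hx.le hy.le ⟨?_, ?_⟩
    · refine v.map_sub_lt (map_mul_lt_one_right hW.a₁ hy) (v.map_add_lt (v.map_add_lt
        (map_mul_lt_one_right n3 (map_pow_lt_one hx two_ne_zero)) ?_) hW.a₄)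
      exact map_mul_lt_one_right (map_mul_le_one n2 hW.a₂) hx
    · exact v.map_add_lt (v.map_add_lt (map_mul_lt_one_right n2 hy)
        (map_mul_lt_one_right hW.a₁ hx)) hW.a₃
  · rintro H hx hy ⟨h1, h2⟩
    have heq := (W.toAffine.equation_iff _ _).mp h.1
    have hx1 : v x < 1 := by
      have e : x ^ 3 = -(x * (W.a₁ * y - (3 * x ^ 2 + 2 * W.a₂ * x + W.a₄)) +
          y * (2 * y + W.a₁ * x + W.a₃)) + (-W.a₃ * y + W.a₄ * x + 2 * W.a₆) := by
        linear_combination 2 * heq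
      have : v (x ^ 3) < 1 := by
        rw [e]
        refine v.map_add_lt ?_ (v.map_add_lt (v.map_add_lt
          (map_mul_lt_one_left (by rw [Valuation.map_neg]; exact hW.a₃) hy)
          (map_mul_lt_one_left hW.a₄ hx)) (map_mul_lt_one_right n2 hW.a₆))
        rw [Valuation.map_neg]
        exact v.map_add_lt (map_mul_lt_one_right hx h1) (map_mul_lt_one_right hy h2)
      rw [map_pow] at this
      by_contra! hle
      exact this.not_ge (one_le_pow₀ hle)
    refine H ⟨hx1, ?_⟩
    have e : y ^ 2 = x * (x ^ 2 + W.a₂ * x - W.a₁ * y) + (-W.a₃ * y + W.a₄ * x + W.a₆) := by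
      linear_combination heq
    have : v (y ^ 2) < 1 := by
      rw [e]
      exact v.map_add_lt (map_mul_lt_one_left hx1 (v.map_sub_le (v.map_add_le
          (map_pow_le_one hx _) (map_mul_le_one hW.a₂ hx)) (map_mul_le_one hW.a₁ hy)))
        (v.map_add_lt (v.map_add_lt
          (map_mul_lt_one_left (by rw [Valuation.map_neg]; exact hW.a₃) hy)
          (map_mul_lt_one_left hW.a₄ hx)) hW.a₆)
    rw [map_pow] at this
    by_contra! hle
    exact this.not_ge (one_le_pow₀ hle)

end Minimal

/-! ### Points with nonsingular reduction in terms of a valuation -/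

section Reduction

variable {R F Γ₀ : Type*} [CommRing R] [Field F] [Algebra R F] [LinearOrderedCommGroupWithZero Γ₀]
  {v : Valuation F Γ₀} {W : WeierstrassCurve F}

theorem le_one_iff_exists (hv : v.Integers R) {x : F} : v x ≤ 1 ↔ ∃ a, algebraMap R F a = x :=
  ⟨fun h ↦ hv.exists_of_le_one h, fun ⟨a, ha⟩ ↦ ha ▸ hv.map_le_one a⟩

theorem one_le_iff_exists (hv : v.Integers R) {x : Fˣ} :
    1 ≤ v (x : F) ↔ ∃ a, algebraMap R F a = (x⁻¹ : Fˣ) := by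
  rw [← le_one_iff_exists hv, Units.val_inv_eq_inv_val, map_inv₀]
  exact (inv_le_one₀ (zero_lt_iff.mpr (v.ne_zero_iff.mpr x.ne_zero))).symm

theorem isIntegral_iff (hv : v.Integers R) : IsIntegral R W ↔ IntegralCurve v W := by
  constructor
  · intro h
    obtain ⟨W₀, rfl⟩ := h.integral
    exact ⟨hv.map_le_one _, hv.map_le_one _, hv.map_le_one _, hv.map_le_one _, hv.map_le_one _⟩
  · intro h
    exact isIntegral_of_exists_lift R (hv.exists_of_le_one h.a₁) (hv.exists_of_le_one h.a₂)
      (hv.exists_of_le_one h.a₃) (hv.exists_of_le_one h.a₄) (hv.exists_of_le_one h.a₆)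

variable [IsDomain R] [IsDiscreteValuationRing R]

theorem residue_eq_zero_iff_val (hv : v.Integers R) {a : R} :
    IsLocalRing.residue R a = 0 ↔ v (algebraMap R F a) < 1 := by
  rw [IsLocalRing.residue_eq_zero_iff, IsLocalRing.mem_maximalIdeal, mem_nonunits_iff,
    hv.isUnit_iff_valuation_eq_one]
  exact (hv.map_le_one a).lt_iff_ne.symm

variable [IsFractionRing R F]

variable (R F) in
theorem integers_valuation :
    ((IsDiscreteValuationRing.maximalIdeal R).valuation F).Integers R where
  hom_inj := IsFractionRing.injective R F
  map_le_one := IsDedekindDomain.HeightOneSpectrum.valuation_le_one _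
  exists_of_le_one _ h := IsDiscreteValuationRing.exists_lift_of_le_one h

theorem isMinimal_iff_minimalCurve [W.IsElliptic] (hv : v.Integers R) :
    IsMinimal R W ↔ MinimalCurve v W := by
  have hv₀ := integers_valuation R F
  set v₀ := (IsDiscreteValuationRing.maximalIdeal R).valuation F
  have hΔ : W.Δ ≠ 0 := W.isUnit_Δ.ne_zero
  have key : ∀ C : VariableChange F, IsIntegral R W → IsIntegral R (C • W) →
      (valuation_Δ_aux R (C • W) ≤ valuation_Δ_aux R W ↔ 1 ≤ v (C.u : F)) := by
    intro C h h'
    rw [← Subtype.coe_le_coe, valuation_Δ_aux_eq_of_isIntegral R W,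
      valuation_Δ_aux_eq_of_isIntegral R (C • W), variableChange_Δ, map_mul, one_le_iff_exists hv,
      ← one_le_iff_exists hv₀, map_pow, Units.val_inv_eq_inv_val, map_inv₀]
    change _ * v₀ W.Δ ≤ v₀ W.Δ ↔ _
    rw [mul_le_iff_le_one_left (by simpa [zero_lt_iff] using hΔ), inv_pow,
      inv_le_one₀ (by simp [zero_lt_iff]), one_le_pow_iff_of_nonneg zero_le (by norm_num)]
  constructor
  · intro h
    refine ⟨(isIntegral_iff hv).mp inferInstance, fun C hC ↦ ?_⟩
    have hC' := (isIntegral_iff hv).mpr hC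
    rw [← key C inferInstance hC']
    have := h.val_Δ_maximal.2 hC'
    simp only [one_smul] at this
    exact (le_total _ _).elim id this
  · rintro ⟨h1, h2⟩
    have h1 := (isIntegral_iff hv).mpr h1
    refine ⟨⟨by simpa only [one_smul], fun C hC _ ↦ ?_⟩⟩
    simp only [one_smul]
    exact (key C h1 hC).mpr (h2 C ((isIntegral_iff hv).mp hC))

theorem nonsingular_reduction_iff (hv : v.Integers R) [IsMinimal R W] {a b : R}
    (h : W.toAffine.Equation (algebraMap R F a) (algebraMap R F b)) :
    (W.reduction R).toAffine.Nonsingular (IsLocalRing.residue R a) (IsLocalRing.residue R b) ↔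
    ¬(v (W.a₁ * algebraMap R F b - (3 * algebraMap R F a ^ 2 + 2 * W.a₂ * algebraMap R F a + W.a₄))
      < 1 ∧ v (2 * algebraMap R F b + W.a₁ * algebraMap R F a + W.a₃) < 1) := by
  obtain ⟨W₀, hW₀⟩ : ∃ W₀, W₀ = integralModel R W := ⟨_, rfl⟩
  have hW : W₀.map (algebraMap R F) = W := hW₀ ▸ baseChange_integralModel_eq R W
  have hred : W.reduction R = W₀.map (IsLocalRing.residue R) := by rw [reduction, hW₀]
  have heq : W₀.toAffine.Equation a b := by
    rw [← hW] at h
    exact (Affine.map_equation (W := W₀) (f := algebraMap R F) hv.hom_inj a b).mp h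
  rw [hred, Affine.nonsingular_iff', not_and_or]
  have heq' := heq.map (IsLocalRing.residue R)
  rw [and_iff_right heq', ← hW]
  simp only [map_a₁, map_a₂, map_a₃, map_a₄]
  refine or_congr (not_congr ?_) (not_congr ?_)
  · have := residue_eq_zero_iff_val hv (a := W₀.a₁ * b - (3 * a ^ 2 + 2 * W₀.a₂ * a + W₀.a₄))
    simpa only [map_sub, map_mul, map_add, map_pow, map_ofNat] using this
  · have := residue_eq_zero_iff_val hv (a := 2 * b + W₀.a₁ * a + W₀.a₃)
    simpa only [map_sub, map_mul, map_add, map_pow, map_ofNat] using this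

open scoped Classical in
/-- The set `E0` can be computed on any minimal model, using any valuation with valuation
ring `R`. -/
theorem mem_E0_iff [W.IsElliptic] (hv : v.Integers R) {C : VariableChange F} {W' : WeierstrassCurve F}
    (hW' : C • W = W') (hmin : MinimalCurve v W') {P : W.toAffine.Point} :
    P ∈ E0 R W ↔ pointHom C hW' P ∈ smoothLocus v W' := by
  subst hW'
  have key : ∀ (D : VariableChange F) (hD : IsMinimal R (D • W)),
      (∀ (x y : F) (h : W.toAffine.Nonsingular x y), P = .some x y h →
      ∀ a b : R,
        algebraMap R F a = (D.u⁻¹ : Fˣ) ^ 2 * (x - D.r) →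
        algebraMap R F b = (D.u⁻¹ : Fˣ) ^ 3 * (y - D.s * (x - D.r) - D.t) →
        ((D • W).reduction R).toAffine.Nonsingular
          (IsLocalRing.residue R a) (IsLocalRing.residue R b)) ↔
      pointHom D rfl P ∈ smoothLocus v (D • W) := by
    intro D hD
    rcases P with _ | ⟨x, y, h⟩
    · exact ⟨fun _ ↦ zero_mem_smoothLocus, fun _ x y h e ↦ by cases e⟩
    rw [pointHom_some, some_mem_smoothLocus, le_one_iff_exists hv, le_one_iff_exists hv]
    have heq := equation_coord W D h.1
    constructor
    · rintro H ⟨a, ha⟩ ⟨b, hb⟩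
      have := H x y h rfl a b ha hb
      rw [nonsingular_reduction_iff hv (by rwa [ha, hb])] at this
      rwa [ha, hb] at this
    · intro H x' y' h' e a b ha hb
      rw [Affine.Point.some.injEq] at e
      obtain ⟨rfl, rfl⟩ := e
      have ha' : algebraMap R F a = coordX D x := ha
      have hb' : algebraMap R F b = coordY D x y := hb
      rw [nonsingular_reduction_iff hv (by rwa [ha', hb']), ha', hb']
      exact H ⟨a, ha⟩ ⟨b, hb⟩
  have hC : IsMinimal R (C • W) := (isMinimal_iff_minimalCurve hv).mpr hmin
  rw [← key C hC]
  refine ⟨?_, fun h ↦ ⟨C, hC, h⟩⟩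
  rintro ⟨D, hD, h⟩
  rw [key D hD] at h
  rw [key C hC]
  have hD' : MinimalCurve v (D • W) := (isMinimal_iff_minimalCurve hv).mp hD
  have e : (C * D⁻¹) • (D • W) = C • W := by rw [mul_smul, inv_smul_smul]
  have hCD := hD'.integralChange (C := C * D⁻¹) (by rwa [e])
  rw [← hCD.pointHom_mem_smoothLocus_iff e] at h
  convert h using 1
  rcases P with _ | ⟨x, y, hxy⟩
  · rfl
  · rw [pointHom_some, pointHom_some, pointHom_some, Affine.Point.some.injEq, ← coordX_mul,
      ← coordY_mul, inv_mul_cancel_right]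
    exact ⟨rfl, rfl⟩

end Reduction

/-! ### Minimal equations stay minimal over unramified extensions -/

section ScaleDown

variable {F Γ₀ : Type*} [Field F] [LinearOrderedCommGroupWithZero Γ₀] {v : Valuation F Γ₀}
  {W : WeierstrassCurve F}

theorem IntegralCurve.smul_of_le {C : VariableChange F} (h : IntegralCurve v (C • W)) {ϖ : Fˣ}
    (hϖ : v (C.u : F) ≤ v (ϖ : F)) :
    IntegralCurve v ((⟨ϖ, C.r, C.s, C.t⟩ : VariableChange F) • W) := by
  obtain ⟨d, hd⟩ : ∃ d : F, d = C.u * (ϖ⁻¹ : Fˣ) := ⟨_, rfl⟩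
  have vd : v d ≤ 1 := by
    rw [hd, map_mul, Units.val_inv_eq_inv_val, map_inv₀]
    exact mul_inv_le_one_of_le₀ hϖ zero_le
  have e : ((ϖ⁻¹ : Fˣ) : F) = d * (C.u⁻¹ : Fˣ) := by
    rw [hd]; field_simp; simp
  constructor
  · have := map_mul_le_one vd h.a₁
    convert this using 2
    rw [variableChange_a₁, variableChange_a₁, e]; ring
  · have := map_mul_le_one (map_pow_le_one vd 2) h.a₂
    convert this using 2
    rw [variableChange_a₂, variableChange_a₂, e]; ring
  · have := map_mul_le_one (map_pow_le_one vd 3) h.a₃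
    convert this using 2
    rw [variableChange_a₃, variableChange_a₃, e]; ring
  · have := map_mul_le_one (map_pow_le_one vd 4) h.a₄
    convert this using 2
    rw [variableChange_a₄, variableChange_a₄, e]; ring
  · have := map_mul_le_one (map_pow_le_one vd 6) h.a₆
    convert this using 2
    rw [variableChange_a₆, variableChange_a₆, e]; ring

/-- Two changes of variables with the same `u`, one of which leads to an integral equation, both do
if and only if they differ by an integral change of variables. -/
theorem IntegralCurve.smul_iff {u : Fˣ} {r s t r' s' t' : F}
    (h : IntegralCurve v ((⟨u, r, s, t⟩ : VariableChange F) • W)) :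
    IntegralCurve v ((⟨u, r', s', t'⟩ : VariableChange F) • W) ↔
      v ((u⁻¹ : Fˣ) ^ 2 * (r' - r)) ≤ 1 ∧ v ((u⁻¹ : Fˣ) * (s' - s)) ≤ 1 ∧
        v ((u⁻¹ : Fˣ) ^ 3 * (t' - t - s * (r' - r))) ≤ 1 := by
  set C : VariableChange F := ⟨u, r, s, t⟩ with hC
  set C' : VariableChange F := ⟨u, r', s', t'⟩ with hC'
  have e : C' • W = (C' * C⁻¹) • (C • W) := by rw [mul_smul, inv_smul_smul]
  have er : (C' * C⁻¹).r = (u⁻¹ : Fˣ) ^ 2 * (r' - r) := by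
    simp only [VariableChange.mul_def, VariableChange.inv_def, hC, hC']; ring
  have es : (C' * C⁻¹).s = (u⁻¹ : Fˣ) * (s' - s) := by
    simp only [VariableChange.mul_def, VariableChange.inv_def, hC, hC']; ring
  have et : (C' * C⁻¹).t = (u⁻¹ : Fˣ) ^ 3 * (t' - t - s * (r' - r)) := by
    simp only [VariableChange.mul_def, VariableChange.inv_def, hC, hC']; ring
  have eu : (C' * C⁻¹).u = 1 := by
    simp [VariableChange.mul_def, VariableChange.inv_def, hC, hC']
  rw [← er, ← es, ← et, e]
  constructor
  · intro h'
    have := h.integralChange h' (by rw [eu]; simp)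
    exact ⟨this.r, this.s, this.t⟩
  · rintro ⟨h1, h2, h3⟩
    exact h.smul ⟨by rw [eu]; simp, h1, h2, h3⟩

end ScaleDown

section BaseChange

variable {K L Γ₀ : Type*} [Field K] [Field L] [Algebra K L]
  [LinearOrderedCommGroupWithZero Γ₀] {v : Valuation L Γ₀}

theorem integralCurve_comap_iff {W : WeierstrassCurve K} :
    IntegralCurve (v.comap (algebraMap K L)) W ↔ IntegralCurve v (W.baseChange L) :=
  ⟨fun h ↦ ⟨h.a₁, h.a₂, h.a₃, h.a₄, h.a₆⟩, fun h ↦ ⟨h.a₁, h.a₂, h.a₃, h.a₄, h.a₆⟩⟩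

theorem IntegralCurve.map_algEquiv (hv : ∀ (σ : L ≃ₐ[K] L) (x : L), v (σ x) = v x)
    {W : WeierstrassCurve K} {C : VariableChange L}
    (h : IntegralCurve v (C • W.baseChange L)) (σ : L ≃ₐ[K] L) :
    IntegralCurve v (C.map (σ : L →+* L) • W.baseChange L) := by
  have e : W.baseChange L = (W.baseChange L).map (σ : L →+* L) := by
    ext <;> simp [baseChange]
  have e' : C.map (σ : L →+* L) • W.baseChange L = (C • W.baseChange L).map (σ : L →+* L) := by
    rw [← map_variableChange, ← e]
  rw [e']
  constructor
  · exact (hv σ _).trans_le h.a₁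
  · exact (hv σ _).trans_le h.a₂
  · exact (hv σ _).trans_le h.a₃
  · exact (hv σ _).trans_le h.a₄
  · exact (hv σ _).trans_le h.a₆

variable [FiniteDimensional K L] [IsGalois K L]

/-- If the differences between `x` and its conjugates are small, then `x` is close to an element
of `K`, namely the trace of `β x` for an integral element `β` of trace one. -/
theorem IsHenselianUnramified.exists_trace (hv : IsHenselianUnramified K v) {d x : L}
    (h : ∀ σ : L ≃ₐ[K] L, v (d * (σ x - x)) ≤ 1) :
    ∃ y : K, v (d * (algebraMap K L y - x)) ≤ 1 := by
  obtain ⟨u, hu, hs, -⟩ := hv.exists_normal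
  obtain ⟨s, hsdef⟩ : ∃ s, s = ∑ σ : L ≃ₐ[K] L, σ u := ⟨_, rfl⟩
  have sfix : ∀ σ : L ≃ₐ[K] L, σ s = s := fun σ ↦ by rw [hsdef, sum_algEquiv_fixed]
  rw [← hsdef] at hs
  have hs0 : s ≠ 0 := fun h ↦ by simp [h] at hs
  obtain ⟨y, hy⟩ := (IsGalois.mem_range_algebraMap_iff_fixed (F := K) (E := L)
    (∑ σ : L ≃ₐ[K] L, σ (u / s * x))).mpr fun τ ↦ sum_algEquiv_fixed τ _
  refine ⟨y, ?_⟩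
  have e1 : x = ∑ σ : L ≃ₐ[K] L, σ u / s * x := by
    rw [← Finset.sum_mul, ← Finset.sum_div, ← hsdef, div_self hs0, one_mul]
  have e : d * (algebraMap K L y - x) = ∑ σ : L ≃ₐ[K] L, σ u / s * (d * (σ x - x)) := by
    have e2 : ∀ σ : L ≃ₐ[K] L, σ u / s * (d * (σ x - x)) =
        d * (σ (u / s * x) - σ u / s * x) := fun σ ↦ by rw [map_mul, map_div₀, sfix]; ring
    rw [hy, Finset.sum_congr rfl fun σ _ ↦ e2 σ, ← Finset.mul_sum, Finset.sum_sub_distrib, ← e1]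
  rw [e]
  refine v.map_sum_le fun σ _ ↦ map_mul_le_one ?_ (h σ)
  rw [map_div₀, hs, hv.map_algEquiv, hu, div_one]

/-- A minimal equation over `K` is minimal over an unramified extension `L`: an integral equation
over `L` with smaller discriminant can be modified by an integral change of variables so that it
descends to `K`. -/
theorem IsHenselianUnramified.minimalCurve_baseChange (hv : IsHenselianUnramified K v)
    {W : WeierstrassCurve K} (h : MinimalCurve (v.comap (algebraMap K L)) W) :
    MinimalCurve v (W.baseChange L) := by
  refine ⟨integralCurve_comap_iff.mp h.integral, fun C hC ↦ ?_⟩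
  by_contra! hlt
  obtain ⟨ϖ, hϖ, hmax⟩ := hv.exists_uniformizer
  set ϖ' : Lˣ := Units.map (algebraMap K L : K →* L) ϖ with hϖ'
  have hmap : ∀ σ : L ≃ₐ[K] L, Units.map ((σ : L →+* L) : L →* L) ϖ' = ϖ' := fun σ ↦ by
    ext; simp [hϖ']
  have fixd : ∀ (σ : L ≃ₐ[K] L), σ ((ϖ'⁻¹ : Lˣ) : L) = (ϖ'⁻¹ : Lˣ) := fun σ ↦ by simp [hϖ']
  have h0 : IntegralCurve v ((⟨ϖ', C.r, C.s, C.t⟩ : VariableChange L) • W.baseChange L) :=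
    hC.smul_of_le (hmax _ hlt)
  have conj : ∀ {r s t : L},
      IntegralCurve v ((⟨ϖ', r, s, t⟩ : VariableChange L) • W.baseChange L) →
      ∀ σ : L ≃ₐ[K] L, IntegralCurve v
        ((⟨ϖ', σ r, σ s, σ t⟩ : VariableChange L) • W.baseChange L) := fun {r s t} h σ ↦ by
    have := h.map_algEquiv hv.map_algEquiv σ
    rw [VariableChange.map, hmap] at this
    exact this
  obtain ⟨r, hr⟩ := hv.exists_trace fun σ ↦ (h0.smul_iff.mp (conj h0 σ)).1
  obtain ⟨s, hs⟩ := hv.exists_trace fun σ ↦ (h0.smul_iff.mp (conj h0 σ)).2.1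
  obtain ⟨t₁, ht₁⟩ : ∃ t₁, t₁ = C.t + C.s * (algebraMap K L r - C.r) := ⟨_, rfl⟩
  have h1 : IntegralCurve v ((⟨ϖ', algebraMap K L r, algebraMap K L s, t₁⟩ : VariableChange L) •
      W.baseChange L) := by
    refine h0.smul_iff.mpr ⟨hr, hs, ?_⟩
    rw [ht₁, add_sub_cancel_left, sub_self, mul_zero, map_zero]
    exact zero_le
  obtain ⟨t, ht⟩ := hv.exists_trace (d := (ϖ'⁻¹ : Lˣ) ^ 3) (x := t₁) fun σ ↦ by
    have := (h1.smul_iff.mp (conj h1 σ)).2.2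
    rwa [AlgEquiv.commutes, sub_self, mul_zero, sub_zero] at this
  have h2 : IntegralCurve v ((⟨ϖ', algebraMap K L r, algebraMap K L s, algebraMap K L t⟩ :
      VariableChange L) • W.baseChange L) := by
    refine h1.smul_iff.mpr ⟨by simp, by simp, ?_⟩
    rwa [sub_self, mul_zero, sub_zero]
  refine (h.one_le ⟨ϖ, r, s, t⟩ (integralCurve_comap_iff.mpr ?_)).not_gt hϖ
  rw [← smul_baseChange]
  exact h2

end BaseChange

end UnramifiedNorm

namespace UnramifiedNorm

open Polynomial
open scoped Pointwise

/-! ### Integral extensions of Henselian rings -/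

section Local

variable {A B G : Type*} [CommRing A] [HenselianLocalRing A] [CommRing B] [IsDomain B] [Algebra A B]
  [Group G] [Finite G] [MulSemiringAction G B]
  [Algebra.IsInvariant A B G]

open scoped Classical in
/-- An element which is congruent to `1` modulo a prime ideal and whose other conjugates lie in this
ideal comes from the Henselian ring of invariants: the monic polynomial with its conjugates as roots
has a simple root congruent to `1`. -/
theorem mem_range_of_conjugates_mem {m : Ideal B} [m.IsPrime]
    (hm : m.under A = IsLocalRing.maximalIdeal A) {b : B} (hb : 1 - b ∈ m)
    (hb' : ∀ g : G, g • b ≠ b → g • b ∈ m) : ∃ a, algebraMap A B a = b := by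
  have := Fintype.ofFinite G
  set S : Finset B := Finset.univ.image fun g : G ↦ g • b with hS
  have memS : ∀ {s}, s ∈ S ↔ ∃ g : G, g • b = s := fun {s} ↦ by simp [hS]
  have bS : b ∈ S := memS.mpr ⟨1, one_smul _ _⟩
  set f : B[X] := ∏ s ∈ S, (X - C s) with hf
  have hmonic : f.Monic := monic_prod_of_monic _ _ fun _ _ ↦ monic_X_sub_C _
  have hlift : f ∈ lifts (algebraMap A B) := by
    refine (f.lifts_iff_coeff_lifts).mpr fun n ↦ Algebra.IsInvariant.isInvariant (G := G) _ fun g ↦ ?_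
    rw [← coeff_smul, hf, Finset.smul_prod']
    congr 1
    refine Finset.prod_bij (fun s _ ↦ g • s) (fun s hs ↦ ?_) (fun s _ t _ h ↦ ?_) (fun s hs ↦ ?_)
      fun s _ ↦ by rw [smul_sub, smul_X, smul_C]
    · obtain ⟨h, rfl⟩ := memS.mp hs
      exact memS.mpr ⟨g * h, mul_smul _ _ _⟩
    · exact MulAction.injective g h
    · obtain ⟨h, rfl⟩ := memS.mp hs
      exact ⟨(g⁻¹ * h) • b, memS.mpr ⟨_, rfl⟩, by rw [← mul_smul, mul_inv_cancel_left]⟩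
  obtain ⟨p, hp, -, pmonic⟩ := lifts_and_natDegree_eq_and_monic hlift hmonic
  have hval : ∀ q : A[X], algebraMap A B (q.eval 1) = (q.map (algebraMap A B)).eval 1 := fun q ↦ by
    rw [eval_map, eval₂_at_one]
  set h : B[X] := ∏ s ∈ S.erase b, (X - C s) with hh
  have fac : f = (X - C b) * h := by rw [hf, ← Finset.mul_prod_erase S _ bS]
  have h1 : h.eval 1 ∉ m := by
    rw [hh, eval_prod, Ideal.IsPrime.prod_mem_iff]
    rintro ⟨s, hs, hsm⟩
    obtain ⟨hne, hs⟩ := Finset.mem_erase.mp hs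
    obtain ⟨g, rfl⟩ := memS.mp hs
    rw [eval_sub, eval_X, eval_C] at hsm
    refine Ideal.IsPrime.ne_top' (I := m) (m.eq_top_iff_one.mpr ?_)
    simpa using m.add_mem hsm (hb' g hne)
  obtain ⟨a, ha, ha1⟩ := HenselianLocalRing.is_henselian p pmonic 1 (by
    rw [← hm, Ideal.mem_under, hval, hp, fac, eval_mul, eval_sub, eval_X, eval_C]
    exact m.mul_mem_right _ hb) (by
    rw [← not_not (a := IsUnit _), ← mem_nonunits_iff, ← IsLocalRing.mem_maximalIdeal, ← hm,
      Ideal.mem_under, hval, ← derivative_map, hp, fac, derivative_mul, eval_add, eval_mul, eval_mul,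
      eval_sub, eval_X, eval_C, derivative_X_sub_C, eval_one, one_mul,
      Ideal.add_mem_iff_left _ (m.mul_mem_right _ hb)]
    exact h1)
  have hroot : f.eval (algebraMap A B a) = 0 := by
    rw [← hp, eval_map, eval₂_at_apply, ha, map_zero]
  rw [hf, eval_prod, Finset.prod_eq_zero_iff] at hroot
  obtain ⟨s, hs, h0⟩ := hroot
  obtain ⟨g, rfl⟩ := memS.mp hs
  rw [eval_sub, eval_X, eval_C, sub_eq_zero] at h0
  by_cases hg : g • b = b
  · exact ⟨a, by rw [h0, hg]⟩
  -- otherwise `1` lies in `m`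
  · exfalso
    have h2 : algebraMap A B (a - 1) ∈ m := by
      rw [← Ideal.mem_under, hm]; exact ha1
    rw [map_sub, map_one, h0] at h2
    refine Ideal.IsPrime.ne_top' (I := m) (m.eq_top_iff_one.mpr ?_)
    simpa using m.sub_mem (hb' g hg) h2

variable (A B G) in
open scoped Classical in
/-- A domain with a finite group action whose invariants form a Henselian local ring is local. -/
theorem isLocalRing_of_isInvariant [FaithfulSMul A B] [SMulCommClass G A B] : IsLocalRing B := by
  have := Fintype.ofFinite G
  have hint : Algebra.IsIntegral A B := Algebra.IsInvariant.isIntegral A B G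
  have under : ∀ m : Ideal B, m.IsMaximal → m.under A = IsLocalRing.maximalIdeal A := fun m hm ↦
    IsLocalRing.eq_maximalIdeal (Ideal.isMaximal_comap_of_isIntegral_of_isMaximal m)
  obtain ⟨m, hm⟩ := Ideal.exists_maximal B
  refine IsLocalRing.of_unique_max_ideal ⟨m, hm, fun m' hm' ↦ ?_⟩
  by_contra hne
  obtain ⟨g₀, rfl⟩ := Algebra.IsInvariant.exists_smul_of_under_eq A B G m m'
    ((under m hm).trans (under m' hm').symm)
  have maxg : ∀ g : G, (g • m).IsMaximal := fun g ↦ by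
    rw [Ideal.pointwise_smul_eq_comap]
    exact Ideal.comap_isMaximal_of_surjective _ (MulSemiringAction.toRingEquiv G B g⁻¹).surjective
  -- an element of all the conjugates of `m` other than `m`, congruent to `1` modulo `m`
  have hc : ∀ g : G, ∃ c ∉ m, g • m ≠ m → c ∈ g • m := fun g ↦ by
    by_cases hg : g • m = m
    · exact ⟨1, fun h ↦ hm.ne_top (m.eq_top_iff_one.mpr h), fun h ↦ (h hg).elim⟩
    · obtain ⟨c, hc, hcm⟩ := SetLike.not_le_iff_exists.mp fun hle ↦ hg ((maxg g).eq_of_le hm.ne_top hle)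
      exact ⟨c, hcm, fun _ ↦ hc⟩
  choose c hcm hc using hc
  have hcprod : ∏ g, c g ∉ m := by
    rw [Ideal.IsPrime.prod_mem_iff]
    rintro ⟨g, -, hg⟩
    exact hcm g hg
  obtain ⟨y, i, hi, hyi⟩ := hm.exists_inv hcprod
  set b := y * ∏ g, c g with hb
  have hbg : ∀ g : G, g • m ≠ m → b ∈ g • m := fun g hg ↦
    Ideal.mul_mem_left _ _ (Ideal.mem_of_dvd _ (Finset.dvd_prod_of_mem c (Finset.mem_univ g))
      (hc g hg))
  have hb1 : 1 - b ∈ m := by rw [← hyi, add_sub_cancel_left]; exact hi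
  -- make it invariant under the decomposition group
  set D : Finset G := Finset.univ.filter fun g ↦ g • m = m with hD
  have memD : ∀ {g}, g ∈ D ↔ g • m = m := fun {g} ↦ by simp [hD]
  set β := ∏ g ∈ D, g • b with hβ
  have hβ1 : 1 - β ∈ m := by
    rw [← Ideal.Quotient.eq_zero_iff_mem, map_sub, map_one, hβ, map_prod, Finset.prod_eq_one, sub_self]
    intro g hg
    have : g • (1 - b) ∈ m := by
      have := Ideal.smul_mem_pointwise_smul g _ _ hb1
      rwa [memD.mp hg] at this
    rw [smul_sub, smul_one, ← Ideal.Quotient.eq_zero_iff_mem, map_sub, map_one, sub_eq_zero] at this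
    exact this.symm
  have hβg : ∀ g : G, g • m ≠ m → β ∈ g • m := fun g hg ↦
    Ideal.mem_of_dvd _ (Finset.dvd_prod_of_mem _ (memD.mpr (one_smul G m)))
      (by rw [one_smul]; exact hbg g hg)
  have hfix : ∀ g : G, g • m = m → g • β = β := fun g hg ↦ by
    rw [hβ, Finset.smul_prod']
    refine Finset.prod_bij (fun s _ ↦ g * s) (fun s hs ↦ ?_) (fun s _ t _ h ↦ ?_) (fun s hs ↦ ?_)
      fun s _ ↦ (mul_smul _ _ _).symm
    · rw [memD, mul_smul, memD.mp hs, hg]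
    · exact mul_left_cancel h
    · refine ⟨g⁻¹ * s, ?_, mul_inv_cancel_left _ _⟩
      rw [memD, mul_smul, memD.mp hs, inv_smul_eq_iff, hg]
  obtain ⟨a, ha⟩ := mem_range_of_conjugates_mem (A := A) (G := G) (under m hm) hβ1 fun g hg ↦ by
    have hg' : g⁻¹ • m ≠ m := fun h ↦ hg (hfix g (by rw [← h, smul_inv_smul, h]))
    have := Ideal.smul_mem_pointwise_smul g _ _ (hβg _ hg')
    rwa [smul_inv_smul] at this
  have h1 : a ∈ (g₀ • m).under A := by rw [Ideal.mem_under, ha]; exact hβg g₀ hne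
  rw [under _ hm', ← under m hm, Ideal.mem_under, ha] at h1
  refine hm.ne_top (m.eq_top_iff_one.mpr ?_)
  simpa using m.add_mem hβ1 h1

end Local

section IntegralClosure

theorem smulCommClass_algEquiv (O K L : Type*) [CommRing O] [Field K] [Algebra O K] [Field L]
    [Algebra K L] [Algebra O L] [IsScalarTower O K L] : SMulCommClass (L ≃ₐ[K] L) O L :=
  ⟨fun g r x ↦ by
    rw [← IsScalarTower.algebraMap_smul K r x, ← IsScalarTower.algebraMap_smul K r (g • x),
      smul_comm]⟩

theorem faithfulSMul_of_isFractionRing (O K L : Type*) [CommRing O] [Field K] [Algebra O K]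
    [IsFractionRing O K] [Field L] [Algebra K L] [Algebra O L] [IsScalarTower O K L] :
    FaithfulSMul O L := by
  rw [faithfulSMul_iff_algebraMap_injective, IsScalarTower.algebraMap_eq O K L]
  exact (algebraMap K L).injective.comp (IsFractionRing.injective O K)

theorem faithfulSMul_integralClosure (O L : Type*) [CommRing O] [Field L] [Algebra O L]
    [FaithfulSMul O L] : FaithfulSMul O (integralClosure O L) := by
  rw [faithfulSMul_iff_algebraMap_injective]
  refine Function.Injective.of_comp (f := algebraMap (integralClosure O L) L) ?_
  rw [← RingHom.coe_comp, ← IsScalarTower.algebraMap_eq]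
  exact FaithfulSMul.algebraMap_injective O L

theorem isLocalRing_integralClosure_of_algHom {O L L' : Type*} [CommRing O] [Field L] [Algebra O L]
    [Field L'] [Algebra O L'] (f : L →ₐ[O] L') [IsLocalRing (integralClosure O L')] :
    IsLocalRing (integralClosure O L) := by
  have hf : Function.Injective f.mapIntegralClosure := fun a b h ↦
    Subtype.ext (f.toRingHom.injective (congrArg Subtype.val h))
  let g : integralClosure O L →+* integralClosure O L' := f.mapIntegralClosure
  have hg : g.IsIntegral := RingHom.IsIntegral.tower_top (algebraMap O _) g (by
    have : g.comp (algebraMap O _) = algebraMap O (integralClosure O L') :=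
      f.mapIntegralClosure.comp_algebraMap
    rw [this]
    exact algebraMap_isIntegral_iff.mpr inferInstance)
  have : IsLocalHom g := hg.isLocalHom hf
  exact g.domain_isLocalRing

variable (O K L : Type*) [CommRing O] [IsIntegrallyClosed O]
  [Field K] [Algebra O K] [IsFractionRing O K] [Field L] [Algebra K L] [Algebra O L]
  [IsScalarTower O K L]

theorem isInvariant_integralClosure [FiniteDimensional K L] [IsGalois K L] :
    letI := smulCommClass_algEquiv O K L
    Algebra.IsInvariant O (integralClosure O L) (L ≃ₐ[K] L) := by
  let := smulCommClass_algEquiv O K L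
  refine ⟨fun b hb ↦ ?_⟩
  obtain ⟨x, hx⟩ := (IsGalois.mem_range_algebraMap_iff_fixed (F := K) (b : L)).mpr fun g ↦
    congrArg Subtype.val (hb g)
  have hint : IsIntegral O x := by
    rw [← isIntegral_algebraMap_iff (algebraMap K L).injective, hx]; exact b.2
  obtain ⟨a, rfl⟩ := IsIntegrallyClosed.algebraMap_eq_of_integral hint
  exact ⟨a, Subtype.ext (by rw [← hx, ← IsScalarTower.algebraMap_apply]; rfl)⟩

/-- The integral closure of a Henselian ring in a finite separable extension is local. -/
theorem isLocalRing_integralClosure [HenselianLocalRing O] [FiniteDimensional K L]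
    [Algebra.IsSeparable K L] : IsLocalRing (integralClosure O L) := by
  have : Algebra.IsSeparable K (SeparableClosure L) := Algebra.IsSeparable.trans K L _
  have : IsSepClosure K (SeparableClosure L) := ⟨inferInstance, inferInstance⟩
  let N := IntermediateField.normalClosure K L (SeparableClosure L)
  let : Algebra O N := ((algebraMap K N).comp (algebraMap O K)).toAlgebra
  have : IsScalarTower O K N := IsScalarTower.of_algebraMap_eq fun _ ↦ rfl
  have : IsLocalRing (integralClosure O N) := by
    let := smulCommClass_algEquiv O K N
    have := isInvariant_integralClosure O K N
    have := faithfulSMul_of_isFractionRing O K N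
    have := faithfulSMul_integralClosure O N
    exact isLocalRing_of_isInvariant O (integralClosure O N) (N ≃ₐ[K] N)
  exact isLocalRing_integralClosure_of_algHom
    ((IsScalarTower.toAlgHom K L N).restrictScalars O)

end IntegralClosure

end UnramifiedNorm

namespace UnramifiedNorm

open Polynomial

/-! ### Finite separable extensions of Henselian rings are Henselian -/

section Hensel

theorem eval_mem_of_two_roots {B : Type*} [CommRing B] {m : Ideal B} {t : Multiset B} {b : B}
    (h : ∀ c ∈ t, b - c ∈ m) (ht : 2 ≤ t.card) :
    ((t.map fun c ↦ X - C c).prod.derivative).eval b ∈ m := by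
  obtain ⟨c₁, hc₁⟩ := Multiset.card_pos_iff_exists_mem.mp (by omega : 0 < t.card)
  obtain ⟨t, rfl⟩ := Multiset.exists_cons_of_mem hc₁
  rw [Multiset.card_cons] at ht
  obtain ⟨c₂, hc₂⟩ := Multiset.card_pos_iff_exists_mem.mp (by omega : 0 < t.card)
  obtain ⟨t, rfl⟩ := Multiset.exists_cons_of_mem hc₂
  have h₁ := h c₁ (by simp)
  have h₂ := h c₂ (by simp)
  rw [Multiset.map_cons, Multiset.prod_cons, Multiset.map_cons, Multiset.prod_cons, derivative_mul,
    eval_add, eval_mul, eval_mul, eval_mul]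
  simp only [eval_sub, eval_X, eval_C]
  exact m.add_mem (m.mul_mem_left _ (m.mul_mem_right _ h₂)) (m.mul_mem_right _ h₁)

/-- A monic polynomial over a local domain with an approximate simple root has an irreducible
monic factor with the same approximate root. -/
theorem exists_irreducible_factor {B : Type*} [CommRing B] [IsDomain B] [IsLocalRing B] {f : B[X]}
    (hf : f.Monic) {b : B} (hb : f.eval b ∈ IsLocalRing.maximalIdeal B)
    (hb' : IsUnit (f.derivative.eval b)) :
    ∃ g : B[X], g.Monic ∧ Irreducible g ∧ g ∣ f ∧ g.eval b ∈ IsLocalRing.maximalIdeal B ∧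
      IsUnit (g.derivative.eval b) := by
  classical
  have hex : ∃ n, ∃ g : B[X], g.Monic ∧ g ∣ f ∧ g.eval b ∈ IsLocalRing.maximalIdeal B ∧
      g.natDegree = n := ⟨_, f, hf, dvd_rfl, hb, rfl⟩
  obtain ⟨g, hg, hgf, hgb, hdeg⟩ := Nat.find_spec hex
  refine ⟨g, hg, ?_, hgf, hgb, ?_⟩
  · rw [hg.irreducible_iff_natDegree]
    refine ⟨fun h1 ↦ ?_, fun p q hp hq hpq ↦ ?_⟩
    · rw [h1, eval_one] at hgb
      exact (IsLocalRing.maximalIdeal.isMaximal B).ne_top ((Ideal.eq_top_iff_one _).mpr hgb)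
    · have hle : ∀ r : B[X], r.Monic → r ∣ g → r.eval b ∈ IsLocalRing.maximalIdeal B →
          g.natDegree ≤ r.natDegree := fun r hr hrg hrb ↦ by
        rw [hdeg]
        exact Nat.find_min' hex ⟨r, hr, hrg.trans hgf, hrb, rfl⟩
      have hd : g.natDegree = p.natDegree + q.natDegree := by rw [← hpq, hp.natDegree_mul hq]
      rw [← hpq, eval_mul] at hgb
      rcases (IsLocalRing.maximalIdeal.isMaximal B).isPrime.mem_or_mem hgb with h | h
      · have := hle p hp ⟨q, hpq.symm⟩ h
        omega
      · have := hle q hq ⟨p, by rw [mul_comm, hpq]⟩ h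
        omega
  · by_contra hu
    have hu : g.derivative.eval b ∈ IsLocalRing.maximalIdeal B := hu
    obtain ⟨q, rfl⟩ := hgf
    rw [derivative_mul, eval_add, eval_mul, eval_mul] at hb'
    exact (IsLocalRing.mem_maximalIdeal _).mp (Ideal.add_mem _ (Ideal.mul_mem_right _ _ hu)
      (Ideal.mul_mem_right _ _ hgb)) hb'

variable (O K L : Type*) [CommRing O] [IsDomain O] [IsIntegrallyClosed O] [HenselianLocalRing O]
  [Field K] [Algebra O K] [IsFractionRing O K] [Field L] [Algebra K L] [Algebra O L]
  [IsScalarTower O K L]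

/-- The integral closure of a Henselian ring in a finite separable extension is Henselian. An
irreducible polynomial with an approximate simple root has degree one: in its splitting field, all
of its roots are conjugate, hence congruent to the approximate root. -/
theorem henselianLocalRing_integralClosure [FiniteDimensional K L] [Algebra.IsSeparable K L] :
    HenselianLocalRing (integralClosure O L) := by
  have loc : IsLocalRing (integralClosure O L) := isLocalRing_integralClosure O K L
  have : IsFractionRing (integralClosure O L) L :=
    integralClosure.isFractionRing_of_finite_extension K L
  have : IsIntegrallyClosed (integralClosure O L) :=
    integralClosure.isIntegrallyClosedOfFiniteExtension K
  refine ⟨fun f hf b hb hb' ↦ ?_⟩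
  obtain ⟨g, hg, girr, hgf, hgb, hgb'⟩ := exists_irreducible_factor hf hb hb'
  suffices h1 : g.natDegree = 1 by
    have e : g = X + C (g.coeff 0) := hg.eq_X_add_C h1
    refine ⟨-g.coeff 0, ?_, ?_⟩
    · obtain ⟨q, rfl⟩ := hgf
      rw [IsRoot, eval_mul, e]
      simp
    · rw [e, eval_add, eval_X, eval_C] at hgb
      have := Ideal.neg_mem_iff _ |>.mpr hgb
      rwa [neg_add_rev, ← sub_eq_add_neg] at this
  set gL := g.map (algebraMap (integralClosure O L) L) with hgL
  have gLirr : Irreducible gL := (hg.irreducible_iff_irreducible_map_fraction_map (K := L)).mp girr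
  have gLsep : gL.Separable := by
    rw [separable_iff_derivative_ne_zero gLirr]
    intro h0
    rw [hgL, derivative_map, Polynomial.map_eq_zero_iff (IsFractionRing.injective _ L)] at h0
    rw [h0, eval_zero] at hgb'
    exact not_isUnit_zero hgb'
  let S := gL.SplittingField
  have : IsGalois L S := IsGalois.of_separable_splitting_field gLsep
  have : Algebra.IsSeparable K S := Algebra.IsSeparable.trans K L S
  have : FiniteDimensional K S := FiniteDimensional.trans K L S
  have : IsScalarTower O K S := IsScalarTower.of_algebraMap_eq fun x ↦ by
    rw [IsScalarTower.algebraMap_apply O L S, IsScalarTower.algebraMap_apply O K L,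
      ← IsScalarTower.algebraMap_apply K L S]
  have : IsLocalRing (integralClosure O S) := isLocalRing_integralClosure O K S
  let φ : integralClosure O L →+* integralClosure O S :=
    (IsScalarTower.toAlgHom O L S).mapIntegralClosure
  have hφ : ∀ x, ((φ x : integralClosure O S) : S) = algebraMap L S x := fun _ ↦ rfl
  have φmem : ∀ x ∈ IsLocalRing.maximalIdeal _, φ x ∈ IsLocalRing.maximalIdeal _ := fun x hx ↦ by
    have hint : φ.IsIntegral := RingHom.IsIntegral.tower_top (algebraMap O _) φ (by
      have : φ.comp (algebraMap O _) = algebraMap O (integralClosure O S) :=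
        (IsScalarTower.toAlgHom O L S).mapIntegralClosure.comp_algebraMap
      rw [this]
      exact algebraMap_isIntegral_iff.mpr inferInstance)
    have : IsLocalHom φ := hint.isLocalHom fun x y h ↦
      Subtype.ext ((algebraMap L S).injective (congrArg Subtype.val h))
    exact fun h ↦ hx (isUnit_of_map_unit φ x h)
  -- the roots of `g` are integral
  set s := (gL.map (algebraMap L S)).roots with hs
  have hprod : gL.map (algebraMap L S) = (s.map fun r ↦ X - C r).prod :=
    (SplittingField.splits gL).eq_prod_roots_of_monic ((hg.map _).map _)
  have hroot : ∀ r ∈ s, aeval r gL = 0 := fun r hr ↦ by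
    have := isRoot_of_mem_roots hr
    rwa [IsRoot, eval_map_algebraMap] at this
  have hint : ∀ r ∈ s, IsIntegral O r := fun r hr ↦ by
    refine isIntegral_trans (A := integralClosure O L) r ⟨g, hg, ?_⟩
    have h1 : aeval r (g.map (algebraMap (integralClosure O L) L)) = 0 := hroot r hr
    rwa [aeval_map_algebraMap] at h1
  obtain ⟨t, ht⟩ : ∃ t : Multiset (integralClosure O S), t.map Subtype.val = s :=
    ⟨s.attach.map fun r ↦ ⟨r.1, hint r.1 r.2⟩, by
      rw [Multiset.map_map]; exact s.attach_map_val⟩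
  have hprod' : g.map φ = (t.map fun c ↦ X - C c).prod := by
    refine Polynomial.map_injective (algebraMap (integralClosure O S) S) Subtype.val_injective ?_
    rw [Polynomial.map_map, Polynomial.map_multiset_prod, Multiset.map_map]
    have e1 : g.map ((algebraMap (integralClosure O S) S).comp φ) = gL.map (algebraMap L S) :=
      (Polynomial.map_map (algebraMap _ L) (algebraMap L S) g).symm
    rw [e1, hprod, ← ht, Multiset.map_map]
    congr 1
    refine Multiset.map_congr rfl fun c _ ↦ ?_
    simp
  -- the roots are conjugate, and one of them is congruent to the approximate root
  have hconj : ∀ c ∈ t, φ b - c ∈ IsLocalRing.maximalIdeal (integralClosure O S) := by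
    have h1 := φmem _ hgb
    rw [← eval₂_at_apply, ← eval_map, hprod', eval_multiset_prod, Multiset.map_map,
      (IsLocalRing.maximalIdeal.isMaximal _).isPrime.multiset_prod_mem_iff_exists_mem] at h1
    obtain ⟨x, hx, hxm⟩ := h1
    obtain ⟨θ, hθ, rfl⟩ := Multiset.mem_map.mp hx
    intro c hc
    have hmin : ∀ c ∈ t, minpoly L (c : S) = gL := fun c hc ↦
      (minpoly.eq_of_irreducible_of_monic gLirr
        (hroot c (ht ▸ Multiset.mem_map_of_mem _ hc)) (hg.map _)).symm
    obtain ⟨τ, hτ⟩ := (Normal.minpoly_eq_iff_mem_orbit (F := L) (E := S)).mp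
      ((hmin c hc).trans (hmin θ hθ).symm)
    let T := AlgEquiv.mapIntegralClosure (τ.restrictScalars O)
    have e : T (φ b - θ) = φ b - c := by
      rw [map_sub]
      congr 1
      · exact Subtype.ext (τ.commutes b)
      · exact Subtype.ext hτ
    rw [← e]
    simp only [Function.comp_apply, eval_sub, eval_X, eval_C] at hxm
    exact fun h ↦ hxm ((MulEquiv.isUnit_map T).mp h)
  have hcard : g.natDegree = t.card := by
    rw [← hg.natDegree_map φ, hprod', natDegree_multiset_prod_X_sub_C_eq_card]
  have hpos : g.natDegree ≠ 0 := fun h0 ↦ girr.not_isUnit (by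
    rw [eq_one_of_monic_natDegree_zero hg h0]; exact isUnit_one)
  have hlt : ¬ 2 ≤ t.card := fun h2 ↦ by
    have := eval_mem_of_two_roots hconj h2
    rw [← hprod', derivative_map, eval_map, eval₂_at_apply] at this
    exact this (hgb'.map φ)
  omega

end Hensel

/-! ### The valuation of a finite unramified extension -/

section HenselValuation

variable {R F Γ₀ : Type*} [CommRing R] [Field F] [Algebra R F]
  [LinearOrderedCommGroupWithZero Γ₀] {v : Valuation F Γ₀}

theorem mem_maximalIdeal_iff_val [IsLocalRing R] (hv : v.Integers R) {a : R} :
    a ∈ IsLocalRing.maximalIdeal R ↔ v (algebraMap R F a) < 1 := by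
  rw [IsLocalRing.mem_maximalIdeal, mem_nonunits_iff, hv.isUnit_iff_valuation_eq_one]
  exact (hv.map_le_one a).lt_iff_ne.symm

theorem exists_root_of_henselian [HenselianLocalRing R] (hv : v.Integers R) {f : F[X]} {b : F}
    (hf : f.Monic) (hint : f ∈ integralPolynomials v) (hb : v b ≤ 1) (h0 : v (f.eval b) < 1)
    (h1 : v (f.derivative.eval b) = 1) : ∃ a, f.eval a = 0 ∧ v (a - b) < 1 := by
  obtain ⟨p, hp, -, pmonic⟩ := lifts_and_natDegree_eq_and_monic
    ((f.lifts_iff_coeff_lifts (f := algebraMap R F)).mpr fun n ↦ hv.exists_of_le_one (hint n)) hf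
  obtain ⟨b, rfl⟩ := hv.exists_of_le_one hb
  rw [← hp, eval_map, eval₂_at_apply] at h0
  rw [← hp, derivative_map, eval_map, eval₂_at_apply] at h1
  obtain ⟨a, ha, hab⟩ := HenselianLocalRing.is_henselian p pmonic b
    ((mem_maximalIdeal_iff_val hv).mpr h0) (hv.isUnit_of_one' h1)
  refine ⟨algebraMap R F a, ?_, ?_⟩
  · rw [← hp, eval_map, eval₂_at_apply, ha, map_zero]
  · rw [← map_sub]
    exact (mem_maximalIdeal_iff_val hv).mp hab

/-- Up to units, every nonzero element is a power of a uniformizer. -/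
theorem exists_val_eq_zpow [IsDomain R] [IsDiscreteValuationRing R] [IsFractionRing R F]
    (hv : v.Integers R) {ϖ : R} (hϖ : Irreducible ϖ) {x : F} (hx : x ≠ 0) :
    ∃ n : ℤ, v x = v (algebraMap R F ϖ) ^ n := by
  have key : ∀ a : R, a ≠ 0 → ∃ n : ℕ, v (algebraMap R F a) = v (algebraMap R F ϖ) ^ n := by
    intro a ha
    obtain ⟨n, u, rfl⟩ := IsDiscreteValuationRing.eq_unit_mul_pow_irreducible ha hϖ
    exact ⟨n, by rw [map_mul, map_mul, hv.valuation_unit, one_mul, map_pow, map_pow]⟩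
  obtain ⟨a, b, hb, rfl⟩ := IsFractionRing.div_surjective (A := R) x
  have ha0 : a ≠ 0 := fun h ↦ hx (by rw [h, map_zero, zero_div])
  obtain ⟨m, hm⟩ := key a ha0
  obtain ⟨n, hn⟩ := key b (nonZeroDivisors.ne_zero hb)
  refine ⟨m - n, ?_⟩
  have h0 : v (algebraMap R F ϖ) ≠ 0 := v.ne_zero_iff.mpr fun h ↦
    hϖ.ne_zero (IsFractionRing.injective R F (by rw [h, map_zero]))
  rw [map_div₀, hm, hn, zpow_sub₀ h0, zpow_natCast, zpow_natCast]

end HenselValuation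

section NormalElement

/-- A normal basis generator has a nonzero trace, and differs from its conjugates even up to
sign. -/
theorem exists_normal_element (G k : Type*) [Group G] [Fintype G] [Field k] [MulSemiringAction G k]
    [FaithfulSMul G k] :
    ∃ x : k, x ≠ 0 ∧ ∑ g : G, g • x ≠ 0 ∧ ∀ g : G, g ≠ 1 → g • x - x ≠ 0 ∧ g • x + x ≠ 0 := by
  let := Classical.decEq G
  obtain ⟨x, hx⟩ := exists_linearIndependent_algEquiv_apply (FixedPoints.subfield G k) k
  have hx' : LinearIndependent (FixedPoints.subfield G k) fun g : G ↦ g • x :=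
    hx.comp _ (FixedPoints.toAlgAutMulEquiv G k).injective
  rw [Fintype.linearIndependent_iff] at hx'
  refine ⟨x, fun h0 ↦ ?_, fun h0 ↦ ?_, fun g hg ↦ ⟨fun h0 ↦ ?_, fun h0 ↦ ?_⟩⟩
  · simpa using hx' (fun _ ↦ 1) (by simp [h0]) 1
  · simpa using hx' (fun _ ↦ 1) (by simpa using h0) 1
  · simpa [hg] using hx' (fun h ↦ (if h = g then 1 else 0) - (if h = 1 then 1 else 0)) (by
      simpa [sub_smul, Finset.sum_sub_distrib, ite_smul] using h0) g
  · simpa [hg] using hx' (fun h ↦ (if h = g then 1 else 0) + (if h = 1 then 1 else 0)) (by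
      simpa [add_smul, Finset.sum_add_distrib, ite_smul] using h0) g

end NormalElement

section Unramified

variable {O K L : Type*} [CommRing O] [Field K] [Algebra O K] [Field L] [Algebra K L] [Algebra O L]
  [IsScalarTower O K L] {Γ₀ : Type*} [LinearOrderedCommGroupWithZero Γ₀] {v : Valuation L Γ₀}

theorem val_algEquiv_le_one_iff (hv : v.Integers (integralClosure O L)) (σ : L ≃ₐ[K] L) {x : L} :
    v (σ x) ≤ 1 ↔ v x ≤ 1 := by
  have key : ∀ (τ : L ≃ₐ[K] L) (y : L), v y ≤ 1 → v (τ y) ≤ 1 := fun τ y hy ↦ by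
    obtain ⟨b, rfl⟩ := hv.exists_of_le_one hy
    exact hv.map_le_one ⟨τ b, b.2.map (τ.restrictScalars O)⟩
  refine ⟨fun h ↦ ?_, key σ x⟩
  simpa using key σ.symm _ h

variable [IsDomain O] [IsFractionRing O K]

theorem IsFiniteUnramified.isSeparable (hL : IsFiniteUnramified O K L) :
    Algebra.IsSeparable K L := by
  have := hL.finiteDimensional
  have := hL.formallyUnramified
  have := hL.isFractionRing
  have : Algebra.FormallyUnramified (integralClosure O L) L :=
    Algebra.FormallyUnramified.of_isLocalization (nonZeroDivisors (integralClosure O L))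
  have : Algebra.FormallyUnramified O L := .comp O (integralClosure O L) L
  have : Algebra.FormallyUnramified K L := .of_restrictScalars O K L
  exact (Algebra.FormallyUnramified.iff_isSeparable K L).mp this

/-- The Galois group of an unramified extension acts faithfully on the residue field. -/
theorem IsFiniteUnramified.eq_one_of_residue (hL : IsFiniteUnramified O K L)
    (hv : v.Integers (integralClosure O L)) {σ : L ≃ₐ[K] L}
    (h : ∀ x, v x ≤ 1 → v (σ x - x) < 1) : σ = 1 := by
  have := hL.isDiscreteValuationRing
  have := hL.isFractionRing
  have := hL.formallyUnramified
  let f := (AlgEquiv.mapIntegralClosure (σ.restrictScalars O)).toAlgHom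
  have key : f = AlgHom.id O _ := by
    refine Algebra.FormallyUnramified.ext_of_iInf _
      (Ideal.iInf_pow_eq_bot_of_isLocalRing (IsLocalRing.maximalIdeal (integralClosure O L))
        Ideal.IsPrime.ne_top') fun x ↦ ?_
    rw [Ideal.Quotient.eq, mem_maximalIdeal_iff_val hv]
    exact h _ (hv.map_le_one x)
  ext x
  obtain ⟨a, b, -, rfl⟩ := IsFractionRing.div_surjective (A := integralClosure O L) x
  have h1 : ∀ a : integralClosure O L, σ (a : L) = a := fun a ↦
    congrArg Subtype.val (DFunLike.congr_fun key a)
  rw [map_div₀]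
  exact congrArg₂ _ (h1 a) (h1 b)

/-- A normal basis of the residue field extension lifts to conjugate units. -/
theorem IsFiniteUnramified.exists_normal (hL : IsFiniteUnramified O K L) [FiniteDimensional K L]
    (hv : v.Integers (integralClosure O L)) :
    ∃ u : L, v u = 1 ∧ v (∑ σ : L ≃ₐ[K] L, σ u) = 1 ∧
      ∀ σ : L ≃ₐ[K] L, σ ≠ 1 → v (σ u - u) = 1 ∧ v (σ u + u) = 1 := by
  have := hL.isDiscreteValuationRing
  let := smulCommClass_algEquiv O K L
  have hres : ∀ b : integralClosure O L, IsLocalRing.residue _ b ≠ 0 ↔ v (b : L) = 1 := fun b ↦ by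
    rw [Ne, IsLocalRing.residue_eq_zero_iff, mem_maximalIdeal_iff_val hv, not_lt]
    exact ⟨le_antisymm (hv.map_le_one b), fun h ↦ h.ge⟩
  have hfaith : FaithfulSMul (L ≃ₐ[K] L) (IsLocalRing.ResidueField (integralClosure O L)) := by
    refine ⟨fun {g₁ g₂} h ↦ ?_⟩
    rw [← inv_mul_eq_one]
    refine hL.eq_one_of_residue hv fun x hx ↦ ?_
    obtain ⟨b, rfl⟩ := hv.exists_of_le_one hx
    have h1 : (g₁⁻¹ * g₂) • IsLocalRing.residue _ b = IsLocalRing.residue _ b := by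
      rw [mul_smul, ← h, inv_smul_smul]
    rw [← IsLocalRing.ResidueField.residue_smul, ← sub_eq_zero, ← map_sub,
      IsLocalRing.residue_eq_zero_iff, mem_maximalIdeal_iff_val hv] at h1
    exact h1
  obtain ⟨x, hx0, hsum, hx⟩ := exists_normal_element (L ≃ₐ[K] L)
    (IsLocalRing.ResidueField (integralClosure O L))
  obtain ⟨u, rfl⟩ := IsLocalRing.residue_surjective x
  refine ⟨u, (hres u).mp hx0, ?_, fun σ hσ ↦ ?_⟩
  · simp only [← IsLocalRing.ResidueField.residue_smul] at hsum
    rw [← map_sum, hres, AddSubmonoidClass.coe_finsetSum] at hsum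
    exact hsum
  · have := hx σ hσ
    rw [← IsLocalRing.ResidueField.residue_smul, ← map_sub, ← map_add, hres, hres] at this
    exact this

variable [IsDiscreteValuationRing O]

theorem IsFiniteUnramified.map_maximalIdeal (hL : IsFiniteUnramified O K L)
    [IsLocalRing (integralClosure O L)] :
    (IsLocalRing.maximalIdeal O).map (algebraMap O (integralClosure O L)) =
      IsLocalRing.maximalIdeal (integralClosure O L) := by
  have := hL.finiteDimensional
  have := hL.formallyUnramified
  have := hL.isSeparable
  have := faithfulSMul_of_isFractionRing O K L
  have := faithfulSMul_integralClosure O L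
  have : Module.Finite O (integralClosure O L) := IsIntegralClosure.finite O K L _
  exact Algebra.FormallyUnramified.map_maximalIdeal

theorem IsFiniteUnramified.irreducible_algebraMap (hL : IsFiniteUnramified O K L) {ϖ : O}
    (hϖ : Irreducible ϖ) : Irreducible (algebraMap O (integralClosure O L) ϖ) := by
  have := hL.isDiscreteValuationRing
  rw [IsDiscreteValuationRing.irreducible_iff_uniformizer, ← hL.map_maximalIdeal,
    hϖ.maximalIdeal_eq, Ideal.map_span, Set.image_singleton]

theorem integers_comap (hv : v.Integers (integralClosure O L)) :
    (v.comap (algebraMap K L)).Integers O where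
  hom_inj := IsFractionRing.injective O K
  map_le_one x := by
    rw [Valuation.comap_apply, ← IsScalarTower.algebraMap_apply]
    exact hv.map_le_one (algebraMap O (integralClosure O L) x)
  exists_of_le_one x hx := by
    obtain ⟨b, hb⟩ := hv.exists_of_le_one hx
    refine IsIntegrallyClosed.algebraMap_eq_of_integral ?_
    rw [← isIntegral_algebraMap_iff (algebraMap K L).injective, ← hb]
    exact b.2

theorem IsFiniteUnramified.val_algEquiv (hL : IsFiniteUnramified O K L)
    (hv : v.Integers (integralClosure O L)) (σ : L ≃ₐ[K] L) (x : L) : v (σ x) = v x := by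
  have := hL.isDiscreteValuationRing
  have := hL.isFractionRing
  obtain ⟨ϖ, hϖ⟩ := IsDiscreteValuationRing.exists_irreducible O
  have hle : ∀ (τ : L ≃ₐ[K] L) (y : L), v (τ y) ≤ v y := fun τ y ↦ by
    rcases eq_or_ne y 0 with rfl | hy
    · simp
    obtain ⟨n, hn⟩ := exists_val_eq_zpow hv (hL.irreducible_algebraMap hϖ) hy
    obtain ⟨p, hp⟩ : ∃ p : K, p = algebraMap O K ϖ ^ n := ⟨_, rfl⟩
    have hp' : v (algebraMap K L p) = v y := by
      rw [hn, hp, map_zpow₀, map_zpow₀, ← IsScalarTower.algebraMap_apply]; rfl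
    have h0 : v (algebraMap K L p) ≠ 0 := by rw [hp']; exact v.ne_zero_iff.mpr hy
    have h1 : v (τ (y / algebraMap K L p)) ≤ 1 := by
      rw [val_algEquiv_le_one_iff hv, map_div₀, hp', div_self (v.ne_zero_iff.mpr hy)]
    rw [map_div₀, AlgEquiv.commutes, map_div₀, div_le_one₀ (zero_lt_iff.mpr h0), hp'] at h1
    exact h1
  refine le_antisymm (hle σ x) ?_
  simpa using hle σ.symm (σ x)

theorem IsFiniteUnramified.isHenselianUnramified [HenselianLocalRing O]
    (hL : IsFiniteUnramified O K L) [FiniteDimensional K L]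
    (hv : v.Integers (integralClosure O L)) : IsHenselianUnramified K v where
  map_algEquiv := hL.val_algEquiv hv
  exists_uniformizer := by
    have := hL.isDiscreteValuationRing
    obtain ⟨ϖ, hϖ⟩ := IsDiscreteValuationRing.exists_irreducible O
    have hϖ' := hL.irreducible_algebraMap hϖ
    have hval : v (algebraMap K L (algebraMap O K ϖ)) =
        v (algebraMap (integralClosure O L) L (algebraMap O (integralClosure O L) ϖ)) := by
      rw [← IsScalarTower.algebraMap_apply]; rfl
    refine ⟨Units.mk0 (algebraMap O K ϖ) fun h ↦ hϖ.ne_zero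
      (IsFractionRing.injective O K (by rw [h, map_zero])), ?_, fun x hx ↦ ?_⟩
    · rw [Units.val_mk0, hval]
      exact hv.valuation_irreducible_lt_one hϖ'
    · obtain ⟨b, rfl⟩ := hv.exists_of_le_one hx.le
      rw [← mem_maximalIdeal_iff_val hv, hϖ'.maximalIdeal_eq, Ideal.mem_span_singleton] at hx
      rw [Units.val_mk0, hval]
      exact hv.le_of_dvd hx
  hensel f b hf hint hb h0 h1 := by
    have := hL.isSeparable
    have := henselianLocalRing_integralClosure O K L
    exact exists_root_of_henselian hv hf hint hb h0 h1
  hensel_base f b hf hint hb h0 h1 := exists_root_of_henselian (integers_comap hv) hf hint hb h0 h1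
  exists_normal := hL.exists_normal hv

end Unramified

end UnramifiedNorm

namespace UnramifiedNorm

open WeierstrassCurve

/-! ### Subextensions of finite unramified extensions -/

section Subextension

variable {O K L F : Type*} [CommRing O] [IsDomain O] [IsDiscreteValuationRing O]
  [Field K] [Algebra O K] [IsFractionRing O K] [Field L] [Algebra K L] [Algebra O L]
  [IsScalarTower O K L] [Field F] [Algebra K F] [Algebra O F] [IsScalarTower O K F]

/-- The integral closure is Dedekind, and local because `O` is Henselian. -/
theorem isDiscreteValuationRing_integralClosure [HenselianLocalRing O] [FiniteDimensional K F]
    [Algebra.IsSeparable K F] : IsDiscreteValuationRing (integralClosure O F) := by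
  have := isLocalRing_integralClosure O K F
  have ded : IsDedekindDomain (integralClosure O F) := integralClosure.isDedekindDomain O K F
  have := faithfulSMul_of_isFractionRing O K F
  have := faithfulSMul_integralClosure O F
  refine ((IsDiscreteValuationRing.TFAE (integralClosure O F) fun h ↦ ?_).out 0 2).mpr ded
  exact IsDiscreteValuationRing.not_isField O (isField_of_isIntegral_of_isField
    (FaithfulSMul.algebraMap_injective O (integralClosure O F)) h)

/-- A subextension of a finite unramified extension is finite unramified. The separability of its
residue field is clear since the residue field of `O` is perfect. -/
theorem IsFiniteUnramified.of_algHom [HenselianLocalRing O]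
    [PerfectField (IsLocalRing.ResidueField O)] (hL : IsFiniteUnramified O K L) (f : F →ₐ[K] L) :
    IsFiniteUnramified O K F := by
  have := hL.finiteDimensional
  have := hL.isSeparable
  have := hL.isDiscreteValuationRing
  have finF : FiniteDimensional K F := FiniteDimensional.of_injective f.toLinearMap f.injective
  have sepF : Algebra.IsSeparable K F := Algebra.IsSeparable.of_algHom K L f
  have dvrF : IsDiscreteValuationRing (integralClosure O F) :=
    isDiscreteValuationRing_integralClosure (K := K)
  have := faithfulSMul_of_isFractionRing O K F
  have := faithfulSMul_integralClosure O F
  have : Module.Finite O (integralClosure O F) := IsIntegralClosure.finite O K F _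
  have : Algebra.IsAlgebraic (IsLocalRing.ResidueField O)
      (IsLocalRing.ResidueField (integralClosure O F)) := inferInstance
  have : Algebra.IsSeparable (IsLocalRing.ResidueField O)
      (IsLocalRing.ResidueField (integralClosure O F)) :=
    Algebra.IsAlgebraic.isSeparable_of_perfectField
  refine ⟨finF, dvrF, ?_⟩
  refine Algebra.FormallyUnramified.of_map_maximalIdeal (R := O) (S := integralClosure O F) ?_
  obtain ⟨ϖ, hϖ⟩ := IsDiscreteValuationRing.exists_irreducible O
  have hϖL := hL.irreducible_algebraMap hϖ
  have hloc : IsLocalHom (algebraMap O (integralClosure O F)) := inferInstance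
  -- a uniformizer `ϖ` of `O` divides each non-unit `y` already in the integral closure of `O` in `F`
  refine le_antisymm (((IsLocalRing.local_hom_TFAE
    (algebraMap O (integralClosure O F))).out 0 2).mp hloc) fun y hy ↦ ?_
  rw [hϖ.maximalIdeal_eq, Ideal.map_span, Set.image_singleton, Ideal.mem_span_singleton]
  let g : integralClosure O F →+* integralClosure O L := (f.restrictScalars O).mapIntegralClosure
  have hg : g.IsIntegral := RingHom.IsIntegral.tower_top (algebraMap O _) g (by
    have : g.comp (algebraMap O _) = algebraMap O (integralClosure O L) :=
      (f.restrictScalars O).mapIntegralClosure.comp_algebraMap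
    rw [this]
    exact algebraMap_isIntegral_iff.mpr inferInstance)
  have : IsLocalHom g := hg.isLocalHom fun x y h ↦ Subtype.ext (f.injective (congrArg Subtype.val h))
  have hgy : g y ∈ IsLocalRing.maximalIdeal _ := fun h ↦ hy (isUnit_of_map_unit g y h)
  rw [hϖL.maximalIdeal_eq, Ideal.mem_span_singleton] at hgy
  obtain ⟨z, hz⟩ := hgy
  have hz' : f (y : F) = f (algebraMap O F ϖ) * (z : L) := by
    have h1 : f (algebraMap O F ϖ) = algebraMap O L ϖ := (f.restrictScalars O).commutes ϖ
    rw [h1]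
    exact congrArg Subtype.val hz
  have h0 : algebraMap O F ϖ ≠ 0 := fun h ↦ hϖ.ne_zero
    (FaithfulSMul.algebraMap_injective O F (by rw [h, map_zero]))
  have hint : IsIntegral O ((y : F) / algebraMap O F ϖ) := by
    rw [← isIntegral_algHom_iff (f.restrictScalars O) f.injective]
    have : f ((y : F) / algebraMap O F ϖ) = z := by
      rw [map_div₀, hz', mul_div_cancel_left₀ _ ((map_ne_zero_iff f f.injective).mpr h0)]
    exact this ▸ z.2
  exact ⟨⟨_, hint⟩, Subtype.ext (mul_div_cancel₀ _ h0).symm⟩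

end Subextension

/-! ### Isomorphic extensions -/

section Transport

variable {O K M M' : Type*} [CommRing O] [Field K] [Algebra O K] [Field M] [Algebra K M]
  [Algebra O M] [IsScalarTower O K M] [Field M'] [Algebra K M'] [Algebra O M'] [IsScalarTower O K M']
  {Γ₀ : Type*} [LinearOrderedCommGroupWithZero Γ₀] {v : Valuation M Γ₀}

theorem integers_comap_algHom (hv : v.Integers (integralClosure O M)) (f : M' →ₐ[K] M) :
    (v.comap (f : M' →+* M)).Integers (integralClosure O M') where
  hom_inj := Subtype.val_injective
  map_le_one x := hv.map_le_one ⟨f x, x.2.map (f.restrictScalars O)⟩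
  exists_of_le_one x hx := by
    obtain ⟨b, hb⟩ := hv.exists_of_le_one hx
    refine ⟨⟨x, ?_⟩, rfl⟩
    rw [mem_integralClosure_iff, ← isIntegral_algHom_iff (f.restrictScalars O) f.injective]
    exact hb ▸ b.2

theorem comap_symm_apply (e : M ≃ₐ[K] M') (x : M) :
    v.comap ((e.symm : M' →ₐ[K] M) : M' →+* M) (e x) = v x := by
  simp [Valuation.comap_apply]

theorem integralCurve_map_algEquiv_iff (e : M ≃ₐ[K] M') {W : WeierstrassCurve M} :
    IntegralCurve (v.comap ((e.symm : M' →ₐ[K] M) : M' →+* M)) (W.map (e : M →+* M')) ↔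
      IntegralCurve v W := by
  have h := comap_symm_apply (v := v) e
  exact ⟨fun H ↦ ⟨(h _).symm.trans_le H.a₁, (h _).symm.trans_le H.a₂, (h _).symm.trans_le H.a₃,
    (h _).symm.trans_le H.a₄, (h _).symm.trans_le H.a₆⟩, fun H ↦ ⟨(h _).trans_le H.a₁,
    (h _).trans_le H.a₂, (h _).trans_le H.a₃, (h _).trans_le H.a₄, (h _).trans_le H.a₆⟩⟩

theorem MinimalCurve.map_algEquiv (e : M ≃ₐ[K] M') {W : WeierstrassCurve M}
    (hW : MinimalCurve v W) :
    MinimalCurve (v.comap ((e.symm : M' →ₐ[K] M) : M' →+* M)) (W.map (e : M →+* M')) := by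
  refine ⟨(integralCurve_map_algEquiv_iff e).mpr hW.integral, fun C hC ↦ ?_⟩
  have hCe : (C.map (e.symm : M' →+* M)).map (e : M →+* M') = C := by
    ext <;> simp [VariableChange.map]
  rw [← hCe, map_variableChange, integralCurve_map_algEquiv_iff] at hC
  exact hW.one_le _ hC

theorem baseChange_map_algEquiv (E : WeierstrassCurve K) (e : M ≃ₐ[K] M') :
    (E.baseChange M).map (e : M →+* M') = E.baseChange M' := by
  ext <;> simp [baseChange]

theorem smul_baseChange_map_algEquiv (E : WeierstrassCurve K) (C : VariableChange M)
    (e : M ≃ₐ[K] M') :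
    C.map (e : M →+* M') • E.baseChange M' = (C • E.baseChange M).map (e : M →+* M') := by
  rw [← map_variableChange, baseChange_map_algEquiv]

variable [IsDomain O] [IsFractionRing O K]

open scoped Classical in
/-- Isomorphisms of finite unramified extensions respect the points with nonsingular reduction. -/
theorem IsFiniteUnramified.map_mem_E0 (hM : IsFiniteUnramified O K M)
    (hM' : IsFiniteUnramified O K M') (e : M ≃ₐ[K] M') {E : WeierstrassCurve K} [E.IsElliptic]
    {P : (E.baseChange M).toAffine.Point} (hP : P ∈ hM.E0 E) :
    Affine.Point.map (W' := E) e.toAlgHom P ∈ hM'.E0 E := by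
  have := hM.isDiscreteValuationRing
  have := hM.isFractionRing
  have := hM'.isDiscreteValuationRing
  have := hM'.isFractionRing
  have : (E.baseChange M).IsElliptic := inferInstanceAs (E.map (algebraMap K M)).IsElliptic
  have : (E.baseChange M').IsElliptic := inferInstanceAs (E.map (algebraMap K M')).IsElliptic
  have hv := integers_valuation (integralClosure O M) M
  set v := (IsDiscreteValuationRing.maximalIdeal (integralClosure O M)).valuation M
  have hv' := integers_comap_algHom (K := K) hv (e.symm : M' →ₐ[K] M)
  obtain ⟨C, hC⟩ := exists_isMinimal (integralClosure O M) (E.baseChange M)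
  rw [isMinimal_iff_minimalCurve hv] at hC
  have h1 : P ∈ UnramifiedNorm.E0 (integralClosure O M) (E.baseChange M) := hP
  change _ ∈ UnramifiedNorm.E0 (integralClosure O M') (E.baseChange M')
  rw [mem_E0_iff hv rfl hC] at h1
  rw [mem_E0_iff hv' (smul_baseChange_map_algEquiv E C e) (hC.map_algEquiv e)]
  rcases P with _ | ⟨x, y, h⟩
  · exact zero_mem_smoothLocus
  rw [pointHom_some, some_mem_smoothLocus] at h1
  rw [Affine.Point.map_some, pointHom_some, some_mem_smoothLocus]
  have hx : coordX (C.map (e : M →+* M')) (e x) = e (coordX C x) := by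
    simp [coordX, VariableChange.map]
  have hy : coordY (C.map (e : M →+* M')) (e x) (e y) = e (coordY C x y) := by
    simp [coordY, VariableChange.map]
  change (v.comap _ (coordX (C.map (e : M →+* M')) (e x)) ≤ 1 →
    v.comap _ (coordY (C.map (e : M →+* M')) (e x) (e y)) ≤ 1 →
    ¬(v.comap _ (_ * coordY (C.map (e : M →+* M')) (e x) (e y) -
      (3 * coordX (C.map (e : M →+* M')) (e x) ^ 2 +
        2 * _ * coordX (C.map (e : M →+* M')) (e x) + _)) < 1 ∧
      v.comap _ (2 * coordY (C.map (e : M →+* M')) (e x) (e y) +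
        _ * coordX (C.map (e : M →+* M')) (e x) + _) < 1))
  rw [hx, hy]
  have e1 : ∀ W : WeierstrassCurve M, ∀ a b : M, (W.map (e : M →+* M')).a₁ * e b -
      (3 * e a ^ 2 + 2 * (W.map (e : M →+* M')).a₂ * e a + (W.map (e : M →+* M')).a₄) =
      e (W.a₁ * b - (3 * a ^ 2 + 2 * W.a₂ * a + W.a₄)) := fun W a b ↦ by simp [map_ofNat e 2, map_ofNat e 3]
  have e2 : ∀ W : WeierstrassCurve M, ∀ a b : M, 2 * e b + (W.map (e : M →+* M')).a₁ * e a +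
      (W.map (e : M →+* M')).a₃ = e (2 * b + W.a₁ * a + W.a₃) := fun W a b ↦ by simp [map_ofNat e 2]
  rw [e1, e2, comap_symm_apply, comap_symm_apply, comap_symm_apply, comap_symm_apply]
  exact h1

end Transport

/-! ### Reduction types in terms of a valuation -/

section ReductionType

variable {F Γ₀ : Type*} [Field F] [LinearOrderedCommGroupWithZero Γ₀] {v : Valuation F Γ₀}
  {W : WeierstrassCurve F}

/-- The reduction of the quadratic polynomial whose roots are the slopes of the tangent lines at
the node has a root in the residue field. If the reduction of `W` has a node, the polynomial is of
degree two, and therefore splits. -/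
def SplitNode (v : Valuation F Γ₀) (W : WeierstrassCurve F) : Prop :=
  ∃ a, v a ≤ 1 ∧
    v (W.c₄ * a ^ 2 + W.a₁ * W.c₄ * a - (54 * W.b₆ - 3 * W.b₂ * W.b₄ + W.a₂ * W.c₄)) < 1

theorem IntegralChange.splitNode_of_smul {C : VariableChange F} (hC : IntegralChange v C)
    (h : SplitNode v (C • W)) : SplitNode v W := by
  obtain ⟨a, ha, h⟩ := h
  -- slopes are transformed by `a ↦ u a + s`
  refine ⟨C.u * a + C.s, v.map_add_le (map_mul_le_one hC.u.le ha) hC.s, ?_⟩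
  obtain ⟨u, hu⟩ : ∃ u : F, u = C.u := ⟨_, rfl⟩
  have hu0 : u ≠ 0 := by rw [hu]; exact C.u.ne_zero
  have hui : ((C.u⁻¹ : Fˣ) : F) = u⁻¹ := by simp [hu]
  have e : W.c₄ * (C.u * a + C.s) ^ 2 + W.a₁ * W.c₄ * (C.u * a + C.s) -
      (54 * W.b₆ - 3 * W.b₂ * W.b₄ + W.a₂ * W.c₄) = u ^ 6 * ((C • W).c₄ * a ^ 2 +
        (C • W).a₁ * (C • W).c₄ * a -
        (54 * (C • W).b₆ - 3 * (C • W).b₂ * (C • W).b₄ + (C • W).a₂ * (C • W).c₄)) := by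
    rw [variableChange_c₄, variableChange_b₂, variableChange_b₄, variableChange_b₆,
      variableChange_a₁, variableChange_a₂, hui, ← hu, c₄]
    field_simp
    ring
  rw [e, map_mul, map_pow, hu, hC.u, one_pow, one_mul]
  exact h

theorem IntegralChange.splitNode_smul_iff {C : VariableChange F} (hC : IntegralChange v C) :
    SplitNode v (C • W) ↔ SplitNode v W :=
  ⟨hC.splitNode_of_smul, fun h ↦ hC.inv.splitNode_of_smul (by rwa [inv_smul_smul])⟩

theorem IntegralChange.val_Δ_smul {C : VariableChange F} (hC : IntegralChange v C) :
    v (C • W).Δ = v W.Δ := by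
  rw [variableChange_Δ, map_mul, map_pow, show v (C.u⁻¹ : Fˣ) = 1 from hC.inv.u, one_pow, one_mul]

theorem IntegralChange.val_c₄_smul {C : VariableChange F} (hC : IntegralChange v C) :
    v (C • W).c₄ = v W.c₄ := by
  rw [variableChange_c₄, map_mul, map_pow, show v (C.u⁻¹ : Fˣ) = 1 from hC.inv.u, one_pow, one_mul]

variable {R : Type*} [CommRing R] [IsDomain R] [IsDiscreteValuationRing R] [Algebra R F]
  [IsFractionRing R F]

theorem valuation_lt_one_iff (hv : v.Integers R) {x : F} (hx : v x ≤ 1) :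
    (IsDiscreteValuationRing.maximalIdeal R).valuation F x < 1 ↔ v x < 1 := by
  obtain ⟨a, rfl⟩ := hv.exists_of_le_one hx
  rw [← residue_eq_zero_iff_val hv, ← residue_eq_zero_iff_val (integers_valuation R F)]

theorem valuation_eq_one_iff (hv : v.Integers R) {x : F} (hx : v x ≤ 1) :
    (IsDiscreteValuationRing.maximalIdeal R).valuation F x = 1 ↔ v x = 1 := by
  have hx' : (IsDiscreteValuationRing.maximalIdeal R).valuation F x ≤ 1 :=
    (le_one_iff_exists (integers_valuation R F)).mpr (hv.exists_of_le_one hx)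
  have := valuation_lt_one_iff hv hx
  rw [hx'.lt_iff_ne, hx.lt_iff_ne] at this
  exact not_iff_not.mp this

variable [W.IsElliptic]

theorem hasGoodReduction_iff_val (hv : v.Integers R) :
    HasGoodReduction R W ↔ MinimalCurve v W ∧ v W.Δ = 1 := by
  rw [hasGoodReduction_iff, isMinimal_iff_minimalCurve hv]
  exact and_congr_right fun h ↦
    valuation_eq_one_iff hv h.integral.invariants_le.2.2.2.2.2

theorem hasMultiplicativeReduction_iff_val (hv : v.Integers R) :
    HasMultiplicativeReduction R W ↔ MinimalCurve v W ∧ v W.Δ < 1 ∧ v W.c₄ = 1 := by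
  rw [hasMultiplicativeReduction_iff, isMinimal_iff_minimalCurve hv]
  exact and_congr_right fun h ↦
    and_congr (valuation_lt_one_iff hv h.integral.invariants_le.2.2.2.2.2)
      (valuation_eq_one_iff hv h.integral.invariants_le.2.2.2.2.1)

theorem hasAdditiveReduction_iff_val (hv : v.Integers R) :
    HasAdditiveReduction R W ↔ MinimalCurve v W ∧ v W.Δ < 1 ∧ v W.c₄ < 1 := by
  rw [hasAdditiveReduction_iff, isMinimal_iff_minimalCurve hv]
  exact and_congr_right fun h ↦
    and_congr (valuation_lt_one_iff hv h.integral.invariants_le.2.2.2.2.2)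
      (valuation_lt_one_iff hv h.integral.invariants_le.2.2.2.2.1)

open Polynomial in
theorem splits_quadratic_iff {k : Type*} [Field k] {a b c : k} (ha : a ≠ 0) :
    (Polynomial.C a * X ^ 2 + Polynomial.C b * X - Polynomial.C c).Splits ↔
      ∃ x, a * x ^ 2 + b * x - c = 0 := by
  have hd : (Polynomial.C a * X ^ 2 + Polynomial.C b * X - Polynomial.C c).degree = 2 := by
    rw [sub_eq_add_neg, ← Polynomial.C_neg]
    exact degree_quadratic ha
  refine ⟨fun h ↦ ?_, fun ⟨x, hx⟩ ↦ Splits.of_degree_eq_two (x := x) hd (by simpa using hx)⟩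
  obtain ⟨x, hx⟩ := h.exists_eval_eq_zero (by rw [hd]; decide)
  exact ⟨x, by simpa using hx⟩

open Polynomial in
theorem hasSplitMultiplicativeReduction_iff_val (hv : v.Integers R) :
    HasSplitMultiplicativeReduction R W ↔
      MinimalCurve v W ∧ v W.Δ < 1 ∧ v W.c₄ = 1 ∧ SplitNode v W := by
  rw [hasSplitMultiplicativeReduction_iff]
  have key (h : HasMultiplicativeReduction R W) : ((Polynomial.C (W.integralModel R).c₄ * X ^ 2 +
      Polynomial.C ((W.integralModel R).a₁ * (W.integralModel R).c₄) * X -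
      Polynomial.C (54 * (W.integralModel R).b₆ -
        3 * (W.integralModel R).b₂ * (W.integralModel R).b₄ +
        (W.integralModel R).a₂ * (W.integralModel R).c₄)).map
      (algebraMap R (IsLocalRing.ResidueField R))).Splits ↔ SplitNode v W := by
    have hc := ((hasMultiplicativeReduction_iff_val hv).mp h).2.2
    rw [← integralModel_c₄_eq R W] at hc
    have hc' : IsLocalRing.residue R (W.integralModel R).c₄ ≠ 0 := fun h ↦
      ((residue_eq_zero_iff_val hv).mp h).ne hc
    simp only [Polynomial.map_sub, Polynomial.map_add, Polynomial.map_mul, Polynomial.map_pow,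
      map_X, map_C, IsLocalRing.ResidueField.algebraMap_eq]
    rw [splits_quadratic_iff hc', SplitNode]
    have e (a : R) : IsLocalRing.residue R (W.integralModel R).c₄ * IsLocalRing.residue R a ^ 2 +
        IsLocalRing.residue R ((W.integralModel R).a₁ * (W.integralModel R).c₄) *
          IsLocalRing.residue R a - IsLocalRing.residue R (54 * (W.integralModel R).b₆ -
          3 * (W.integralModel R).b₂ * (W.integralModel R).b₄ +
          (W.integralModel R).a₂ * (W.integralModel R).c₄) = 0 ↔
        v (W.c₄ * algebraMap R F a ^ 2 + W.a₁ * W.c₄ * algebraMap R F a -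
          (54 * W.b₆ - 3 * W.b₂ * W.b₄ + W.a₂ * W.c₄)) < 1 := by
      rw [← map_pow, ← map_mul, ← map_mul, ← map_add, ← map_sub, residue_eq_zero_iff_val hv]
      simp only [map_sub, map_add, map_mul, map_pow, map_ofNat, integralModel_a₁_eq,
        integralModel_a₂_eq, integralModel_b₂_eq, integralModel_b₄_eq, integralModel_b₆_eq,
        integralModel_c₄_eq]
    constructor
    · rintro ⟨x, hx⟩
      obtain ⟨a, rfl⟩ := IsLocalRing.residue_surjective x
      exact ⟨algebraMap R F a, hv.map_le_one a, (e a).mp hx⟩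
    · rintro ⟨x, hx, h⟩
      obtain ⟨a, rfl⟩ := hv.exists_of_le_one hx
      exact ⟨_, (e a).mpr h⟩
  rw [exists_prop_congr key Iff.rfl, exists_prop, hasMultiplicativeReduction_iff_val hv, and_assoc,
    and_assoc]

variable {E : WeierstrassCurve F}

/-- The reduction type does not depend on the choice of the minimal equation. -/
theorem MinimalCurve.invariants_eq {C D : VariableChange F} (hC : MinimalCurve v (C • E))
    (hD : MinimalCurve v (D • E)) :
    v (D • E).Δ = v (C • E).Δ ∧ v (D • E).c₄ = v (C • E).c₄ ∧
      (SplitNode v (D • E) ↔ SplitNode v (C • E)) := by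
  have e : (D * C⁻¹) • (C • E) = D • E := by rw [mul_smul, inv_smul_smul]
  have h := hC.integralChange (C := D * C⁻¹) (by rwa [e])
  rw [← e]
  exact ⟨h.val_Δ_smul, h.val_c₄_smul, h.splitNode_smul_iff⟩

end ReductionType

/-! ### Split reduction on a single minimal equation -/

section Split

variable {O K Kbar : Type*} [CommRing O] [IsDomain O] [Field K] [Algebra O K] [IsFractionRing O K]
  [Field Kbar] [Algebra K Kbar] [Algebra O Kbar] [IsScalarTower O K Kbar]
  {Γ₀ : Type*} [LinearOrderedCommGroupWithZero Γ₀]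

/-- Split reduction can be read off from any minimal equation, with respect to any valuation whose
valuation ring is the ring of integers. -/
theorem hasSplitReduction_iff {E : WeierstrassCurve K} [E.IsElliptic] {L : IntermediateField K Kbar}
    (hL : IsFiniteUnramified O K L) {v : Valuation L Γ₀} (hv : v.Integers (integralClosure O L))
    {C : VariableChange L} (hmin : MinimalCurve v (C • E.baseChange L)) :
    HasSplitReduction E L hL ↔ v (C • E.baseChange L).Δ = 1 ∨
      (v (C • E.baseChange L).Δ < 1 ∧ v (C • E.baseChange L).c₄ = 1 ∧
        SplitNode v (C • E.baseChange L)) ∨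
      (v (C • E.baseChange L).Δ < 1 ∧ v (C • E.baseChange L).c₄ < 1 ∧
        GaloisActsTriviallyOnComponents O E L) := by
  have := hL.isDiscreteValuationRing
  have := hL.isFractionRing
  have : (E.baseChange L).IsElliptic := inferInstanceAs (E.map (algebraMap K L)).IsElliptic
  unfold HasSplitReduction
  simp only [hasGoodReduction_iff_val hv, hasSplitMultiplicativeReduction_iff_val hv,
    hasAdditiveReduction_iff_val hv]
  refine or_congr ⟨fun ⟨D, h⟩ ↦ ?_, fun h ↦ ⟨C, hmin, h⟩⟩
    (or_congr ⟨fun ⟨D, h⟩ ↦ ?_, fun h ↦ ⟨C, hmin, h⟩⟩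
    ⟨fun ⟨⟨D, h⟩, h'⟩ ↦ ?_, fun h ↦ ⟨⟨C, hmin, h.1, h.2.1⟩, h.2.2⟩⟩)
  · exact (hmin.invariants_eq h.1).1 ▸ h.2
  · obtain ⟨h1, h2, h3⟩ := hmin.invariants_eq h.1
    rw [h1, h2, h3] at h
    exact h.2
  · obtain ⟨h1, h2, h3⟩ := hmin.invariants_eq h.1
    rw [h1, h2] at h
    exact ⟨h.2.1, h.2.2, h'⟩

end Split

/-! ### Conjugate intermediate fields -/

section Conj

variable {O K M M' : Type*} [CommRing O] [IsDomain O] [Field K] [Algebra O K] [IsFractionRing O K]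
  [Field M] [Algebra K M] [Algebra O M] [IsScalarTower O K M]
  [Field M'] [Algebra K M'] [Algebra O M'] [IsScalarTower O K M']
  {E : WeierstrassCurve K} [E.IsElliptic]

open scoped Classical in
/-- An automorphism `τ` of `M'` acts trivially on the class of `P` in the component group if its
conjugate by `e : M' ≃ M` acts trivially on the class of `e(P)`. -/
theorem IsFiniteUnramified.map_sub_mem_E0_of_conj (hM : IsFiniteUnramified O K M)
    (hM' : IsFiniteUnramified O K M') (e : M' ≃ₐ[K] M) (τ : M' ≃ₐ[K] M')
    {P : (E.baseChange M').toAffine.Point}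
    (hP : Affine.Point.map (W' := E) ((e.symm.trans τ).trans e).toAlgHom
      (Affine.Point.map (W' := E) e.toAlgHom P) - Affine.Point.map (W' := E) e.toAlgHom P ∈
        hM.E0 E) :
    Affine.Point.map (W' := E) τ.toAlgHom P - P ∈ hM'.E0 E := by
  have e1 : (e.symm.toAlgHom.comp ((e.symm.trans τ).trans e).toAlgHom).comp e.toAlgHom =
      τ.toAlgHom := by
    ext x; simp
  have e2 : e.symm.toAlgHom.comp e.toAlgHom = AlgHom.id K M' := by ext x; simp
  have e3 := AddMonoidHom.map_sub (Affine.Point.map (W' := E) e.symm.toAlgHom)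
    (Affine.Point.map (W' := E) ((e.symm.trans τ).trans e).toAlgHom
    (Affine.Point.map (W' := E) e.toAlgHom P)) (Affine.Point.map (W' := E) e.toAlgHom P)
  have e4 : Affine.Point.map (W' := E) e.symm.toAlgHom (Affine.Point.map (W' := E) e.toAlgHom P) =
      P := by
    rw [Affine.Point.map_map, e2]
    exact Affine.Point.map_id P
  have e5 : Affine.Point.map (W' := E) e.symm.toAlgHom (Affine.Point.map (W' := E)
      ((e.symm.trans τ).trans e).toAlgHom (Affine.Point.map (W' := E) e.toAlgHom P)) =
      Affine.Point.map (W' := E) τ.toAlgHom P := by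
    rw [Affine.Point.map_map, Affine.Point.map_map, e1]
  rw [e4, e5] at e3
  exact (congrArg (· ∈ hM'.E0 E) e3).mp (hM.map_mem_E0 hM' e.symm hP)

end Conj

section Conjugate

variable {O K Kbar : Type*} [CommRing O] [IsDomain O] [IsDiscreteValuationRing O]
  [HenselianLocalRing O] [PerfectField (IsLocalRing.ResidueField O)]
  [Field K] [Algebra O K] [IsFractionRing O K]
  [Field Kbar] [Algebra K Kbar] [Algebra O Kbar] [IsScalarTower O K Kbar]
  {E : WeierstrassCurve K} {L : IntermediateField K Kbar}

open scoped Classical in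
theorem GaloisActsTriviallyOnComponents.map [E.IsElliptic]
    (h : GaloisActsTriviallyOnComponents O E L) (σ : Kbar ≃ₐ[K] Kbar) :
    GaloisActsTriviallyOnComponents O E (L.map (σ : Kbar →ₐ[K] Kbar)) := by
  intro M' hM' hLM τ' hτ' P'
  -- apply the hypothesis to the extension `σ⁻¹ M'` of `L` and to the conjugate of `τ'` by `σ⁻¹`
  set e := M'.equivMap (σ.symm : Kbar →ₐ[K] Kbar)
  have hM := hM'.of_algHom e.symm.toAlgHom
  have hL : L ≤ M'.map (σ.symm : Kbar →ₐ[K] Kbar) := fun x hx ↦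
    ⟨σ x, hLM ⟨x, hx, rfl⟩, σ.symm_apply_apply x⟩
  have hes : ∀ x, (e.symm x : Kbar) = σ x := fun x ↦ by
    obtain ⟨y, rfl⟩ := e.surjective x
    rw [e.symm_apply_apply]
    exact (σ.apply_symm_apply (y : Kbar)).symm
  have key := h _ hM hL ((e.symm.trans τ').trans e) (fun x hx ↦ by
    rw [AlgEquiv.trans_apply, AlgEquiv.trans_apply, hτ' _ (by rw [hes]; exact ⟨x, hx, rfl⟩),
      e.apply_symm_apply]) (Affine.Point.map (W' := E) e.toAlgHom P')
  have := hM.map_sub_mem_E0_of_conj hM' e τ' (P := P') (by convert key)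
  convert this

theorem HasSplitReduction.map [E.IsElliptic] {hL : IsFiniteUnramified O K L}
    (h : HasSplitReduction E L hL) (σ : Kbar ≃ₐ[K] Kbar)
    (hL' : IsFiniteUnramified O K (L.map (σ : Kbar →ₐ[K] Kbar))) :
    HasSplitReduction E (L.map (σ : Kbar →ₐ[K] Kbar)) hL' := by
  have := hL.isDiscreteValuationRing
  have := hL.isFractionRing
  have : (E.baseChange L).IsElliptic := inferInstanceAs (E.map (algebraMap K L)).IsElliptic
  have hv := integers_valuation (integralClosure O L) L
  set v := (IsDiscreteValuationRing.maximalIdeal (integralClosure O L)).valuation L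
  obtain ⟨C, hC⟩ := exists_isMinimal (integralClosure O L) (E.baseChange L)
  rw [isMinimal_iff_minimalCurve hv] at hC
  set e := L.equivMap (σ : Kbar →ₐ[K] Kbar)
  have hv' := integers_comap_algHom (K := K) hv e.symm.toAlgHom
  have hC' := hC.map_algEquiv e
  rw [hasSplitReduction_iff hL hv hC] at h
  have he := smul_baseChange_map_algEquiv E C e
  rw [← he] at hC'
  rw [hasSplitReduction_iff hL' hv' hC', he]
  set W := C • E.baseChange L
  have hΔ : (W.map (e : L →+* _)).Δ = e W.Δ := W.map_Δ _
  have hc : (W.map (e : L →+* _)).c₄ = e W.c₄ := W.map_c₄ _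
  rw [hΔ, hc, comap_symm_apply, comap_symm_apply]
  refine h.imp_right (Or.imp (fun ⟨h1, h2, a, ha, h3⟩ ↦ ⟨h1, h2, e a, ?_, ?_⟩)
    fun ⟨h1, h2, h3⟩ ↦ ⟨h1, h2, h3.map σ⟩)
  · rwa [comap_symm_apply]
  · convert h3 using 1
    rw [← comap_symm_apply (v := v) e]
    congr 1
    simp [map_ofNat e]

/-- The smallest finite unramified extension over which `E` has split reduction is contained in
each of its conjugates, hence normal. -/
theorem IsSmallestSplitting.isGalois [IsAlgClosure K Kbar] [E.IsElliptic]
    (h : IsSmallestSplitting O E L) : IsGalois K L := by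
  obtain ⟨⟨hL, hs⟩, hmin⟩ := h
  have := hL.isSeparable
  have := (IsAlgClosure.isAlgClosed K : IsAlgClosed Kbar)
  have := (IsAlgClosure.isAlgebraic : Algebra.IsAlgebraic K Kbar)
  have : Normal K L := by
    refine IntermediateField.normal_iff_forall_map_le'.mpr fun σ ↦ ?_
    have hL' : IsFiniteUnramified O K (L.map (σ.symm : Kbar →ₐ[K] Kbar)) :=
      hL.of_algHom ((L.equivMap (σ.symm : Kbar →ₐ[K] Kbar)).symm : _ →ₐ[K] L)
    rintro x ⟨y, hy, rfl⟩
    obtain ⟨z, hz, rfl⟩ := hmin ⟨hL', hs.map σ.symm hL'⟩ hy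
    have : σ (σ.symm z) = z := σ.apply_symm_apply z
    exact this.symm ▸ hz
  exact ⟨⟩

end Conjugate

/-! ### Singular Weierstrass equations over a perfect field -/

section Singular

variable {k : Type*} [Field k] {W : WeierstrassCurve k}

theorem exists_pow_eq_of_perfectField [PerfectField k] {p : ℕ} (hp : p.Prime) (h : (p : k) = 0)
    (x : k) : ∃ y, y ^ p = x := by
  have : Fact p.Prime := ⟨hp⟩
  have : CharP k p := by
    obtain ⟨q, hq⟩ := CharP.exists k
    have hqp := (CharP.cast_eq_zero_iff k q p).mp h
    rcases (Nat.dvd_prime hp).mp hqp with rfl | rfl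
    · exact absurd rfl (CharP.char_ne_one k 1)
    · exact hq
  exact surjective_frobenius k p x

/-- The vanishing of the discriminant makes the right-hand side of `(2y + a₁x + a₃)² = 4x³ + …` have
a multiple root. -/
theorem exists_double_root [PerfectField k] (hΔ : W.Δ = 0) (h2 : (2 : k) ≠ 0) :
    ∃ r : k, 4 * r ^ 3 + W.b₂ * r ^ 2 + 2 * W.b₄ * r + W.b₆ = 0 ∧
      6 * r ^ 2 + W.b₂ * r + W.b₄ = 0 := by
  have h8 := W.b_relation
  by_cases hc : W.c₄ = 0
  -- here the cubic polynomial has a triple root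
  · by_cases h3 : (3 : k) = 0
    · have hb2 : W.b₂ = 0 := by
        rw [c₄] at hc
        exact pow_eq_zero_iff two_ne_zero |>.mp (by linear_combination hc + 8 * W.b₄ * h3)
      have hb4 : W.b₄ = 0 := by
        rw [Δ, hb2] at hΔ
        have : (2 * W.b₄) ^ 3 = 0 := by linear_combination -hΔ - 9 * W.b₆ ^ 2 * h3
        exact (mul_eq_zero.mp (pow_eq_zero_iff three_ne_zero |>.mp this)).resolve_left h2
      obtain ⟨r, hr⟩ := exists_pow_eq_of_perfectField Nat.prime_three (by exact_mod_cast h3) (-W.b₆)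
      exact ⟨r, by rw [hb2, hb4]; linear_combination hr + r ^ 3 * h3,
        by rw [hb2, hb4]; linear_combination 2 * r ^ 2 * h3⟩
    · have h12 : (12 : k) ≠ 0 := by
        have : (12 : k) = 2 * 2 * 3 := by norm_num
        rw [this]; exact mul_ne_zero (mul_ne_zero h2 h2) h3
      have hc6 : W.c₆ = 0 := by
        have := W.c_relation
        rw [hΔ, hc] at this
        exact pow_eq_zero_iff two_ne_zero |>.mp (by linear_combination this)
      obtain ⟨r, hr⟩ : ∃ r, 12 * r = -W.b₂ := ⟨-W.b₂ / 12, mul_div_cancel₀ _ h12⟩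
      have h24 : (24 : k) ≠ 0 := by
        have : (24 : k) = 2 * 12 := by norm_num
        rw [this]; exact mul_ne_zero h2 h12
      have h216 : (216 : k) ≠ 0 := by
        have : (216 : k) = 24 * (3 * 3) := by norm_num
        rw [this]; exact mul_ne_zero h24 (mul_ne_zero h3 h3)
      rw [c₄] at hc
      rw [c₆] at hc6
      have hb2 : W.b₂ = -(12 * r) := by rw [hr, neg_neg]
      rw [hb2] at hc hc6 ⊢
      refine ⟨r, mul_left_cancel₀ h216 ?_, mul_left_cancel₀ h24 ?_⟩
      · linear_combination -hc6
      · linear_combination -hc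
  -- a double root that is not triple is rational in the coefficients
  · refine ⟨(18 * W.b₆ - W.b₂ * W.b₄) / W.c₄, ?_, ?_⟩
    · field_simp
      rw [Δ] at hΔ
      rw [c₄]
      linear_combination (-864 * W.b₆ + 144 * W.b₂ * W.b₄ - 4 * W.b₂ ^ 3) * hΔ +
        (-216 * W.b₆ + 36 * W.b₂ * W.b₄ - W.b₂ ^ 3) * W.b₂ ^ 2 * h8
    · field_simp
      rw [Δ] at hΔ
      rw [c₄]
      linear_combination -72 * hΔ - 18 * W.b₂ ^ 2 * h8

/-- If the discriminant vanishes, the curve has a singular point over `k`: the equation and its two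
partial derivatives have a common zero. -/
theorem exists_singular_point [PerfectField k] (hΔ : W.Δ = 0) :
    ∃ r t : k, t ^ 2 + W.a₁ * r * t + W.a₃ * t = r ^ 3 + W.a₂ * r ^ 2 + W.a₄ * r + W.a₆ ∧
      W.a₁ * t = 3 * r ^ 2 + 2 * W.a₂ * r + W.a₄ ∧ 2 * t + W.a₁ * r + W.a₃ = 0 := by
  by_cases h2 : (2 : k) = 0
  · rw [Δ, b₂, b₄, b₆, b₈] at hΔ
    by_cases h1 : W.a₁ = 0
    · have h3 : W.a₃ = 0 := by
        rw [h1] at hΔ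
        exact pow_eq_zero_iff four_ne_zero |>.mp (by grind)
      obtain ⟨r, hr⟩ := exists_pow_eq_of_perfectField Nat.prime_two (by exact_mod_cast h2) W.a₄
      obtain ⟨t, ht⟩ := exists_pow_eq_of_perfectField Nat.prime_two (by exact_mod_cast h2)
        (r ^ 3 + W.a₂ * r ^ 2 + W.a₄ * r + W.a₆)
      refine ⟨r, t, ?_, ?_, ?_⟩
      · rw [h1, h3, ht]; ring
      · rw [h1]; linear_combination -hr - (r ^ 2 + W.a₂ * r + W.a₄) * h2
      · rw [h1, h3]; linear_combination t * h2
    -- both coordinates of a node in characteristic two are given by the partial derivatives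
    · obtain ⟨r, hr⟩ : ∃ r, W.a₁ * r = W.a₃ := ⟨W.a₃ / W.a₁, mul_div_cancel₀ _ h1⟩
      obtain ⟨t, ht⟩ : ∃ t, W.a₁ * t = r ^ 2 + W.a₄ := ⟨_, mul_div_cancel₀ _ h1⟩
      rw [← hr] at hΔ ⊢
      have h4 : W.a₄ = W.a₁ * t - r ^ 2 := by rw [ht]; ring
      rw [h4] at hΔ ⊢
      refine ⟨r, t, ?_, ?_, ?_⟩
      · refine mul_left_cancel₀ (pow_ne_zero 6 h1) ?_
        grind
      · linear_combination (-r ^ 2 - W.a₂ * r) * h2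
      · linear_combination (t + W.a₁ * r) * h2
  · obtain ⟨r, h, h'⟩ := exists_double_root hΔ h2
    rw [b₂, b₄, b₆] at h
    rw [b₂, b₄] at h'
    obtain ⟨t, ht⟩ : ∃ t, 2 * t = -(W.a₁ * r + W.a₃) := ⟨_, mul_div_cancel₀ _ h2⟩
    refine ⟨r, t, ?_, ?_, ?_⟩
    · refine mul_left_cancel₀ (mul_ne_zero h2 h2) ?_
      linear_combination (2 * t + W.a₁ * r + W.a₃) * ht - h
    · refine mul_left_cancel₀ h2 ?_
      linear_combination W.a₁ * ht - h'
    · linear_combination ht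

/-- A singular Weierstrass equation over a perfect field can be moved so that the singular point is
the origin. If the singular point is a cusp, the tangent line can be moved to `y = 0` as well. -/
theorem exists_variableChange_of_Δ_eq_zero [PerfectField k] (hΔ : W.Δ = 0) :
    ∃ r s t : k, ((⟨1, r, s, t⟩ : VariableChange k) • W).a₃ = 0 ∧
      ((⟨1, r, s, t⟩ : VariableChange k) • W).a₄ = 0 ∧
      ((⟨1, r, s, t⟩ : VariableChange k) • W).a₆ = 0 ∧
      (W.c₄ = 0 → ((⟨1, r, s, t⟩ : VariableChange k) • W).a₁ = 0 ∧
        ((⟨1, r, s, t⟩ : VariableChange k) • W).a₂ = 0) := by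
  obtain ⟨r, t, h, h', h''⟩ := exists_singular_point hΔ
  -- `s` is the slope of the tangent line at the cusp
  have key : ∃ s, W.c₄ = 0 → W.a₁ + 2 * s = 0 ∧ W.a₂ - s * W.a₁ + 3 * r - s ^ 2 = 0 := by
    by_cases hc : W.c₄ = 0
    · have hb : W.b₂ + 12 * r = 0 := by
        refine pow_eq_zero_iff two_ne_zero |>.mp ?_
        rw [c₄] at hc
        rw [b₂, b₄] at hc
        rw [b₂]
        linear_combination hc + 24 * W.a₁ * h'' - 48 * h'
      rw [b₂] at hb
      by_cases h2 : (2 : k) = 0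
      · obtain ⟨s, hs⟩ := exists_pow_eq_of_perfectField Nat.prime_two (by exact_mod_cast h2)
          (W.a₂ + 3 * r)
        have h1 : W.a₁ = 0 := pow_eq_zero_iff two_ne_zero |>.mp (by
          linear_combination hb - (2 * W.a₂ + 6 * r) * h2)
        refine ⟨s, fun _ ↦ ⟨by rw [h1]; linear_combination s * h2, ?_⟩⟩
        rw [h1]; linear_combination -hs
      · obtain ⟨s, hs⟩ : ∃ s, 2 * s = -W.a₁ := ⟨_, mul_div_cancel₀ _ h2⟩
        refine ⟨s, fun _ ↦ ⟨by rw [hs]; ring, mul_left_cancel₀ (mul_ne_zero h2 h2) ?_⟩⟩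
        linear_combination hb - (2 * s + W.a₁) * hs
    · exact ⟨0, fun h ↦ absurd h hc⟩
  obtain ⟨s, hs⟩ := key
  refine ⟨r, s, t, ?_, ?_, ?_, fun hc ↦ ?_⟩ <;>
    simp only [variableChange_def, inv_one, Units.val_one, one_pow, one_mul]
  · linear_combination h''
  · linear_combination -h' - s * h''
  · linear_combination -h
  · exact hs hc

end Singular

/-! ### Moving the singular point of the reduction to the origin -/

section MoveSingularPoint

variable {R F Γ₀ : Type*} [CommRing R] [IsDomain R] [IsDiscreteValuationRing R] [Field F]
  [Algebra R F] [LinearOrderedCommGroupWithZero Γ₀] {v : Valuation F Γ₀} {W : WeierstrassCurve F}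

/-- If the reduction of `W` is singular and the residue field is perfect, an integral change of
variables moves the singular point to the origin, and also the tangent line to `y = 0` if the point is
a cusp. -/
theorem IntegralCurve.exists_singularAtOrigin [PerfectField (IsLocalRing.ResidueField R)]
    (hv : v.Integers R) (hW : IntegralCurve v W) (hΔ : v W.Δ < 1) :
    ∃ C : VariableChange F, IntegralChange v C ∧ SingularAtOrigin v (C • W) ∧
      (v W.c₄ < 1 → CuspAtOrigin v (C • W)) := by
  obtain ⟨W₀, rfl⟩ := ((isIntegral_iff hv).mpr hW).integral
  have hΔ₀ : (W₀.map (IsLocalRing.residue R)).Δ = 0 := by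
    rw [map_Δ, residue_eq_zero_iff_val hv, ← map_Δ]; exact hΔ
  obtain ⟨r, s, t, h3, h4, h6, h⟩ := exists_variableChange_of_Δ_eq_zero hΔ₀
  obtain ⟨r, rfl⟩ := IsLocalRing.residue_surjective r
  obtain ⟨s, rfl⟩ := IsLocalRing.residue_surjective s
  obtain ⟨t, rfl⟩ := IsLocalRing.residue_surjective t
  obtain ⟨C, hC⟩ : ∃ C : VariableChange R, C = ⟨1, r, s, t⟩ := ⟨_, rfl⟩
  have hCr : (⟨1, IsLocalRing.residue R r, IsLocalRing.residue R s, IsLocalRing.residue R t⟩ :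
      VariableChange (IsLocalRing.ResidueField R)) = C.map (IsLocalRing.residue R) := by
    rw [hC]; ext <;> simp [VariableChange.map]
  rw [hCr, map_variableChange] at h3 h4 h6 h
  have hCi : IntegralChange v (C.map (algebraMap R F)) := by
    rw [hC]
    exact ⟨by simp [VariableChange.map], hv.map_le_one _, hv.map_le_one _, hv.map_le_one _⟩
  have e : C.map (algebraMap R F) • W₀.baseChange F = (C • W₀).map (algebraMap R F) :=
    map_variableChange W₀ C (algebraMap R F)
  have key {a : R} (ha : IsLocalRing.residue R a = 0) : v (algebraMap R F a) < 1 :=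
    (residue_eq_zero_iff_val hv).mp ha
  refine ⟨C.map (algebraMap R F), hCi, ?_, fun hc ↦ ?_⟩ <;> rw [e]
  · exact ⟨hv.map_le_one _, hv.map_le_one _, key h3, key h4, key h6⟩
  · have hc₀ : (W₀.map (IsLocalRing.residue R)).c₄ = 0 := by
      rw [map_c₄, residue_eq_zero_iff_val hv, ← map_c₄]; exact hc
    exact ⟨key (h hc₀).1, key (h hc₀).2, key h3, key h4, key h6⟩

end MoveSingularPoint

/-! ### The tangent lines at a node -/

section Node

variable {F Γ₀ : Type*} [Field F] [LinearOrderedCommGroupWithZero Γ₀] {v : Valuation F Γ₀}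
  {W : WeierstrassCurve F}

/-- At a node the discriminant `b₂` of `T² + a₁ T - a₂` is a unit. -/
theorem SingularAtOrigin.val_b₂_eq_one (hW : SingularAtOrigin v W) (hc : v W.c₄ = 1) :
    v W.b₂ = 1 := by
  have n2 : v (2 : F) ≤ 1 := map_ofNat_le_one 2
  have n24 : v (24 : F) ≤ 1 := map_ofNat_le_one 24
  have h4 : v W.b₄ < 1 := v.map_add_lt (map_mul_lt_one_right n2 hW.a₄)
    (map_mul_lt_one_right hW.a₁ hW.a₃)
  have h : v (W.b₂ ^ 2) = 1 := by
    have e : W.b₂ ^ 2 = W.c₄ + 24 * W.b₄ := by rw [c₄]; ring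
    rw [e, v.map_add_eq_of_lt_left, hc]
    rw [hc]; exact map_mul_lt_one_right n24 h4
  rw [map_pow] at h
  exact (pow_eq_one_iff_of_nonneg zero_le two_ne_zero).mp h

/-- For a node at the origin, the slopes of the tangent lines are the roots of `T² + a₁ T - a₂`. -/
theorem SingularAtOrigin.splitNode_iff (hW : SingularAtOrigin v W) (hc : v W.c₄ = 1) :
    SplitNode v W ↔ ∃ a, v a ≤ 1 ∧ v (a ^ 2 + W.a₁ * a - W.a₂) < 1 := by
  have n2 : v (2 : F) ≤ 1 := map_ofNat_le_one 2
  have n3 : v (3 : F) ≤ 1 := map_ofNat_le_one 3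
  have n4 : v (4 : F) ≤ 1 := map_ofNat_le_one 4
  have n54 : v (54 : F) ≤ 1 := map_ofNat_le_one 54
  have h2 : v W.b₂ ≤ 1 := (hW.val_b₂_eq_one hc).le
  have h4 : v W.b₄ < 1 := v.map_add_lt (map_mul_lt_one_right n2 hW.a₄)
    (map_mul_lt_one_right hW.a₁ hW.a₃)
  have h6 : v W.b₆ < 1 := v.map_add_lt (map_pow_lt_one hW.a₃ two_ne_zero)
    (map_mul_lt_one_right n4 hW.a₆)
  have hsmall : v (54 * W.b₆ - 3 * W.b₂ * W.b₄) < 1 :=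
    v.map_sub_lt (map_mul_lt_one_right n54 h6) (map_mul_lt_one_right (map_mul_le_one n3 h2) h4)
  refine exists_congr fun a ↦ and_congr_right fun _ ↦ ?_
  have e : v (a ^ 2 + W.a₁ * a - W.a₂) = v (W.c₄ * (a ^ 2 + W.a₁ * a - W.a₂)) := by
    rw [map_mul, hc, one_mul]
  rw [e]
  constructor
  · intro h
    have e' : W.c₄ * (a ^ 2 + W.a₁ * a - W.a₂) = (W.c₄ * a ^ 2 + W.a₁ * W.c₄ * a -
        (54 * W.b₆ - 3 * W.b₂ * W.b₄ + W.a₂ * W.c₄)) + (54 * W.b₆ - 3 * W.b₂ * W.b₄) := by ring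
    rw [e']
    exact v.map_add_lt h hsmall
  · intro h
    have e' : W.c₄ * a ^ 2 + W.a₁ * W.c₄ * a - (54 * W.b₆ - 3 * W.b₂ * W.b₄ + W.a₂ * W.c₄) =
        W.c₄ * (a ^ 2 + W.a₁ * a - W.a₂) - (54 * W.b₆ - 3 * W.b₂ * W.b₄) := by ring
    rw [e']
    exact v.map_sub_lt h hsmall

theorem SingularAtOrigin.nodeSlopes (hW : SingularAtOrigin v W) (hc : v W.c₄ = 1) {α : F}
    (hα : v α ≤ 1) (h : α ^ 2 + W.a₁ * α - W.a₂ = 0) : NodeSlopes W v α (-W.a₁ - α) := by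
  refine ⟨by ring, by linear_combination -h, hα,
    v.map_sub_le (by rw [Valuation.map_neg]; exact hW.a₁) hα, ?_⟩
  have e : (α - (-W.a₁ - α)) ^ 2 = W.b₂ := by rw [b₂]; linear_combination 4 * h
  have := congrArg v e
  rw [hW.val_b₂_eq_one hc, map_pow] at this
  exact (pow_eq_one_iff_of_nonneg zero_le two_ne_zero).mp this

open Polynomial in
/-- The slopes of the tangent lines at a split node lift by Hensel's lemma. -/
theorem SingularAtOrigin.exists_slope {K : Type*} [Field K] [Algebra K F] [FiniteDimensional K F]
    (hv : IsHenselianUnramified K v) (hW : SingularAtOrigin v W) (hc : v W.c₄ = 1)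
    (h : SplitNode v W) : ∃ α, v α ≤ 1 ∧ α ^ 2 + W.a₁ * α - W.a₂ = 0 := by
  obtain ⟨a, ha, h⟩ := (hW.splitNode_iff hc).mp h
  have n4 : v (4 : F) ≤ 1 := map_ofNat_le_one 4
  obtain ⟨α, hα, hαa⟩ := hv.hensel (X ^ 2 + Polynomial.C W.a₁ * X - Polynomial.C W.a₂) a
    (by monicity!) (Subring.sub_mem _ (Subring.add_mem _ (Subring.pow_mem _ X_mem_integralPolynomials 2)
      (Subring.mul_mem _ (C_mem_integralPolynomials hW.a₁) X_mem_integralPolynomials))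
      (C_mem_integralPolynomials hW.a₂)) ha (by simpa using h) (by
      have e : (2 * a + W.a₁) ^ 2 = W.b₂ + 4 * (a ^ 2 + W.a₁ * a - W.a₂) := by rw [b₂]; ring
      have := congrArg v e
      rw [v.map_add_eq_of_lt_left (by
        rw [hW.val_b₂_eq_one hc]; exact map_mul_lt_one_right n4 h), hW.val_b₂_eq_one hc,
        map_pow] at this
      have := (pow_eq_one_iff_of_nonneg zero_le two_ne_zero).mp this
      simpa [one_add_one_eq_two] using this)
  refine ⟨α, ?_, by simpa using hα⟩
  have e : α = (α - a) + a := by ring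
  rw [e]
  exact v.map_add_le hαa.le ha

end Node

/-! ### Nonsingular reduction over `K` and over a finite unramified extension -/

section Norm

variable {O K L Γ₀ : Type*} [CommRing O] [IsDomain O] [IsDiscreteValuationRing O]
  [HenselianLocalRing O] [Field K] [Algebra O K] [IsFractionRing O K] [Field L] [Algebra K L]
  [Algebra O L] [IsScalarTower O K L] [LinearOrderedCommGroupWithZero Γ₀] {v : Valuation L Γ₀}
  {E : WeierstrassCurve K} [E.IsElliptic] {C : VariableChange K}

theorem IsFiniteUnramified.minimalCurve_baseChange [IsGalois K L] (hL : IsFiniteUnramified O K L)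
    (hv : v.Integers (integralClosure O L)) {W : WeierstrassCurve K}
    (hW : MinimalCurve (v.comap (algebraMap K L)) W) : MinimalCurve v (W.baseChange L) :=
  have := hL.finiteDimensional
  (hL.isHenselianUnramified hv).minimalCurve_baseChange hW

open scoped Classical in
/-- `E⁰(L)` can be computed on a minimal equation over `K`. -/
theorem IsFiniteUnramified.mem_E0_iff [IsGalois K L] (hL : IsFiniteUnramified O K L)
    (hv : v.Integers (integralClosure O L))
    (hmin : MinimalCurve (v.comap (algebraMap K L)) (C • E)) {Q : (E.baseChange L).toAffine.Point} :
    Q ∈ hL.E0 E ↔ baseChangeHom E C L Q ∈ smoothLocus v ((C • E).baseChange L) := by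
  have := hL.isDiscreteValuationRing
  have := hL.isFractionRing
  have : (E.baseChange L).IsElliptic := inferInstanceAs (E.map (algebraMap K L)).IsElliptic
  exact UnramifiedNorm.mem_E0_iff hv (smul_baseChange E C L) (hL.minimalCurve_baseChange hv hmin)

open scoped Classical in
/-- `E⁰(K)` consists of the points of `E(K)` that lie in `E⁰(L)`. -/
theorem IsFiniteUnramified.baseChange_mem_E0_iff [IsGalois K L] (hL : IsFiniteUnramified O K L)
    (hv : v.Integers (integralClosure O L))
    (hmin : MinimalCurve (v.comap (algebraMap K L)) (C • E))
    {P : (E.baseChange K).toAffine.Point} :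
    Affine.Point.baseChange (W' := E) K L P ∈ hL.E0 E ↔ P ∈ UnramifiedNorm.E0 O (E.baseChange K) := by
  have : (E.baseChange K).IsElliptic := inferInstanceAs (E.map (algebraMap K K)).IsElliptic
  have hmin' : MinimalCurve (v.comap (algebraMap K L)) ((C • E).baseChange K) := hmin
  rw [hL.mem_E0_iff hv hmin, UnramifiedNorm.mem_E0_iff (integers_comap (K := K) hv)
    (smul_baseChange E C K) hmin']
  change _ ↔ baseChangeHom E C K P ∈ _
  have h := map_baseChangeHom (W := E) (C := C) (Algebra.ofId K L) P
  have h' : baseChangeHom E C L (Affine.Point.baseChange (W' := E) K L P) =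
    Affine.Point.baseChange (W' := C • E) K L (baseChangeHom E C K P) := h.symm
  rw [h']
  rcases baseChangeHom E C K P with _ | ⟨x, y, hxy⟩
  · exact ⟨fun _ ↦ zero_mem_smoothLocus, fun _ ↦ zero_mem_smoothLocus⟩
  rw [some_mem_smoothLocus]
  change Affine.Point.some _ _ _ ∈ _ ↔ _
  rw [some_mem_smoothLocus]
  simp only [Valuation.comap_apply, map_sub, map_add, map_mul, map_pow, map_ofNat]
  rfl

variable [FiniteDimensional K L]

open scoped Classical in
/-- The statement about the norm map, in terms of the sum of the conjugates. -/
theorem mapsTo_and_surjOn_norm [IsGalois K L] (hL : IsFiniteUnramified O K L)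
    (hv : v.Integers (integralClosure O L))
    (hmin : MinimalCurve (v.comap (algebraMap K L)) (C • E))
    (h₁ : ∀ Q ∈ hL.E0 E, ∑ σ : L ≃ₐ[K] L, Affine.Point.map (W' := E) σ.toAlgHom Q ∈ hL.E0 E)
    (h₂ : ∀ P : (E.baseChange K).toAffine.Point, Affine.Point.baseChange (W' := E) K L P ∈ hL.E0 E →
      ∃ Q ∈ hL.E0 E, ∑ σ : L ≃ₐ[K] L, Affine.Point.map (W' := E) σ.toAlgHom Q =
        Affine.Point.baseChange (W' := E) K L P) :
    Set.MapsTo (norm E L) (hL.E0 E) (E0 O (E.baseChange K)) ∧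
      Set.SurjOn (norm E L) (hL.E0 E) (E0 O (E.baseChange K)) := by
  refine ⟨fun Q hQ ↦ ?_, fun P hP ↦ ?_⟩
  · rw [← hL.baseChange_mem_E0_iff hv hmin, baseChange_norm]
    exact h₁ Q hQ
  · rw [← hL.baseChange_mem_E0_iff hv hmin] at hP
    obtain ⟨Q, hQ, h⟩ := h₂ P hP
    refine ⟨Q, hQ, Affine.Point.map_injective (W' := E) (Algebra.ofId K L) ?_⟩
    exact (baseChange_norm E L Q).trans h

open scoped Classical in
theorem mapsTo_and_surjOn_norm_of_trivial [IsGalois K L] (hL : IsFiniteUnramified O K L)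
    (hv : v.Integers (integralClosure O L))
    (hmin : MinimalCurve (v.comap (algebraMap K L)) (C • E)) (h : ∀ σ : L ≃ₐ[K] L, σ = 1) :
    Set.MapsTo (norm E L) (hL.E0 E) (E0 O (E.baseChange K)) ∧
      Set.SurjOn (norm E L) (hL.E0 E) (E0 O (E.baseChange K)) := by
  have hu : (Finset.univ : Finset (L ≃ₐ[K] L)) = {1} :=
    Finset.eq_singleton_iff_unique_mem.mpr ⟨Finset.mem_univ _, fun σ _ ↦ h σ⟩
  have hsum (Q : (E.baseChange L).toAffine.Point) :
      ∑ σ : L ≃ₐ[K] L, Affine.Point.map (W' := E) σ.toAlgHom Q = Q := by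
    rw [hu, Finset.sum_singleton]
    exact Affine.Point.map_id Q
  refine mapsTo_and_surjOn_norm hL hv hmin (fun Q hQ ↦ ?_) fun P hP ↦ ⟨_, hP, hsum _⟩
  rwa [hsum]

open scoped Classical in
/-- The norm map when the singular point of the reduction of a minimal equation is the origin; it
suffices to find the points of given norm on that equation. -/
theorem mapsTo_and_surjOn_norm_of_singularAtOrigin [IsGalois K L] (hL : IsFiniteUnramified O K L)
    (hv : v.Integers (integralClosure O L))
    (hmin : MinimalCurve (v.comap (algebraMap K L)) (C • E))
    (hs : SingularAtOrigin v ((C • E).baseChange L))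
    (h : ∀ P : ((C • E).baseChange K).toAffine.Point,
      Affine.Point.baseChange (W' := C • E) K L P ∈ awayFromOrigin v ((C • E).baseChange L) →
      ∃ Q ∈ awayFromOrigin v ((C • E).baseChange L),
        ∑ σ : L ≃ₐ[K] L, Affine.Point.map (W' := C • E) σ.toAlgHom Q =
          Affine.Point.baseChange (W' := C • E) K L P) :
    Set.MapsTo (norm E L) (hL.E0 E) (E0 O (E.baseChange K)) ∧
      Set.SurjOn (norm E L) (hL.E0 E) (E0 O (E.baseChange K)) := by
  have key (Q : (E.baseChange L).toAffine.Point) : Q ∈ hL.E0 E ↔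
      baseChangeHom E C L Q ∈ awayFromOrigin v ((C • E).baseChange L) := by
    rw [hL.mem_E0_iff hv hmin, hs.smoothLocus_eq]
  refine mapsTo_and_surjOn_norm hL hv hmin (fun Q hQ ↦ ?_) fun P hP ↦ ?_
  · rw [key] at hQ ⊢
    rw [map_sum]
    refine AddSubgroup.sum_mem (awaySubgroup v _ hs) fun σ _ ↦ ?_
    rw [← map_baseChangeHom]
    exact map_mem_awayFromOrigin (hL.val_algEquiv hv) σ hQ
  · rw [key] at hP
    have e : Affine.Point.baseChange (W' := C • E) K L (baseChangeHom E C K P) =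
      baseChangeHom E C L (Affine.Point.baseChange (W' := E) K L P) :=
      map_baseChangeHom (W := E) (C := C) (Algebra.ofId K L) P
    obtain ⟨Q', hQ', h'⟩ := h (baseChangeHom E C K P) (by rwa [e])
    obtain ⟨Q, rfl⟩ := (baseChangeHom_bijective (W := E) (C := C)).2 Q'
    exact ⟨Q, (key Q).mpr hQ', sum_map_eq_of_baseChangeHom h'⟩

end Norm

/-! ### Split reduction over subextensions -/

section SmallestSplitting

variable {O K Kbar Γ₀ : Type*} [CommRing O] [IsDomain O] [IsDiscreteValuationRing O]
  [HenselianLocalRing O] [Field K] [Algebra O K] [IsFractionRing O K]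
  [Field Kbar] [Algebra K Kbar] [Algebra O Kbar] [IsScalarTower O K Kbar]
  [LinearOrderedCommGroupWithZero Γ₀] {E : WeierstrassCurve K} [E.IsElliptic]
  {C : VariableChange K} {L F : IntermediateField K Kbar} {v : Valuation L Γ₀}

/-- A minimal equation over `K` decides the reduction type over a Galois subextension `F` of `L`. -/
theorem hasSplitReduction_iff_of_le [IsGalois K F] (hF : IsFiniteUnramified O K F)
    (hv : v.Integers (integralClosure O L)) (hFL : F ≤ L)
    (hmin : MinimalCurve (v.comap (algebraMap K L)) (C • E)) :
    HasSplitReduction E F hF ↔ v.comap (algebraMap K L) (C • E).Δ = 1 ∨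
      (v.comap (algebraMap K L) (C • E).Δ < 1 ∧ v.comap (algebraMap K L) (C • E).c₄ = 1 ∧
        SplitNode (v.comap (IntermediateField.inclusion hFL : F →+* L))
          ((C • E).baseChange F)) ∨
      (v.comap (algebraMap K L) (C • E).Δ < 1 ∧ v.comap (algebraMap K L) (C • E).c₄ < 1 ∧
        GaloisActsTriviallyOnComponents O E F) := by
  have hvF := integers_comap_algHom (K := K) hv (IntermediateField.inclusion hFL)
  have hmin' := hF.minimalCurve_baseChange hvF (W := C • E) hmin
  rw [← smul_baseChange] at hmin'
  rw [hasSplitReduction_iff hF hvF hmin', smul_baseChange]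
  have hΔ : ((C • E).baseChange F).Δ = algebraMap K F (C • E).Δ := map_Δ _ _
  have hc : ((C • E).baseChange F).c₄ = algebraMap K F (C • E).c₄ := map_c₄ _ _
  rw [hΔ, hc]
  rfl

variable [PerfectField (IsLocalRing.ResidueField O)]

/-- If `E` acquires split reduction only over a nontrivial extension, its reduction is singular, and
the singular point can be moved to the origin over `K`. -/
theorem IsSmallestSplitting.exists_singularAtOrigin [IsGalois K L]
    (h : IsSmallestSplitting O E L) (hv : v.Integers (integralClosure O L)) (hL : L ≠ ⊥) :
    ∃ C : VariableChange K, MinimalCurve (v.comap (algebraMap K L)) (C • E) ∧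
      SingularAtOrigin (v.comap (algebraMap K L)) (C • E) ∧
      v.comap (algebraMap K L) (C • E).Δ < 1 ∧
      (v.comap (algebraMap K L) (C • E).c₄ < 1 →
        CuspAtOrigin (v.comap (algebraMap K L)) (C • E)) := by
  obtain ⟨⟨hLu, -⟩, hmin⟩ := h
  have hv₀ := integers_comap (K := K) hv
  obtain ⟨C, hC⟩ := exists_isMinimal O E
  rw [isMinimal_iff_minimalCurve hv₀] at hC
  have hbot : IsFiniteUnramified O K (⊥ : IntermediateField K Kbar) :=
    hLu.of_algHom (IntermediateField.inclusion bot_le)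
  have hΔ : v.comap (algebraMap K L) (C • E).Δ < 1 := by
    -- good reduction over `L` would imply good, hence split reduction over `K`
    refine lt_of_le_of_ne hC.integral.invariants_le.2.2.2.2.2 fun hΔ ↦ hL (le_bot_iff.mp ?_)
    exact hmin ⟨hbot, (hasSplitReduction_iff_of_le hbot hv bot_le hC).mpr (.inl hΔ)⟩
  obtain ⟨D, hD, hs, hc⟩ := hC.integral.exists_singularAtOrigin hv₀ hΔ
  refine ⟨D * C, ?_⟩
  rw [mul_smul, hD.val_Δ_smul, hD.val_c₄_smul]
  exact ⟨hC.smul hD, hs, hΔ, hc⟩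

/-- If the reduction has a node, `L` is generated by the slope of a tangent line at the node. -/
theorem IsSmallestSplitting.eq_adjoin_slope [IsAlgClosure K Kbar] [IsGalois K L]
    (h : IsSmallestSplitting O E L) (hv : v.Integers (integralClosure O L))
    (hC : MinimalCurve (v.comap (algebraMap K L)) (C • E))
    (hs : SingularAtOrigin (v.comap (algebraMap K L)) (C • E))
    (hΔ : v.comap (algebraMap K L) (C • E).Δ < 1) (hc : v.comap (algebraMap K L) (C • E).c₄ = 1)
    {α : L} (hα : v α ≤ 1)
    (hroot : α ^ 2 + algebraMap K L (C • E).a₁ * α - algebraMap K L (C • E).a₂ = 0) :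
    L = IntermediateField.adjoin K {(α : Kbar)} := by
  obtain ⟨⟨hLu, -⟩, hmin⟩ := h
  have hFL : IntermediateField.adjoin K {(α : Kbar)} ≤ L := by
    rw [IntermediateField.adjoin_le_iff, Set.singleton_subset_iff]
    exact α.2
  set F := IntermediateField.adjoin K {(α : Kbar)} with hFdef
  have hF : IsFiniteUnramified O K F := hLu.of_algHom (IntermediateField.inclusion hFL)
  have hαF : (α : Kbar) ∈ F := IntermediateField.mem_adjoin_simple_self K (α : Kbar)
  have hrootbar : (α : Kbar) ^ 2 + algebraMap K Kbar (C • E).a₁ * α -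
      algebraMap K Kbar (C • E).a₂ = 0 := congrArg Subtype.val hroot
  have := (IsAlgClosure.isAlgebraic : Algebra.IsAlgebraic K Kbar)
  have := (IsAlgClosure.isAlgClosed K : IsAlgClosed Kbar)
  -- a conjugate of `α` is `α` or the other slope `-a₁ - α`
  have : Normal K F := by
    refine IntermediateField.normal_iff_forall_map_le'.mpr fun σ ↦ ?_
    rw [hFdef, IntermediateField.adjoin_map, Set.image_singleton,
      IntermediateField.adjoin_le_iff, Set.singleton_subset_iff]
    change σ (α : Kbar) ∈ F
    have h1 := congrArg σ hrootbar
    simp only [map_sub, map_add, map_mul, map_pow, AlgEquiv.commutes, map_zero] at h1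
    have h2 : (σ (α : Kbar) - α) * (σ (α : Kbar) + algebraMap K Kbar (C • E).a₁ + α) = 0 := by
      linear_combination h1 - hrootbar
    rcases mul_eq_zero.mp h2 with h3 | h3
    · rwa [sub_eq_zero.mp h3]
    · have : σ (α : Kbar) = -(algebraMap K Kbar (C • E).a₁ + α) := by linear_combination h3
      rw [this]
      exact neg_mem (add_mem (algebraMap_mem F _) hαF)
  have := hF.isSeparable
  have : IsGalois K F := ⟨⟩
  -- `E` has split multiplicative reduction over `F`, so that `L ≤ F`
  refine le_antisymm (hmin ⟨hF, (hasSplitReduction_iff_of_le hF hv hFL hC).mpr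
    (.inr (.inl ⟨hΔ, hc, ?_⟩))⟩) hFL
  have hsF : SingularAtOrigin (v.comap (IntermediateField.inclusion hFL : F →+* L))
      ((C • E).baseChange F) := ⟨hs.a₁, hs.a₂, hs.a₃, hs.a₄, hs.a₆⟩
  rw [hsF.splitNode_iff (by rw [baseChange, map_c₄]; exact hc)]
  refine ⟨⟨α, hαF⟩, hα, ?_⟩
  have : (⟨α, hαF⟩ : F) ^ 2 + ((C • E).baseChange F).a₁ * ⟨α, hαF⟩ - ((C • E).baseChange F).a₂ = 0 :=
    Subtype.ext hrootbar
  rw [this, map_zero]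
  exact zero_lt_one

/-- The norm maps `E⁰(L)` onto `E⁰(K)`, in each of the three cases: `L = K`, the reduction has a
cusp, the reduction has a node. -/
theorem IsSmallestSplitting.mapsTo_and_surjOn_norm [IsAlgClosure K Kbar] [IsGalois K L]
    [FiniteDimensional K L] (h : IsSmallestSplitting O E L) (hL : IsFiniteUnramified O K L) :
    Set.MapsTo (norm E L) (hL.E0 E) (E0 O (E.baseChange K)) ∧
      Set.SurjOn (norm E L) (hL.E0 E) (E0 O (E.baseChange K)) := by
  have := hL.isDiscreteValuationRing
  have := hL.isFractionRing
  have hv := integers_valuation (integralClosure O L) L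
  set v := (IsDiscreteValuationRing.maximalIdeal (integralClosure O L)).valuation L
  have hH := hL.isHenselianUnramified hv
  by_cases hbot : L = ⊥
  -- for `L = K` the norm is the identity
  · obtain ⟨C, hC⟩ := exists_isMinimal O E
    rw [isMinimal_iff_minimalCurve (integers_comap (K := K) hv)] at hC
    have hsub : ∀ σ : L ≃ₐ[K] L, σ = 1 := fun σ ↦ by
      ext x
      obtain ⟨y, hy⟩ := IntermediateField.mem_bot.mp (hbot.le x.2)
      have : x = algebraMap K L y := Subtype.ext hy.symm
      rw [this, AlgEquiv.commutes, AlgEquiv.commutes]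
    exact mapsTo_and_surjOn_norm_of_trivial hL hv hC hsub
  obtain ⟨C, hC, hs, hΔ, hcusp⟩ := h.exists_singularAtOrigin hv hbot
  have hs' : SingularAtOrigin v ((C • E).baseChange L) := ⟨hs.a₁, hs.a₂, hs.a₃, hs.a₄, hs.a₆⟩
  refine mapsTo_and_surjOn_norm_of_singularAtOrigin hL hv hC hs' fun P hP ↦ ?_
  obtain ⟨σ, hσ⟩ : ∃ σ : L ≃ₐ[K] L, σ ≠ 1 := by
    by_contra! hσ
    refine hbot (eq_bot_iff.mpr fun x hx ↦ ?_)
    obtain ⟨y, hy⟩ := (IsGalois.mem_range_algebraMap_iff_fixed (F := K) (⟨x, hx⟩ : L)).mpr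
      fun σ ↦ by rw [hσ σ]; rfl
    exact IntermediateField.mem_bot.mpr ⟨y, congrArg Subtype.val hy⟩
  rcases (hC.integral.invariants_le.2.2.2.2.1).lt_or_eq with hc | hc
  · have hcu := hcusp hc
    exact hH.exists_norm_eq_of_cusp ⟨σ, 1, hσ⟩ ⟨hcu.a₁, hcu.a₂, hcu.a₃, hcu.a₄, hcu.a₆⟩ hP
  -- now the reduction has a node, and over `L` it is split multiplicative
  have hc' : v ((C • E).baseChange L).c₄ = 1 := by rw [baseChange, map_c₄]; exact hc
  have hnode : SplitNode v ((C • E).baseChange L) := by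
    obtain ⟨⟨hL', hsplit⟩, -⟩ := h
    rw [hasSplitReduction_iff_of_le hL' hv le_rfl hC] at hsplit
    rcases hsplit with h1 | h1 | h1
    · exact absurd h1 hΔ.ne
    · exact h1.2.2
    · exact absurd hc h1.2.1.ne
  obtain ⟨α, hα, hroot⟩ := hs'.exists_slope hH hc' hnode
  have hadj := h.eq_adjoin_slope hv hC hs hΔ hc hα hroot
  have hext : ∀ σ τ : L ≃ₐ[K] L, σ α = τ α → σ = τ := fun σ τ hστ ↦ by
    have : (σ : L →ₐ[K] L) = τ := IntermediateField.algHom_ext_of_eq_adjoin K hadj fun x hx ↦ by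
      obtain rfl := hx
      exact hστ
    exact AlgEquiv.ext fun x ↦ DFunLike.congr_fun this x
  have hσα : ∀ σ : L ≃ₐ[K] L, σ ≠ 1 → σ α = -((C • E).baseChange L).a₁ - α := fun σ hσ ↦ by
    have h1 := congrArg σ hroot
    have h2 : σ ((C • E).baseChange L).a₁ = ((C • E).baseChange L).a₁ := σ.commutes _
    have h3 : σ ((C • E).baseChange L).a₂ = ((C • E).baseChange L).a₂ := σ.commutes _
    simp only [map_sub, map_add, map_mul, map_pow, h2, h3, map_zero] at h1
    have h4 : (σ α - α) * (σ α - (-((C • E).baseChange L).a₁ - α)) = 0 := by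
      linear_combination h1 - hroot
    exact sub_eq_zero.mp ((mul_eq_zero.mp h4).resolve_left fun h5 ↦
      hσ (hext σ 1 (sub_eq_zero.mp h5)))
  exact hH.exists_norm_eq_of_node hσ
    (fun τ ↦ or_iff_not_imp_left.mpr fun hτ ↦ hext τ σ ((hσα τ hτ).trans (hσα σ hσ).symm)) hs'
    (hσα σ hσ ▸ hs'.nodeSlopes hc' hα hroot) hP

end SmallestSplitting

end UnramifiedNorm

theorem mainTheorem9 (O K Kbar : Type*) [CommRing O] [IsDomain O] [IsDiscreteValuationRing O]
    [HenselianLocalRing O] [PerfectField (IsLocalRing.ResidueField O)]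
    [Field K] [Algebra O K] [IsFractionRing O K]
    [Field Kbar] [Algebra K Kbar] [IsAlgClosure K Kbar] [Algebra O Kbar] [IsScalarTower O K Kbar]
    (E : WeierstrassCurve K) [E.IsElliptic]
    (L : IntermediateField K Kbar) (hL : UnramifiedNorm.IsFiniteUnramified O K L)
    (hmin : UnramifiedNorm.IsSmallestSplitting O E L) :
    ∃ (_ : FiniteDimensional K L) (_ : IsGalois K L),
      Set.MapsTo (UnramifiedNorm.norm E L) (hL.E0 E)
        (UnramifiedNorm.E0 O (E.baseChange K)) ∧
      Set.SurjOn (UnramifiedNorm.norm E L) (hL.E0 E)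
        (UnramifiedNorm.E0 O (E.baseChange K)) := by
  have := hL.finiteDimensional
  have := hmin.isGalois
  exact ⟨inferInstance, inferInstance, hmin.mapsTo_and_surjOn_norm hL⟩
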